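/- **Setting.** For $p=(a,b,c,d)$ put $$\Pi(p)=(A,B,C,D)=(ab+cd,\ bc+ad,\ ac+bd,\ 4-a^2-b^2-c^2-d^2-abcd),$$ $$\Delta(p)=\bigl(2(a^2+b^2+c^2+d^2)-abcd-16\bigr)^2-(4-a^2)(4-b^2)(4-c^2)(4-d^2),$$ and for $p$ real let $S_p$ be the real cubic surface $x^2+y^2+z^2+xyz=Ax+By+Cz+D$ in $\mathbf R^3$. Let $\pi_1=\langle\alpha,\beta,\gamma,\delta\mid\alpha\beta\gamma\delta=1\rangle$ be the fundamental group of the four-punctured sphere. A representation $\rho:\pi_1\to \mathrm{SL}(2,\mathbf C)$ has boundary traces $a,b,c,d=\mathrm{tr}\,\rho(\alpha),\mathrm{tr}\,\rho(\beta),\mathrm{tr}\,\rho(\gamma),\mathrm{tr}\,\rho(\delta)$ and interior traces $x=\mathrm{tr}\,\rho(\alpha\beta)$, $y=\mathrm{tr}\,\rho(\beta\gamma)$, $z=\mathrm{tr}\,\rho(\gamma\alpha)$. A set $U\subset(-2,2)^4$ *corresponds to $\mathrm{SL}(2,\mathbf R)$-representations* if for every $p\in U$ the smooth part of $S_p$ has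 exactly one bounded connected component and, for each point $(x,y,z)$ of it, $(p,x,y,z)$ is the tuple of traces of a representation into $\mathrm{SL}(2,\mathbf R)$ but not of a representation into $\mathrm{SU}(2)$; it *corresponds to $\mathrm{SU}(2)$-representations* if the same holds with the two groups exchanged. Let $G$ be the group of transformations of $\mathbf C^4\ni\theta=(\theta_1,\dots,\theta_4)$ generated by the translations by $n\in\mathbf Z^4$ with $n_1+n_2+n_3+n_4$ even, the permutations of coordinates, the sign changes of coordinates, and the special Okamoto symmetry $\theta_i\mapsto\theta_i-\tfrac12(\theta_1+\theta_2+\theta_3+\theta_4)+1$ $(1\le i\le 4)$. Let $\tau:\mathbf C^4\to\mathbf C^4$, $\tau(\theta)=(2\cos\pi\theta_1,\dots,2\cos\pi\theta_4)$, and let $G_\Pi$ be the set of $g\in G$ with $\Pi\circ\tau\circ g=\Pi\circ\tau$. For $U\subset(-2,2)^4$, a continuous map $s:U\to\mathbf C^4$ with $\tau\circ s=\mathrm{id}_U$ is called a determination of $\theta$ on $U$, and $\tau\circ g\circ s$ is called a branch over $U$ of the Okamoto correspondence induced by $g\in G$. **Proposition.** The set $(-2,2)^4\setminus\{\Delta=0\}$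 has exactly $24$ connected components; exactly $8$ of them correspond to $\mathrm{SL}(2,\mathbf R)$-representations and exactly $16$ to $\mathrm{SU}(2)$-representations. The Okamoto correspondences permute these components transitively, in the following sense. On each component $U$ there is a determination of $\theta$; for every $g\in G$, every component $U$ and every determination $s$ on $U$, the branch $\tau\circ g\circ s$ maps $U$ bijectively onto a component; and for any two components $U,V$ and any determination $s$ on $U$ there is $g\in G_\Pi$ such that $\tau\circ g\circ s$ maps $U$ bijectively onto $V$. -/

import Mathlib

/-! ### The parameter space -/

/-- The open cube `(-2, 2)⁴` of trace parameters `(a, b, c, d)`. -/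
def openCube : Set (Fin 4 → ℝ) := {p | ∀ i, -2 < p i ∧ p i < 2}

/-- The polynomial
`Δ = (2(a² + b² + c² + d²) - abcd - 16)² - (4 - a²)(4 - b²)(4 - c²)(4 - d²)`. -/
def reducibleDisc (p : Fin 4 → ℝ) : ℝ :=
  (2 * (p 0 ^ 2 + p 1 ^ 2 + p 2 ^ 2 + p 3 ^ 2) - p 0 * p 1 * p 2 * p 3 - 16) ^ 2
    - (4 - p 0 ^ 2) * (4 - p 1 ^ 2) * (4 - p 2 ^ 2) * (4 - p 3 ^ 2)

/-- The set `(-2, 2)⁴ \ {Δ = 0}`. -/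
def regularCube : Set (Fin 4 → ℝ) := {p | p ∈ openCube ∧ reducibleDisc p ≠ 0}

/-- The set of connected components of a subset `X` of a topological space. -/
def componentsOf {α : Type*} [TopologicalSpace α] (X : Set α) : Set (Set α) :=
  {U | ∃ x ∈ X, U = connectedComponentIn X x}

/-- The map `Π : (a, b, c, d) ↦ (A, B, C, D)`, over any commutative ring. -/
def cubicParams {R : Type*} [CommRing R] (p : Fin 4 → R) : Fin 4 → R :=
  ![p 0 * p 1 + p 2 * p 3,
    p 1 * p 2 + p 0 * p 3,
    p 0 * p 2 + p 1 * p 3,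
    4 - p 0 ^ 2 - p 1 ^ 2 - p 2 ^ 2 - p 3 ^ 2 - p 0 * p 1 * p 2 * p 3]

/-- Coordinatewise inclusion of real tuples into complex tuples. -/
def complexify {n : ℕ} (v : Fin n → ℝ) : Fin n → ℂ := fun i => (v i : ℂ)

/-! ### The real cubic surfaces and their bounded components -/

/-- The real cubic surface `x² + y² + z² + xyz = Ax + By + Cz + D`, for `q = (A, B, C, D)`. -/
def realCubic (q : Fin 4 → ℝ) : Set (Fin 3 → ℝ) :=
  {m | m 0 ^ 2 + m 1 ^ 2 + m 2 ^ 2 + m 0 * m 1 * m 2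
        = q 0 * m 0 + q 1 * m 1 + q 2 * m 2 + q 3}

/-- The smooth part of the real cubic surface: the points where the gradient of the defining
polynomial does not vanish. -/
def smoothPart (q : Fin 4 → ℝ) : Set (Fin 3 → ℝ) :=
  {m | m ∈ realCubic q ∧
    ¬ (2 * m 0 + m 1 * m 2 = q 0 ∧ 2 * m 1 + m 0 * m 2 = q 1 ∧ 2 * m 2 + m 0 * m 1 = q 2)}

/-- `C` is a bounded connected component of the smooth part of the real cubic surface. -/
def IsBoundedComponent (q : Fin 4 → ℝ) (C : Set (Fin 3 → ℝ)) : Prop :=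
  C ∈ componentsOf (smoothPart q) ∧ Bornology.IsBounded C

/-! ### Representations of the fundamental group of the four-punctured sphere -/

/-- `π₁` of the four-punctured sphere, `⟨α, β, γ, δ | αβγδ = 1⟩`. -/
abbrev FourPuncturedSphereGroup : Type :=
  PresentedGroup ({FreeGroup.of 0 * FreeGroup.of 1 * FreeGroup.of 2 * FreeGroup.of 3} :
    Set (FreeGroup (Fin 4)))

/-- The loops `α, β, γ, δ` around the punctures. -/
def puncLoop (i : Fin 4) : FourPuncturedSphereGroup := PresentedGroup.of i

/-- Representations of the group into `SL(2, ℂ)`. -/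
abbrev SphereRep : Type := FourPuncturedSphereGroup →* Matrix.SpecialLinearGroup (Fin 2) ℂ

/-- The trace of `ρ(g)`. -/
def repTrace (ρ : SphereRep) (g : FourPuncturedSphereGroup) : ℂ :=
  (ρ g : Matrix (Fin 2) (Fin 2) ℂ).trace

/-- The boundary traces `(a, b, c, d)` of a representation. -/
def boundaryTraces (ρ : SphereRep) : Fin 4 → ℂ := fun i => repTrace ρ (puncLoop i)

/-- The interior traces `x = tr ρ(αβ)`, `y = tr ρ(βγ)`, `z = tr ρ(γα)` of a representation. -/
def interiorTraces (ρ : SphereRep) : Fin 3 → ℂ :=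
  ![repTrace ρ (puncLoop 0 * puncLoop 1),
    repTrace ρ (puncLoop 1 * puncLoop 2),
    repTrace ρ (puncLoop 2 * puncLoop 0)]

/-- `ρ` takes its values in `SL(2, ℝ)`. -/
def IsRealRep (ρ : SphereRep) : Prop :=
  ∀ g, ρ g ∈ (Matrix.SpecialLinearGroup.map (n := Fin 2) Complex.ofRealHom).range

/-- `ρ` takes its values in `SU(2)`. -/
def IsUnitaryRep (ρ : SphereRep) : Prop :=
  ∀ g, (ρ g : Matrix (Fin 2) (Fin 2) ℂ) ∈ Matrix.specialUnitaryGroup (Fin 2) ℂ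

/-- `(a, b, c, d, x, y, z)` is the tuple of traces of a representation into `SL(2, ℝ)`. -/
def RealizedInSL2R (p : Fin 4 → ℝ) (m : Fin 3 → ℝ) : Prop :=
  ∃ ρ : SphereRep, IsRealRep ρ ∧ boundaryTraces ρ = complexify p ∧
    interiorTraces ρ = complexify m

/-- `(a, b, c, d, x, y, z)` is the tuple of traces of a representation into `SU(2)`. -/
def RealizedInSU2 (p : Fin 4 → ℝ) (m : Fin 3 → ℝ) : Prop :=
  ∃ ρ : SphereRep, IsUnitaryRep ρ ∧ boundaryTraces ρ = complexify p ∧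
    interiorTraces ρ = complexify m

/-- For every `p` in `U`, the smooth part of the surface with parameters `Π(p)` has exactly one
bounded component, and, with boundary traces `p`, all its points come from representations
into `SL(2, ℝ)` and none from a representation into `SU(2)`. -/
def CorrespondsToSL2R (U : Set (Fin 4 → ℝ)) : Prop :=
  ∀ p ∈ U, ∃ C, IsBoundedComponent (cubicParams p) C ∧
    (∀ C', IsBoundedComponent (cubicParams p) C' → C' = C) ∧
    ∀ m ∈ C, RealizedInSL2R p m ∧ ¬ RealizedInSU2 p m

/-- For every `p` in `U`, the smooth part of the surface with parameters `Π(p)` has exactly one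
bounded component, and, with boundary traces `p`, all its points come from representations
into `SU(2)` and none from a representation into `SL(2, ℝ)`. -/
def CorrespondsToSU2 (U : Set (Fin 4 → ℝ)) : Prop :=
  ∀ p ∈ U, ∃ C, IsBoundedComponent (cubicParams p) C ∧
    (∀ C', IsBoundedComponent (cubicParams p) C' → C' = C) ∧
    ∀ m ∈ C, RealizedInSU2 p m ∧ ¬ RealizedInSL2R p m

/-! ### Okamoto symmetries and correspondences -/

/-- `(θ_α, θ_β, θ_γ, θ_δ) ↦ (a, b, c, d)`, where `a = 2 cos(π θ_α)`, and so on. -/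
noncomputable def traceOfTheta (θ : Fin 4 → ℂ) : Fin 4 → ℂ :=
  fun i => 2 * Complex.cos (Real.pi * θ i)

/-- Translation by an integer vector. -/
def thetaTranslation (n : Fin 4 → ℤ) : Equiv.Perm (Fin 4 → ℂ) :=
  Equiv.addRight (fun i => (n i : ℂ))

/-- Permutation of the coordinates. -/
def thetaPermutation (σ : Equiv.Perm (Fin 4)) : Equiv.Perm (Fin 4 → ℂ) :=
  σ.arrowCongr (Equiv.refl ℂ)

/-- Change of signs of the coordinates. -/
def thetaSigns (ε : Fin 4 → ℤˣ) : Equiv.Perm (Fin 4 → ℂ) :=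
  Function.Involutive.toPerm (fun θ i => ((ε i : ℤ) : ℂ) * θ i) (by
    intro θ
    funext i
    rcases Int.units_eq_one_or (ε i) with h | h <;> simp [h])

/-- The special Okamoto symmetry; its first coordinate is `(θ_α - θ_β - θ_γ - θ_δ) / 2 + 1`,
and similarly for the others. -/
noncomputable def specialOkamoto : Equiv.Perm (Fin 4 → ℂ) :=
  Function.Involutive.toPerm (fun θ i => θ i - (∑ j, θ j) / 2 + 1) (by
    intro θ
    funext i
    simp only [Fin.sum_univ_four]
    ring)

/-- The group of Okamoto symmetries: generated by the translations by integer vectors of even sum,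
the permutations, the sign changes and the special Okamoto symmetry. -/
noncomputable def okamotoGroup : Subgroup (Equiv.Perm (Fin 4 → ℂ)) :=
  Subgroup.closure
    ({g | ∃ n : Fin 4 → ℤ, Even (∑ i, n i) ∧ g = thetaTranslation n} ∪
      Set.range thetaPermutation ∪ Set.range thetaSigns ∪ {specialOkamoto})

/-- `g` is a deck transformation of `(θ_α, θ_β, θ_γ, θ_δ) ↦ (A, B, C, D)`. -/
def FixesCubicParams (g : Equiv.Perm (Fin 4 → ℂ)) : Prop :=
  ∀ θ, cubicParams (traceOfTheta (g θ)) = cubicParams (traceOfTheta θ)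

/-- `s` is a continuous determination on `U` of the multivalued map
`(a, b, c, d) ↦ (θ_α, θ_β, θ_γ, θ_δ)`. -/
def IsThetaDetermination (U : Set (Fin 4 → ℝ)) (s : (Fin 4 → ℝ) → (Fin 4 → ℂ)) : Prop :=
  ContinuousOn s U ∧ ∀ p ∈ U, traceOfTheta (s p) = complexify p

/-- The branch, given by the determination `s`, of the (multivalued) Okamoto correspondence
`(a, b, c, d) ↦ (a', b', c', d')` induced by `g`. -/
noncomputable def okamotoBranch (g : Equiv.Perm (Fin 4 → ℂ))
    (s : (Fin 4 → ℝ) → (Fin 4 → ℂ)) (p : Fin 4 → ℝ) : Fin 4 → ℂ :=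
  traceOfTheta (g (s p))

/-- The branch of the correspondence of `g` given by `s` carries `U` bijectively onto `V`. -/
def OkamotoCarries (g : Equiv.Perm (Fin 4 → ℂ)) (s : (Fin 4 → ℝ) → (Fin 4 → ℂ))
    (U V : Set (Fin 4 → ℝ)) : Prop :=
  Set.BijOn (okamotoBranch g s) U (complexify '' V)

/-! Everything is read off in the angles θ, with a = 2cos πθ₁, and so on. As a function of x,
`commDisc a b`, which is tr [A, B] - 2, is a quadratic polynomial with roots 2cos π(θ₁ ± θ₂).
Likewise `commDisc c d` has roots 2cos π(θ₃ ± θ₄), and Δ is four times the resultant of the two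
(`reducibleDisc_eq`). So Δ ≠ 0 on the cube says that θ avoids the walls θᵢ ∈ ℤ and ±θ₁ ± θ₂ ± θ₃ ±
θ₄ ∈ 2ℤ. In the coordinates w = `centralForm θ` these walls cut the open unit cube into the 16
orthants of the cross-polytope ∑ |w k| < 2 and 8 simplices at alternate vertices of the cube. These
24 convex open chambers give the components.

The kind of a component is found by projecting S_p to x. For -2 < x < 2 the fibre is an ellipse, a
point or empty according to the sign of Q(x) = `commDisc a b x * commDisc c d x`. Off Δ = 0 the four
roots of Q are distinct and lie in [-2, 2]. The part of the surface over the middle interval is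
compact and connected, and every other point is joined to infinity (`bounded_component_unique`).
Over that interval both quadratics are ≤ 0 if the two root intervals overlap (`central_overlap`),
and both are ≥ 0 if they are disjoint (`corner_gap`). Pairs in SU(2) have `commDisc` ≤ 0, and pairs
in SL(2, ℝ) with elliptic first member have `commDisc` ≥ 0. Conversely, a strict sign yields a pair
in the corresponding group, and linear algebra in the span of 1, A, B, AB - BA completes it to a
quadruple (`third_matrix_traces`, `RealizedIn.of_pair`).

For transitivity, the walls are those of an affine reflection group of type D₄. The Okamoto group
preserves their union (`exists_actsOnRegular_of_mem`), and on each cell of the complement the trace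
map is a bijection onto a component (`bijOn_cosTrace_component`). The special Okamoto symmetry is
the reflection in θ₁ + θ₂ + θ₃ + θ₄ = 2 and preserves Π (`specialOkamoto_mem_deckGroup`).
Conjugating it by deck transformations gives the reflections in all the sign walls, and with these
every regular θ can be folded into one chamber (`exists_deckRelated_baseChamber`). -/

/-! ### Traces of pairs and triples of unimodular matrices -/

/-- Given `2 × 2` matrices `A`, `B` of determinant one with traces `a`, `b` and `tr (AB) = x`, a
linear combination `C` of `1`, `A`, `B` and `AB - BA` with prescribed traces. -/
lemma third_matrix_traces {L : Type*} [Field L] [CharZero L]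
    (A B : Matrix (Fin 2) (Fin 2) L) (hA : A.det = 1) (hB : B.det = 1)
    {a b c d x y z l m n : L} (ha : A.trace = a) (hb : B.trace = b) (hx : (A * B).trace = x)
    (h1 : l * (1 - a ^ 2 / 4) + m * (a * b / 4 - x / 2) = a * c / 4 - z / 2)
    (h2 : l * (a * b / 4 - x / 2) + m * (1 - b ^ 2 / 4) = b * c / 4 - y / 2)
    (h3 : n * ((1 - a ^ 2 / 4) * (1 - b ^ 2 / 4) - (a * b / 4 - x / 2) ^ 2)
      = x * c / 4 - a * (b * c / 4 - y / 2) / 2 - b * (a * c / 4 - z / 2) / 2 - d / 2)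
    (h4 : c ^ 2 / 4 + l * (a * c / 4 - z / 2) + m * (b * c / 4 - y / 2)
      + n * (x * c / 4 - a * (b * c / 4 - y / 2) / 2 - b * (a * c / 4 - z / 2) / 2 - d / 2) = 1)
    {C : Matrix (Fin 2) (Fin 2) L}
    (hC : C = (c / 2 - l * a / 2 - m * b / 2) • (1 : Matrix (Fin 2) (Fin 2) L) + l • A + m • B
      + (n / 2) • (A * B - B * A)) :
    C.det = 1 ∧ C.trace = c ∧ (B * C).trace = y ∧ (C * A).trace = z ∧ (A * B * C).trace = d := by
  -- Split A and B into scalar and traceless parts. On traceless matrices the determinant is a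
  -- quadratic form, and 1 - a²/4, 1 - b²/4, a b/4 - x/2 are the Gram entries of the two traceless
  -- parts. Then `h1`, `h2`, `h3` prescribe the pairings of the traceless part of C with those of A,
  -- B and (AB - BA)/2, while `h4` says det C = 1.
  obtain ⟨u1, hu1⟩ : ∃ u1, A 0 0 = a / 2 + u1 := ⟨A 0 0 - a / 2, by ring⟩
  obtain ⟨v1, hv1⟩ : ∃ v1, B 0 0 = b / 2 + v1 := ⟨B 0 0 - b / 2, by ring⟩
  rw [Matrix.trace_fin_two] at ha hb
  have hu4 : A 1 1 = a / 2 - u1 := by linear_combination ha - hu1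
  have hv4 : B 1 1 = b / 2 - v1 := by linear_combination hb - hv1
  rw [Matrix.det_fin_two] at hA hB
  rw [hu1, hu4] at hA
  rw [hv1, hv4] at hB
  simp only [Matrix.trace_fin_two, Matrix.mul_apply, Fin.sum_univ_two, hu1, hu4, hv1, hv4] at hx
  have hU : 1 - a ^ 2 / 4 = -(u1 ^ 2 + A 0 1 * A 1 0) := by linear_combination -hA
  have hV : 1 - b ^ 2 / 4 = -(v1 ^ 2 + B 0 1 * B 1 0) := by linear_combination -hB
  have hP : a * b / 4 - x / 2 = -(u1 * v1 + (A 0 1 * B 1 0 + A 1 0 * B 0 1) / 2) := by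
    linear_combination hx / 2
  obtain ⟨r, hr⟩ : ∃ r, r = a * c / 4 - z / 2 := ⟨_, rfl⟩
  obtain ⟨t, ht⟩ : ∃ t, t = b * c / 4 - y / 2 := ⟨_, rfl⟩
  obtain ⟨e, he⟩ : ∃ e, e = x * c / 4 - a * t / 2 - b * r / 2 - d / 2 := ⟨_, rfl⟩
  rw [← hr, hU, hP] at h1
  rw [← ht, hV, hP] at h2
  rw [← ht, ← hr, ← he, hU, hV, hP] at h3
  rw [← ht, ← hr, ← he] at h4
  have hx' : x = a * b / 2 + 2 * (u1 * v1 + (A 0 1 * B 1 0 + A 1 0 * B 0 1) / 2) := by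
    linear_combination -2 * hP
  subst hC
  simp only [Matrix.det_fin_two, Matrix.trace_fin_two, Matrix.mul_apply, Fin.sum_univ_two,
    Matrix.add_apply, Matrix.sub_apply, Matrix.smul_apply, smul_eq_mul, Matrix.one_apply_eq,
    hu1, hu4, hv1, hv4, Matrix.one_apply_ne (show (0 : Fin 2) ≠ 1 by decide),
    Matrix.one_apply_ne (show (1 : Fin 2) ≠ 0 by decide)]
  clear hu1 hu4 hv1 hv4 ha hb
  generalize A 0 1 = u2 at *
  generalize A 1 0 = u3 at *
  generalize B 0 1 = v2 at *
  generalize B 1 0 = v3 at *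
  refine ⟨?_, ?_, ?_, ?_, ?_⟩
  · linear_combination l * h1 + m * h2 + n * h3 + h4
  · ring
  · linear_combination -2 * h2 - 2 * ht
  · linear_combination -2 * h1 - 2 * hr
  · linear_combination -2 * h3 - 2 * he - a * h2 - b * h1 - c / 2 * hx'

/-- The value of `tr [A, B] - 2`, for `a = tr A`, `b = tr B` and `x = tr (AB)`. -/
def commDisc {R : Type*} [CommRing R] (a b x : R) : R := x ^ 2 - a * b * x + a ^ 2 + b ^ 2 - 4

/-- Cramer's rule: the Gram determinant is -`commDisc a b x` / 4, so the three linear equations are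
solvable. Once their solution is inserted, the determinant condition is exactly the equation of the
cubic surface. -/
lemma exists_third_matrix_coeffs {a b c d x y z : ℝ} (hF : commDisc a b x ≠ 0)
    (hS : x ^ 2 + y ^ 2 + z ^ 2 + x * y * z = (a * b + c * d) * x + (b * c + a * d) * y
      + (a * c + b * d) * z + (4 - a ^ 2 - b ^ 2 - c ^ 2 - d ^ 2 - a * b * c * d)) :
    ∃ l m n : ℝ,
      l * (1 - a ^ 2 / 4) + m * (a * b / 4 - x / 2) = a * c / 4 - z / 2 ∧
      l * (a * b / 4 - x / 2) + m * (1 - b ^ 2 / 4) = b * c / 4 - y / 2 ∧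
      n * ((1 - a ^ 2 / 4) * (1 - b ^ 2 / 4) - (a * b / 4 - x / 2) ^ 2)
        = x * c / 4 - a * (b * c / 4 - y / 2) / 2 - b * (a * c / 4 - z / 2) / 2 - d / 2 ∧
      c ^ 2 / 4 + l * (a * c / 4 - z / 2) + m * (b * c / 4 - y / 2)
        + n * (x * c / 4 - a * (b * c / 4 - y / 2) / 2 - b * (a * c / 4 - z / 2) / 2 - d / 2)
          = 1 := by
  have hN : (1 - a ^ 2 / 4) * (1 - b ^ 2 / 4) - (a * b / 4 - x / 2) ^ 2 ≠ 0 := by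
    intro h
    apply hF
    unfold commDisc
    linear_combination -4 * h
  obtain ⟨N, hNdef⟩ : ∃ N, N = (1 - a ^ 2 / 4) * (1 - b ^ 2 / 4) - (a * b / 4 - x / 2) ^ 2 :=
    ⟨_, rfl⟩
  rw [← hNdef] at hN ⊢
  refine ⟨((a * c / 4 - z / 2) * (1 - b ^ 2 / 4) - (b * c / 4 - y / 2) * (a * b / 4 - x / 2)) / N,
    ((b * c / 4 - y / 2) * (1 - a ^ 2 / 4) - (a * c / 4 - z / 2) * (a * b / 4 - x / 2)) / N,
    (x * c / 4 - a * (b * c / 4 - y / 2) / 2 - b * (a * c / 4 - z / 2) / 2 - d / 2) / N,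
    ?_, ?_, ?_, ?_⟩
  · rw [div_mul_eq_mul_div, div_mul_eq_mul_div, ← add_div, div_eq_iff hN]
    linear_combination (-(a * c / 4 - z / 2)) * hNdef
  · rw [div_mul_eq_mul_div, div_mul_eq_mul_div, ← add_div, div_eq_iff hN]
    linear_combination (-(b * c / 4 - y / 2)) * hNdef
  · rw [div_mul_cancel₀ _ hN]
  · rw [div_mul_eq_mul_div, div_mul_eq_mul_div, div_mul_eq_mul_div, add_assoc, add_assoc,
      ← add_div, ← add_div, ← eq_sub_iff_add_eq', div_eq_iff hN]
    linear_combination (-(1 - c ^ 2 / 4)) * hNdef + hS / 4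

/-! ### Representations as quadruples of matrices -/

abbrev SL2C : Type := Matrix.SpecialLinearGroup (Fin 2) ℂ

lemma trace_inv_of_det_one {L : Type*} [CommRing L] (A : Matrix.SpecialLinearGroup (Fin 2) L) :
    ((A⁻¹ : Matrix.SpecialLinearGroup (Fin 2) L) : Matrix (Fin 2) (Fin 2) L).trace
      = (A : Matrix (Fin 2) (Fin 2) L).trace := by
  rw [Matrix.SpecialLinearGroup.coe_inv, Matrix.adjugate_fin_two, Matrix.trace_fin_two,
    Matrix.trace_fin_two]
  simp [add_comm]

/-- The traces `(p, m)` are realized by four elements of `K` with product one. -/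
def RealizedIn (K : Subgroup SL2C) (p : Fin 4 → ℝ) (m : Fin 3 → ℝ) : Prop :=
  ∃ A ∈ K, ∃ B ∈ K, ∃ C ∈ K, ∃ D ∈ K, A * B * C * D = 1 ∧
    A.1.trace = p 0 ∧ B.1.trace = p 1 ∧ C.1.trace = p 2 ∧ D.1.trace = p 3 ∧
    (A * B).1.trace = m 0 ∧ (B * C).1.trace = m 1 ∧ (C * A).1.trace = m 2

/-- By the universal property of the presentation. Building the homomorphism into K itself makes all
its values lie in K, not just those on the generators. -/
lemma exists_rep_iff_realizedIn (K : Subgroup SL2C) (p : Fin 4 → ℝ) (m : Fin 3 → ℝ) :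
    (∃ ρ : SphereRep, (∀ g, ρ g ∈ K) ∧ boundaryTraces ρ = complexify p ∧
      interiorTraces ρ = complexify m) ↔ RealizedIn K p m := by
  constructor
  · rintro ⟨ρ, hK, hp, hm⟩
    refine ⟨ρ (puncLoop 0), hK _, ρ (puncLoop 1), hK _, ρ (puncLoop 2), hK _, ρ (puncLoop 3), hK _,
      ?_, congrFun hp 0, congrFun hp 1, congrFun hp 2, congrFun hp 3, ?_, ?_, ?_⟩
    · rw [← map_mul, ← map_mul, ← map_mul, ← map_one ρ]
      congr 1
      exact PresentedGroup.one_of_mem (Set.mem_singleton _)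
    · rw [← map_mul]; exact congrFun hm 0
    · rw [← map_mul]; exact congrFun hm 1
    · rw [← map_mul]; exact congrFun hm 2
  · rintro ⟨A, hA, B, hB, C, hC, D, hD, h1, ha, hb, hc, hd, hx, hy, hz⟩
    let f : Fin 4 → K := ![⟨A, hA⟩, ⟨B, hB⟩, ⟨C, hC⟩, ⟨D, hD⟩]
    have hf : ∀ r ∈ ({FreeGroup.of 0 * FreeGroup.of 1 * FreeGroup.of 2 * FreeGroup.of 3} :
        Set (FreeGroup (Fin 4))), FreeGroup.lift f r = 1 := by
      rintro r rfl
      apply Subtype.ext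
      simpa [f] using h1
    have key : ∀ i, K.subtype (PresentedGroup.toGroup hf (puncLoop i)) = f i := by
      intro i
      simp only [puncLoop, PresentedGroup.toGroup.of, Subgroup.coe_subtype]
    refine ⟨K.subtype.comp (PresentedGroup.toGroup hf), fun g => Subtype.prop _, ?_, ?_⟩
    · funext i
      simp only [boundaryTraces, repTrace, MonoidHom.comp_apply, key, complexify]
      fin_cases i
      exacts [ha, hb, hc, hd]
    · funext i
      simp only [interiorTraces, repTrace, MonoidHom.comp_apply, map_mul, key, complexify]
      fin_cases i
      exacts [hx, hy, hz]

/-- Since CD = (AB)⁻¹ and DA = (BC)⁻¹, the interior traces survive the cyclic shift by two. This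
lets a representation be built from the pair (C, D) at points where `commDisc a b x` vanishes. -/
lemma RealizedIn.rotate {K : Subgroup SL2C} {a b c d x y z : ℝ}
    (h : RealizedIn K ![c, d, a, b] ![x, y, z]) : RealizedIn K ![a, b, c, d] ![x, y, z] := by
  obtain ⟨C, hC, D, hD, A, hA, B, hB, h1, hc, hd, ha, hb, hx, hy, hz⟩ := h
  have h2 : A * B = (C * D)⁻¹ := eq_inv_of_mul_eq_one_right (by rw [← h1]; group)
  have h3 : B * C = (D * A)⁻¹ := by
    rw [eq_inv_iff_mul_eq_one]
    calc B * C * (D * A) = B * (C * D * A * B) * B⁻¹ := by group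
      _ = 1 := by rw [h1]; group
  refine ⟨A, hA, B, hB, C, hC, D, hD, ?_, ha, hb, hc, hd, ?_, ?_, ?_⟩
  · rw [h2]; group
  · rw [h2, trace_inv_of_det_one]; exact hx
  · rw [h3, trace_inv_of_det_one]; exact hy
  · have : (C * A).1.trace = (A * C).1.trace := Matrix.trace_mul_comm _ _
    rw [this]; exact hz

/-- `SL(2, ℝ)`, as a subgroup of `SL(2, ℂ)`. -/
def realSL2 : Subgroup SL2C := (Matrix.SpecialLinearGroup.map (n := Fin 2) Complex.ofRealHom).range

/-- `SU(2)`, as a subgroup of `SL(2, ℂ)`. -/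
def unitarySL2 : Subgroup SL2C where
  carrier := {A | A.1 ∈ Matrix.specialUnitaryGroup (Fin 2) ℂ}
  mul_mem' := fun {A B} hA hB => by
    simpa using mul_mem hA hB
  one_mem' := by simp
  inv_mem' := fun {A} hA => by
    have h := (Matrix.mem_specialUnitaryGroup_iff.1 hA).1
    have h1 : (A⁻¹).1 = star A.1 := by
      have h2 : A.1 * star A.1 = 1 := Matrix.mem_unitaryGroup_iff.1 h
      have h3 : (A⁻¹).1 * A.1 = 1 := by
        rw [← Matrix.SpecialLinearGroup.coe_mul, inv_mul_cancel, Matrix.SpecialLinearGroup.coe_one]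
      calc (A⁻¹).1 = (A⁻¹).1 * (A.1 * star A.1) := by rw [h2, mul_one]
        _ = star A.1 := by rw [← mul_assoc, h3, one_mul]
    show (A⁻¹).1 ∈ Matrix.specialUnitaryGroup (Fin 2) ℂ
    rw [Matrix.mem_specialUnitaryGroup_iff]
    refine ⟨?_, (A⁻¹).2⟩
    rw [h1]
    exact Unitary.star_mem h

lemma realizedInSL2R_iff (p : Fin 4 → ℝ) (m : Fin 3 → ℝ) :
    RealizedInSL2R p m ↔ RealizedIn realSL2 p m := exists_rep_iff_realizedIn realSL2 p m

lemma realizedInSU2_iff (p : Fin 4 → ℝ) (m : Fin 3 → ℝ) :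
    RealizedInSU2 p m ↔ RealizedIn unitarySL2 p m := exists_rep_iff_realizedIn unitarySL2 p m

/-- Two-by-two matrices with `M* = adj M`, a copy of the quaternions, meet `SL(2, ℂ)` in `SU(2)`. -/
lemma mem_unitarySL2_iff (A : SL2C) : A ∈ unitarySL2 ↔ star A.1 = A.1.adjugate := by
  have hdet : A.1.det = 1 := A.2
  constructor
  · intro h
    have h2 : A.1 * star A.1 = 1 :=
      Matrix.mem_unitaryGroup_iff.1 (Matrix.mem_specialUnitaryGroup_iff.1 h).1
    have h3 : A.1.adjugate * A.1 = 1 := by rw [Matrix.adjugate_mul, hdet, one_smul]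
    calc star A.1 = A.1.adjugate * A.1 * star A.1 := by rw [h3, one_mul]
      _ = A.1.adjugate := by rw [mul_assoc, h2, mul_one]
  · intro h
    refine Matrix.mem_specialUnitaryGroup_iff.2 ⟨Matrix.mem_unitaryGroup_iff.2 ?_, hdet⟩
    rw [h, Matrix.mul_adjugate, hdet, one_smul]

/-- For unit quaternions with imaginary parts u and v, `commDisc` equals -4|u × v|², by Lagrange's
identity. -/
lemma commDisc_nonpos_of_unitary {A B : SL2C} (hA : A ∈ unitarySL2) (hB : B ∈ unitarySL2)
    {a b x : ℝ} (ha : A.1.trace = a) (hb : B.1.trace = b) (hx : (A * B).1.trace = x) :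
    commDisc a b x ≤ 0 := by
  have entries : ∀ M : SL2C, M ∈ unitarySL2 → ∃ p q r s : ℝ, M.1 0 0 = p + q * Complex.I ∧
      M.1 0 1 = r + s * Complex.I ∧ M.1 1 0 = -r + s * Complex.I ∧ M.1 1 1 = p - q * Complex.I ∧
      p ^ 2 + q ^ 2 + r ^ 2 + s ^ 2 = 1 := by
    intro M hM
    have h := (mem_unitarySL2_iff M).1 hM
    rw [Matrix.adjugate_fin_two] at h
    have h0 := congrFun (congrFun h 0) 0
    have h1 := congrFun (congrFun h 1) 0
    have hdet : M.1.det = 1 := M.2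
    rw [Matrix.det_fin_two] at hdet
    simp [Matrix.star_apply] at h0 h1
    have h3 : M.1 1 0 = -(starRingEnd ℂ) (M.1 0 1) := by rw [h1, neg_neg]
    rw [← h0, h3] at hdet
    refine ⟨(M.1 0 0).re, (M.1 0 0).im, (M.1 0 1).re, (M.1 0 1).im, ?_, ?_, ?_, ?_, ?_⟩
    · exact (Complex.re_add_im _).symm
    · exact (Complex.re_add_im _).symm
    · rw [h3]; apply Complex.ext <;> simp
    · rw [← h0]; apply Complex.ext <;> simp
    · have := congrArg Complex.re hdet
      simp at this
      linear_combination this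
  obtain ⟨p, q, r, s, h1, h2, h3, h4, h5⟩ := entries A hA
  obtain ⟨p', q', r', s', h1', h2', h3', h4', h5'⟩ := entries B hB
  rw [Matrix.trace_fin_two, h1, h4] at ha
  rw [Matrix.trace_fin_two, h1', h4'] at hb
  rw [Matrix.SpecialLinearGroup.coe_mul, Matrix.trace_fin_two] at hx
  simp only [Matrix.mul_apply, Fin.sum_univ_two] at hx
  rw [h1, h2, h3, h4, h1', h2', h3', h4'] at hx
  have ha' : 2 * p = a := by have := congrArg Complex.re ha; simp at this; linarith
  have hb' : 2 * p' = b := by have := congrArg Complex.re hb; simp at this; linarith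
  have hx' : 2 * (p * p' - q * q' - r * r' - s * s') = x := by
    have := congrArg Complex.re hx; simp at this; linarith
  unfold commDisc
  rw [← ha', ← hb', ← hx']
  have h6 : p ^ 2 = 1 - (q ^ 2 + r ^ 2 + s ^ 2) := by linarith
  have h7 : p' ^ 2 = 1 - (q' ^ 2 + r' ^ 2 + s' ^ 2) := by linarith
  have : 0 ≤ 4 * ((q * r' - r * q') ^ 2 + (q * s' - s * q') ^ 2 + (r * s' - s * r') ^ 2) := by
    positivity
  linear_combination this + (4 - 4 * p' ^ 2) * h6 + 4 * (q ^ 2 + r ^ 2 + s ^ 2) * h7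

lemma trace_map_ofReal (M : Matrix.SpecialLinearGroup (Fin 2) ℝ) :
    (Matrix.SpecialLinearGroup.map Complex.ofRealHom M).1.trace = ((M.1.trace : ℝ) : ℂ) := by
  simp [Matrix.trace_fin_two]

/-- On traceless real matrices the determinant form has signature (1, 2). Ellipticity of A makes its
traceless part a positive vector, and a plane containing such a vector has Gram determinant U V - P²
≤ 0. -/
lemma commDisc_nonneg_of_real {A B : SL2C} (hA : A ∈ realSL2) (hB : B ∈ realSL2)
    {a b x : ℝ} (ha : A.1.trace = a) (hb : B.1.trace = b) (hx : (A * B).1.trace = x)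
    (ha2 : a ^ 2 < 4) : 0 ≤ commDisc a b x := by
  obtain ⟨A, rfl⟩ := hA
  obtain ⟨B, rfl⟩ := hB
  rw [← map_mul, trace_map_ofReal] at hx
  rw [trace_map_ofReal] at ha hb
  have ha := Complex.ofReal_injective ha
  have hb := Complex.ofReal_injective hb
  have hx := Complex.ofReal_injective hx
  have hdA : A.1.det = 1 := A.2
  have hdB : B.1.det = 1 := B.2
  rw [Matrix.SpecialLinearGroup.coe_mul] at hx
  rw [Matrix.det_fin_two] at hdA hdB
  simp only [Matrix.trace_fin_two, Matrix.mul_apply, Fin.sum_univ_two] at ha hb hx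
  generalize A.1 0 0 = p at *
  generalize A.1 0 1 = u2 at *
  generalize A.1 1 0 = u3 at *
  generalize A.1 1 1 = s at *
  generalize B.1 0 0 = p' at *
  generalize B.1 0 1 = v2 at *
  generalize B.1 1 0 = v3 at *
  generalize B.1 1 1 = s' at *
  obtain ⟨u1, hu1⟩ : ∃ u1, u1 = (p - s) / 2 := ⟨_, rfl⟩
  obtain ⟨v1, hv1⟩ : ∃ v1, v1 = (p' - s') / 2 := ⟨_, rfl⟩
  obtain rfl : p = a / 2 + u1 := by linarith
  obtain rfl : s = a / 2 - u1 := by linarith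
  obtain rfl : p' = b / 2 + v1 := by linarith
  obtain rfl : s' = b / 2 - v1 := by linarith
  obtain ⟨U, hU⟩ : ∃ U, U = -(u1 ^ 2 + u2 * u3) := ⟨_, rfl⟩
  obtain ⟨V, hV⟩ : ∃ V, V = -(v1 ^ 2 + v2 * v3) := ⟨_, rfl⟩
  obtain ⟨P, hP⟩ : ∃ P, P = -(u1 * v1 + (u2 * v3 + u3 * v2) / 2) := ⟨_, rfl⟩
  have hU' : a ^ 2 = 4 - 4 * U := by linear_combination 4 * hdA + 4 * hU
  have hV' : b ^ 2 = 4 - 4 * V := by linear_combination 4 * hdB + 4 * hV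
  have hx' : x = a * b / 2 - 2 * P := by linear_combination -hx + 2 * hP
  have hUpos : 0 < U := by linarith
  -- A vanishing upper right entry would give U = -u1² ≤ 0.
  have hu2 : u2 ≠ 0 := by
    rintro rfl
    nlinarith [sq_nonneg u1]
  -- Subtracting k times the traceless part of A from that of B kills the upper right entry, so the
  -- form is ≤ 0 there. A quadratic in k with leading coefficient U > 0 that takes such a value has
  -- nonnegative discriminant.
  obtain ⟨k, hk⟩ : ∃ k, k * u2 = v2 := ⟨v2 / u2, div_mul_cancel₀ _ hu2⟩
  have h1 : V - 2 * k * P + k ^ 2 * U ≤ 0 := by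
    have : V - 2 * k * P + k ^ 2 * U = -(v1 - k * u1) ^ 2 := by
      rw [hU, hV, hP, ← hk]; ring
    rw [this]
    nlinarith [sq_nonneg (v1 - k * u1)]
  have h2 : U * V ≤ P ^ 2 := by
    nlinarith [mul_nonpos_of_nonneg_of_nonpos hUpos.le h1, sq_nonneg (k * U - P)]
  have : commDisc a b x = 4 * (P ^ 2 - U * V) := by
    unfold commDisc
    rw [hx']
    linear_combination (1 - b ^ 2 / 4) * hU' + U * hV'
  rw [this]
  linarith

lemma RealizedIn.commDisc_nonpos {a b c d x y z : ℝ}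
    (h : RealizedIn unitarySL2 ![a, b, c, d] ![x, y, z]) :
    commDisc a b x ≤ 0 ∧ commDisc c d x ≤ 0 := by
  obtain ⟨A, hA, B, hB, C, hC, D, hD, h1, ha, hb, hc, hd, hx, hy, hz⟩ := h
  have h2 : C * D = (A * B)⁻¹ := eq_inv_of_mul_eq_one_right (by rw [← h1]; group)
  refine ⟨commDisc_nonpos_of_unitary hA hB ha hb hx, commDisc_nonpos_of_unitary hC hD hc hd ?_⟩
  rw [h2, trace_inv_of_det_one]
  exact hx

lemma RealizedIn.commDisc_nonneg {a b c d x y z : ℝ} (ha2 : a ^ 2 < 4) (hc2 : c ^ 2 < 4)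
    (h : RealizedIn realSL2 ![a, b, c, d] ![x, y, z]) :
    0 ≤ commDisc a b x ∧ 0 ≤ commDisc c d x := by
  obtain ⟨A, hA, B, hB, C, hC, D, hD, h1, ha, hb, hc, hd, hx, hy, hz⟩ := h
  have h2 : C * D = (A * B)⁻¹ := eq_inv_of_mul_eq_one_right (by rw [← h1]; group)
  refine ⟨commDisc_nonneg_of_real hA hB ha hb hx ha2, commDisc_nonneg_of_real hC hD hc hd ?_ hc2⟩
  rw [h2, trace_inv_of_det_one]
  exact hx

/-- Completion of a pair to a quadruple with prescribed traces. -/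
lemma RealizedIn.of_pair {K : Subgroup SL2C} {a b c d x y z : ℝ} (hF : commDisc a b x ≠ 0)
    (hS : x ^ 2 + y ^ 2 + z ^ 2 + x * y * z = (a * b + c * d) * x + (b * c + a * d) * y
      + (a * c + b * d) * z + (4 - a ^ 2 - b ^ 2 - c ^ 2 - d ^ 2 - a * b * c * d))
    {A B : SL2C} (hA : A ∈ K) (hB : B ∈ K) (ha : A.1.trace = a) (hb : B.1.trace = b)
    (hx : (A * B).1.trace = x)
    (hK : ∀ C : SL2C, ∀ t l m n : ℝ, C.1 = (t : ℂ) • (1 : Matrix (Fin 2) (Fin 2) ℂ)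
      + (l : ℂ) • A.1 + (m : ℂ) • B.1 + (n : ℂ) • (A.1 * B.1 - B.1 * A.1) → C ∈ K) :
    RealizedIn K ![a, b, c, d] ![x, y, z] := by
  obtain ⟨l, m, n, h1, h2, h3, h4⟩ := exists_third_matrix_coeffs hF hS
  have h1' := congrArg (Complex.ofReal) h1
  have h2' := congrArg (Complex.ofReal) h2
  have h3' := congrArg (Complex.ofReal) h3
  have h4' := congrArg (Complex.ofReal) h4
  push_cast at h1' h2' h3' h4'
  obtain ⟨k1, k2, k3, k4, k5⟩ := third_matrix_traces A.1 B.1 A.2 B.2 ha hb hx h1' h2' h3' h4' rfl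
  let C : SL2C := ⟨_, k1⟩
  -- The coefficients are real. For both groups K in use, K is the set of elements of determinant
  -- one in a real algebra (real matrices or quaternions), and this gives `hK`.
  have hC : C ∈ K := by
    apply hK C (c / 2 - l * a / 2 - m * b / 2) l m (n / 2)
    push_cast
    rfl
  refine ⟨A, hA, B, hB, C, hC, (A * B * C)⁻¹, inv_mem (mul_mem (mul_mem hA hB) hC),
    mul_inv_cancel _, ha, hb, k2, ?_, hx, k3, k4⟩
  rw [trace_inv_of_det_one]
  exact k5

/-- Normal form of the pair: A is diagonal and B has real off-diagonal entries ±w. The trace of AB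
fixes v, and det B = 1 forces w² = -`commDisc a b x` / (4u²), which has a real solution by the sign
hypothesis. -/
lemma realizedIn_unitary_of_lt {a b c d x y z : ℝ} (ha : a ^ 2 < 4) (hF : commDisc a b x < 0)
    (hS : x ^ 2 + y ^ 2 + z ^ 2 + x * y * z = (a * b + c * d) * x + (b * c + a * d) * y
      + (a * c + b * d) * z + (4 - a ^ 2 - b ^ 2 - c ^ 2 - d ^ 2 - a * b * c * d)) :
    RealizedIn unitarySL2 ![a, b, c, d] ![x, y, z] := by
  obtain ⟨u, hu0, hu⟩ : ∃ u : ℝ, u ≠ 0 ∧ u ^ 2 = 1 - a ^ 2 / 4 :=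
    ⟨√(1 - a ^ 2 / 4), (Real.sqrt_pos.2 (by linarith)).ne', Real.sq_sqrt (by linarith)⟩
  obtain ⟨v, hv⟩ : ∃ v : ℝ, u * v = a * b / 4 - x / 2 :=
    ⟨(a * b / 4 - x / 2) / u, mul_div_cancel₀ _ hu0⟩
  have hw0 : 0 ≤ 1 - b ^ 2 / 4 - v ^ 2 := by
    have h1 : u ^ 2 * (1 - b ^ 2 / 4 - v ^ 2) = -commDisc a b x / 4 := by
      unfold commDisc
      linear_combination (1 - b ^ 2 / 4) * hu - (u * v + (a * b / 4 - x / 2)) * hv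
    have h2 : 0 < u ^ 2 := by positivity
    by_contra h
    nlinarith [mul_neg_of_pos_of_neg h2 (not_le.1 h)]
  obtain ⟨w, hw⟩ : ∃ w : ℝ, w ^ 2 = 1 - b ^ 2 / 4 - v ^ 2 := ⟨_, Real.sq_sqrt hw0⟩
  have huC : (u : ℂ) ^ 2 = 1 - a ^ 2 / 4 := by exact_mod_cast congrArg Complex.ofReal hu
  have hvC : (u : ℂ) * v = a * b / 4 - x / 2 := by exact_mod_cast congrArg Complex.ofReal hv
  have hwC : (w : ℂ) ^ 2 = 1 - b ^ 2 / 4 - v ^ 2 := by exact_mod_cast congrArg Complex.ofReal hw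
  let A : SL2C := ⟨!![a / 2 + u * Complex.I, 0; 0, a / 2 - u * Complex.I], by
    rw [Matrix.det_fin_two_of]
    linear_combination huC - u ^ 2 * Complex.I_sq⟩
  let B : SL2C := ⟨!![b / 2 + v * Complex.I, w; -w, b / 2 - v * Complex.I], by
    rw [Matrix.det_fin_two_of]
    linear_combination hwC - v ^ 2 * Complex.I_sq⟩
  have hA : star A.1 = A.1.adjugate := by
    ext i j
    fin_cases i <;> fin_cases j <;>
      simp [A, Matrix.adjugate_fin_two, Matrix.star_apply, sub_eq_add_neg]
  have hB : star B.1 = B.1.adjugate := by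
    ext i j
    fin_cases i <;> fin_cases j <;>
      simp [B, Matrix.adjugate_fin_two, Matrix.star_apply, sub_eq_add_neg]
  refine RealizedIn.of_pair (A := A) (B := B) hF.ne hS ((mem_unitarySL2_iff A).2 hA)
    ((mem_unitarySL2_iff B).2 hB) ?_ ?_ ?_ ?_
  · simp [A, Matrix.trace_fin_two]
  · simp [B, Matrix.trace_fin_two]
  · rw [Matrix.SpecialLinearGroup.coe_mul, Matrix.trace_fin_two]
    simp [A, B, Matrix.mul_apply, Fin.sum_univ_two]
    linear_combination -2 * hvC + 2 * u * v * Complex.I_sq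
  · intro C t l m n hC
    rw [mem_unitarySL2_iff, hC]
    have h1 : star (A.1 * B.1 - B.1 * A.1) = (A.1 * B.1 - B.1 * A.1).adjugate := by
      have sub : ∀ M N : Matrix (Fin 2) (Fin 2) ℂ,
          (M - N).adjugate = M.adjugate - N.adjugate := by
        intro M N
        ext i j
        fin_cases i <;> fin_cases j <;> simp [Matrix.adjugate_fin_two] <;> ring
      rw [star_sub, star_mul, star_mul, sub, Matrix.adjugate_mul_distrib,
        Matrix.adjugate_mul_distrib, hA, hB]
    have add : ∀ M N : Matrix (Fin 2) (Fin 2) ℂ,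
        (M + N).adjugate = M.adjugate + N.adjugate := by
      intro M N
      ext i j
      fin_cases i <;> fin_cases j <;> simp [Matrix.adjugate_fin_two] <;> ring
    have smul : ∀ (r : ℝ) (M : Matrix (Fin 2) (Fin 2) ℂ), star M = M.adjugate →
        star ((r : ℂ) • M) = ((r : ℂ) • M).adjugate := by
      intro r M hM
      rw [star_smul, hM, Matrix.adjugate_smul]
      simp
    rw [add, add, add, star_add, star_add, star_add, smul _ _ (by simp), smul _ _ hA,
      smul _ _ hB, smul _ _ h1]

/-- Normal form of the pair: A is a rotation, and the traceless part of B has diagonal entries ±w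
and antisymmetric part v. Here w² = `commDisc a b x` / (4u²). -/
lemma realizedIn_real_of_lt {a b c d x y z : ℝ} (ha : a ^ 2 < 4) (hF : 0 < commDisc a b x)
    (hS : x ^ 2 + y ^ 2 + z ^ 2 + x * y * z = (a * b + c * d) * x + (b * c + a * d) * y
      + (a * c + b * d) * z + (4 - a ^ 2 - b ^ 2 - c ^ 2 - d ^ 2 - a * b * c * d)) :
    RealizedIn realSL2 ![a, b, c, d] ![x, y, z] := by
  obtain ⟨u, hu0, hu⟩ : ∃ u : ℝ, u ≠ 0 ∧ u ^ 2 = 1 - a ^ 2 / 4 :=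
    ⟨√(1 - a ^ 2 / 4), (Real.sqrt_pos.2 (by linarith)).ne', Real.sq_sqrt (by linarith)⟩
  obtain ⟨v, hv⟩ : ∃ v : ℝ, u * v = a * b / 4 - x / 2 :=
    ⟨(a * b / 4 - x / 2) / u, mul_div_cancel₀ _ hu0⟩
  have hw0 : 0 ≤ v ^ 2 - (1 - b ^ 2 / 4) := by
    have h1 : u ^ 2 * (v ^ 2 - (1 - b ^ 2 / 4)) = commDisc a b x / 4 := by
      unfold commDisc
      linear_combination (-(1 - b ^ 2 / 4)) * hu + (u * v + (a * b / 4 - x / 2)) * hv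
    have h2 : 0 < u ^ 2 := by positivity
    by_contra h
    nlinarith [mul_neg_of_pos_of_neg h2 (not_le.1 h)]
  obtain ⟨w, hw⟩ : ∃ w : ℝ, w ^ 2 = v ^ 2 - (1 - b ^ 2 / 4) := ⟨_, Real.sq_sqrt hw0⟩
  let A : Matrix.SpecialLinearGroup (Fin 2) ℝ := ⟨!![a / 2, u; -u, a / 2], by
    rw [Matrix.det_fin_two_of]
    linear_combination hu⟩
  let B : Matrix.SpecialLinearGroup (Fin 2) ℝ := ⟨!![b / 2 + w, v; -v, b / 2 - w], by
    rw [Matrix.det_fin_two_of]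
    linear_combination -hw⟩
  refine RealizedIn.of_pair (A := Matrix.SpecialLinearGroup.map Complex.ofRealHom A)
    (B := Matrix.SpecialLinearGroup.map Complex.ofRealHom B) hF.ne' hS ⟨A, rfl⟩ ⟨B, rfl⟩ ?_ ?_ ?_ ?_
  · rw [trace_map_ofReal]; simp [A, Matrix.trace_fin_two]
  · rw [trace_map_ofReal]; simp [B, Matrix.trace_fin_two]
  · rw [← map_mul, trace_map_ofReal]
    have h : (A * B).1.trace = x := by
      rw [Matrix.SpecialLinearGroup.coe_mul, Matrix.trace_fin_two]
      simp [A, B, Matrix.mul_apply, Fin.sum_univ_two]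
      linear_combination -2 * hv
    rw [h]
  · intro C t l m n hC
    let M : Matrix (Fin 2) (Fin 2) ℝ := t • 1 + l • A.1 + m • B.1 + n • (A.1 * B.1 - B.1 * A.1)
    have hM : C.1 = M.map Complex.ofRealHom := by
      rw [hC]
      ext i j
      fin_cases i <;> fin_cases j <;> simp [M, Matrix.mul_apply, Fin.sum_univ_two]
    have hdet : M.det = 1 := by
      have h1 : C.1.det = 1 := C.2
      rw [hM] at h1
      have h2 : ((M.det : ℝ) : ℂ) = 1 := by
        rw [← h1]
        simp [Matrix.det_fin_two]
      exact_mod_cast h2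
    refine ⟨⟨M, hdet⟩, ?_⟩
    apply Subtype.ext
    rw [hM]
    rfl

/-! ### Connected components -/

lemma connectedComponentIn_eq_of_separated {α : Type*} [TopologicalSpace α] {X K O O' : Set α}
    (hK : IsPreconnected K) (hO : IsOpen O) (hO' : IsOpen O') (hdisj : Disjoint O O')
    (hX : X ⊆ O ∪ O') (hKX : K = X ∩ O) {k : α} (hk : k ∈ K) :
    connectedComponentIn X k = K := by
  have hkX : k ∈ X := by rw [hKX] at hk; exact hk.1
  have hkO : k ∈ O := by rw [hKX] at hk; exact hk.2
  apply Set.Subset.antisymm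
  · have h : connectedComponentIn X k ⊆ O :=
      isPreconnected_connectedComponentIn.subset_left_of_subset_union hO hO' hdisj
        ((connectedComponentIn_subset X k).trans hX) ⟨k, mem_connectedComponentIn hkX, hkO⟩
    intro y hy
    rw [hKX]
    exact ⟨connectedComponentIn_subset X k hy, h hy⟩
  · exact hK.subset_connectedComponentIn hk (by rw [hKX]; exact Set.inter_subset_left)

/-! ### The projection of the cubic surface to the first coordinate -/

/-- The quartic polynomial whose sign at `x` decides if the fibre over `x` is nonempty. -/
def fibreQuartic (q : Fin 4 → ℝ) (x : ℝ) : ℝ :=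
  q 1 ^ 2 + q 2 ^ 2 - q 1 * q 2 * x + (4 - x ^ 2) * (q 0 * x + q 3 - x ^ 2)

/-- On the surface, `(y + z - (B + C) / (2 + x))²` is a function of `x` and `t = y - z`. -/
noncomputable def foldDisc (q : Fin 4 → ℝ) (v : ℝ × ℝ) : ℝ :=
  ((q 1 + q 2) / (2 + v.1)) ^ 2
    + (2 * (q 1 - q 2) * v.2 - (2 - v.1) * v.2 ^ 2 + 4 * (q 0 * v.1 + q 3 - v.1 ^ 2)) / (2 + v.1)

/-- The two points of the surface (for `ε = ± 1`) with given `x` and `t = y - z`. -/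
noncomputable def foldPoint (q : Fin 4 → ℝ) (ε : ℝ) (v : ℝ × ℝ) : Fin 3 → ℝ :=
  ![v.1, ((q 1 + q 2) / (2 + v.1) + ε * √(foldDisc q v) + v.2) / 2,
    ((q 1 + q 2) / (2 + v.1) + ε * √(foldDisc q v) - v.2) / 2]

/-- The domain of `foldPoint`. -/
def foldDomain (q : Fin 4 → ℝ) : Set (ℝ × ℝ) := {v | -2 < v.1 ∧ 0 ≤ foldDisc q v}

/-- In s = y + z and t = y - z, four times the surface equation is quadratic in s with leading
coefficient 2 + x. This is the completed square. -/
lemma foldDisc_spec {q : Fin 4 → ℝ} {x : ℝ} (hx : -2 < x) (t s : ℝ) :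
    (2 + x) * ((s - (q 1 + q 2) / (2 + x)) ^ 2 - foldDisc q (x, t)) =
      4 * ((x ^ 2 + ((s + t) / 2) ^ 2 + ((s - t) / 2) ^ 2 + x * ((s + t) / 2) * ((s - t) / 2))
      - (q 0 * x + q 1 * ((s + t) / 2) + q 2 * ((s - t) / 2) + q 3)) := by
  have h : 2 + x ≠ 0 := by linarith
  simp only [foldDisc]
  field_simp
  ring

lemma foldPoint_mem {q : Fin 4 → ℝ} {ε : ℝ} (hε : ε ^ 2 = 1) {v : ℝ × ℝ} (hv : v ∈ foldDomain q) :
    foldPoint q ε v ∈ realCubic q := by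
  obtain ⟨x, t⟩ := v
  obtain ⟨h1, h2⟩ := hv
  have h := foldDisc_spec (q := q) h1 t ((q 1 + q 2) / (2 + x) + ε * √(foldDisc q (x, t)))
  rw [add_sub_cancel_left, mul_pow, hε, Real.sq_sqrt h2, one_mul, sub_self, mul_zero] at h
  simp only [realCubic, foldPoint, Set.mem_ofPred_eq, Matrix.cons_val]
  linarith

lemma exists_foldPoint {q : Fin 4 → ℝ} {m : Fin 3 → ℝ} (hm : m ∈ realCubic q) (hx : -2 < m 0) :
    (m 0, m 1 - m 2) ∈ foldDomain q ∧
      ∃ ε : ℝ, (ε = 1 ∨ ε = -1) ∧ m = foldPoint q ε (m 0, m 1 - m 2) := by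
  have h := foldDisc_spec (q := q) hx (m 1 - m 2) (m 1 + m 2)
  have e1 : (m 1 + m 2 + (m 1 - m 2)) / 2 = m 1 := by ring
  have e2 : (m 1 + m 2 - (m 1 - m 2)) / 2 = m 2 := by ring
  have hm' : m 0 ^ 2 + m 1 ^ 2 + m 2 ^ 2 + m 0 * m 1 * m 2
        = q 0 * m 0 + q 1 * m 1 + q 2 * m 2 + q 3 := hm
  rw [e1, e2, hm', sub_self, mul_zero] at h
  have h2 : foldDisc q (m 0, m 1 - m 2) = (m 1 + m 2 - (q 1 + q 2) / (2 + m 0)) ^ 2 := by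
    have h0 : 2 + m 0 ≠ 0 := by linarith
    have := (mul_eq_zero.1 h).resolve_left h0
    linarith
  refine ⟨⟨hx, by rw [h2]; positivity⟩, ?_⟩
  have key : ∀ ε : ℝ, m 1 + m 2 - (q 1 + q 2) / (2 + m 0) = ε * √(foldDisc q (m 0, m 1 - m 2)) →
      m = foldPoint q ε (m 0, m 1 - m 2) := by
    intro ε hε
    funext i
    simp only [foldPoint, ← hε]
    fin_cases i
    · rfl
    · show m 1 = ((q 1 + q 2) / (2 + m 0) + (m 1 + m 2 - (q 1 + q 2) / (2 + m 0))
        + (m 1 - m 2)) / 2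
      ring
    · show m 2 = ((q 1 + q 2) / (2 + m 0) + (m 1 + m 2 - (q 1 + q 2) / (2 + m 0))
        - (m 1 - m 2)) / 2
      ring
  rw [h2, Real.sqrt_sq_eq_abs] at key
  rcases abs_choice (m 1 + m 2 - (q 1 + q 2) / (2 + m 0)) with h3 | h3
  · exact ⟨1, Or.inl rfl, key 1 (by rw [h3, one_mul])⟩
  · exact ⟨-1, Or.inr rfl, key (-1) (by rw [h3]; ring)⟩

lemma continuousOn_foldDisc (q : Fin 4 → ℝ) : ContinuousOn (foldDisc q) {v | -2 < v.1} := by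
  have h : ∀ v ∈ {v : ℝ × ℝ | -2 < v.1}, 2 + v.1 ≠ 0 := fun v hv => by
    have : -2 < v.1 := hv
    linarith
  unfold foldDisc
  refine ContinuousOn.add (ContinuousOn.pow (ContinuousOn.div ?_ ?_ h) 2)
    (ContinuousOn.div ?_ ?_ h) <;> fun_prop

lemma continuousOn_foldPoint (q : Fin 4 → ℝ) (ε : ℝ) :
    ContinuousOn (foldPoint q ε) {v | -2 < v.1} := by
  have h : ∀ v ∈ {v : ℝ × ℝ | -2 < v.1}, 2 + v.1 ≠ 0 := fun v hv => by
    have : -2 < v.1 := hv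
    linarith
  have h1 : ContinuousOn (fun v : ℝ × ℝ => (q 1 + q 2) / (2 + v.1)) {v | -2 < v.1} :=
    ContinuousOn.div (by fun_prop) (by fun_prop) h
  have h2 : ContinuousOn (fun v : ℝ × ℝ => ε * √(foldDisc q v)) {v | -2 < v.1} :=
    continuousOn_const.mul (continuousOn_foldDisc q).sqrt
  have h3 : ContinuousOn (fun v : ℝ × ℝ => v.2) {v | -2 < v.1} := by fun_prop
  rw [continuousOn_pi]
  intro i
  fin_cases i
  · exact continuousOn_fst
  · exact ((h1.add h2).add h3).div_const 2
  · exact ((h1.add h2).sub h3).div_const 2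

/-- Completing the square in t as well: over a given x the admissible t form an interval centred at
(q 1 - q 2) / (2 - x), whose half-width is controlled by `fibreQuartic`. -/
lemma foldDisc_of_lt {q : Fin 4 → ℝ} {x : ℝ} (h1 : -2 < x) (h2 : x < 2) (t : ℝ) :
    foldDisc q (x, t) = (2 - x) / (2 + x) *
      (4 * fibreQuartic q x / ((2 + x) * (2 - x) ^ 2) - (t - (q 1 - q 2) / (2 - x)) ^ 2) := by
  have h3 : 2 + x ≠ 0 := by linarith
  have h4 : 2 - x ≠ 0 := by linarith
  simp only [foldDisc, fibreQuartic]
  field_simp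
  ring

lemma foldDisc_nonneg_iff {q : Fin 4 → ℝ} {x : ℝ} (h1 : -2 < x) (h2 : x < 2) (t : ℝ) :
    0 ≤ foldDisc q (x, t) ↔
      (t - (q 1 - q 2) / (2 - x)) ^ 2 ≤ 4 * fibreQuartic q x / ((2 + x) * (2 - x) ^ 2) := by
  have h3 : 0 < (2 - x) / (2 + x) := div_pos (by linarith) (by linarith)
  rw [foldDisc_of_lt h1 h2, mul_nonneg_iff_of_pos_left h3, sub_nonneg]

lemma fibreQuartic_nonneg {q : Fin 4 → ℝ} {m : Fin 3 → ℝ} (hm : m ∈ realCubic q) (h1 : -2 < m 0)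
    (h2 : m 0 < 2) : 0 ≤ fibreQuartic q (m 0) := by
  have h := (foldDisc_nonneg_iff h1 h2 _).1 (exists_foldPoint hm h1).1.2
  have h3 : 0 < (2 + m 0) * (2 - m 0) ^ 2 := mul_pos (by linarith) (pow_pos (by linarith) 2)
  have h4 := (sq_nonneg _).trans h
  rw [le_div_iff₀ h3, zero_mul] at h4
  linarith

/-! ### The bounded component -/

/-- The part of the surface lying over an interval. -/
def cubicOver (q : Fin 4 → ℝ) (r s : ℝ) : Set (Fin 3 → ℝ) := {m ∈ realCubic q | r ≤ m 0 ∧ m 0 ≤ s}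

section

variable {q : Fin 4 → ℝ} {r s : ℝ}

/-- The set Ω is the union over x in [r, s] of the intervals of admissible t, and the surface
consists of two sheets over it. -/
lemma cubicOver_aux (hr : -2 < r) (hrs : r ≤ s) (hs : s < 2)
    (hQ : ∀ x, r ≤ x → x ≤ s → 0 ≤ fibreQuartic q x) :
    ∃ Ω : Set (ℝ × ℝ), IsPreconnected Ω ∧ IsCompact Ω ∧ (r, (q 1 - q 2) / (2 - r)) ∈ Ω ∧
      Ω ⊆ foldDomain q ∧ cubicOver q r s = foldPoint q 1 '' Ω ∪ foldPoint q (-1) '' Ω := by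
  -- The second coordinate is centre plus w.2 times half-width, so that Ω is the continuous image of
  -- a rectangle.
  let f : ℝ × ℝ → ℝ × ℝ := fun w => (w.1, (q 1 - q 2) / (2 - w.1)
    + w.2 * √(4 * fibreQuartic q w.1 / ((2 + w.1) * (2 - w.1) ^ 2)))
  have hf : ContinuousOn f (Set.Icc r s ×ˢ Set.Icc (-1) 1) := by
    have h1 : ∀ w ∈ Set.Icc r s ×ˢ Set.Icc (-1 : ℝ) 1, 2 - w.1 ≠ 0 := fun w hw => by
      have := hw.1.2
      linarith
    have h2 : ∀ w ∈ Set.Icc r s ×ˢ Set.Icc (-1 : ℝ) 1, (2 + w.1) * (2 - w.1) ^ 2 ≠ 0 :=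
      fun w hw => by
        have := hw.1.1
        exact mul_ne_zero (by linarith) (pow_ne_zero 2 (h1 w hw))
    unfold f fibreQuartic
    refine ContinuousOn.prodMk (by fun_prop) (ContinuousOn.add ?_ ?_)
    · exact ContinuousOn.div (by fun_prop) (by fun_prop) h1
    · exact ContinuousOn.mul (by fun_prop)
        (ContinuousOn.sqrt (ContinuousOn.div (by fun_prop) (by fun_prop) h2))
  have hW : ∀ x, r ≤ x → x ≤ s → 0 ≤ 4 * fibreQuartic q x / ((2 + x) * (2 - x) ^ 2) := by
    intro x h1 h2
    exact div_nonneg (by linarith [hQ x h1 h2]) (mul_nonneg (by linarith) (sq_nonneg _))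
  have hdom : f '' (Set.Icc r s ×ˢ Set.Icc (-1) 1) ⊆ foldDomain q := by
    rintro _ ⟨⟨x, u⟩, ⟨⟨h1, h2⟩, h3, h4⟩, rfl⟩
    simp only at h1 h2 h3 h4
    refine ⟨by show -2 < x; linarith, ?_⟩
    rw [foldDisc_nonneg_iff (by linarith) (by linarith), add_sub_cancel_left, mul_pow,
      Real.sq_sqrt (hW x h1 h2)]
    exact mul_le_of_le_one_left (hW x h1 h2) (by nlinarith)
  refine ⟨f '' (Set.Icc r s ×ˢ Set.Icc (-1) 1), ?_, ?_, ?_, hdom, ?_⟩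
  · exact (isPreconnected_Icc.prod isPreconnected_Icc).image f hf
  · exact (isCompact_Icc.prod isCompact_Icc).image_of_continuousOn hf
  · refine ⟨(r, 0), ⟨⟨le_refl _, hrs⟩, by norm_num, by norm_num⟩, ?_⟩
    simp [f]
  · apply Set.Subset.antisymm
    · rintro m ⟨hm, h1, h2⟩
      obtain ⟨h3, ε, hε, h4⟩ := exists_foldPoint hm (by linarith)
      have h5 := (foldDisc_nonneg_iff (by linarith) (by linarith) _).1 h3.2
      have h6 : (m 0, m 1 - m 2) ∈ f '' (Set.Icc r s ×ˢ Set.Icc (-1) 1) := by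
        have h7 := Real.abs_le_sqrt h5
        generalize hw : √(4 * fibreQuartic q (m 0) / ((2 + m 0) * (2 - m 0) ^ 2)) = w at h7
        obtain ⟨h8, h9⟩ := abs_le.1 h7
        -- If the half-width is zero the parameter cannot be recovered by division, and 0 is used.
        rcases (abs_nonneg _ |>.trans h7).eq_or_lt with h0 | h0
        · refine ⟨(m 0, 0), ⟨⟨h1, h2⟩, by norm_num, by norm_num⟩, ?_⟩
          simp only [f, hw, zero_mul, add_zero, Prod.mk.injEq, true_and]
          linarith
        · refine ⟨(m 0, (m 1 - m 2 - (q 1 - q 2) / (2 - m 0)) / w), ⟨⟨h1, h2⟩, ?_, ?_⟩, ?_⟩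
          · simp only
            rw [le_div_iff₀ h0]; linarith
          · simp only
            rw [div_le_iff₀ h0]; linarith
          · simp only [f, hw, div_mul_cancel₀ _ h0.ne', Prod.mk.injEq, true_and]
            ring
      rcases hε with rfl | rfl
      · exact Or.inl ⟨_, h6, h4.symm⟩
      · exact Or.inr ⟨_, h6, h4.symm⟩
    · rintro _ (⟨v, hv, rfl⟩ | ⟨v, hv, rfl⟩)
      · refine ⟨foldPoint_mem (by norm_num) (hdom hv), ?_⟩
        obtain ⟨w, hw, rfl⟩ := hv
        exact hw.1
      · refine ⟨foldPoint_mem (by norm_num) (hdom hv), ?_⟩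
        obtain ⟨w, hw, rfl⟩ := hv
        exact hw.1

lemma isCompact_cubicOver (hr : -2 < r) (hrs : r ≤ s) (hs : s < 2)
    (hQ : ∀ x, r ≤ x → x ≤ s → 0 ≤ fibreQuartic q x) : IsCompact (cubicOver q r s) := by
  obtain ⟨Ω, -, h2, -, h4, h5⟩ := cubicOver_aux hr hrs hs hQ
  rw [h5]
  have h6 : Ω ⊆ {v | -2 < v.1} := fun v hv => (h4 hv).1
  exact (h2.image_of_continuousOn ((continuousOn_foldPoint q 1).mono h6)).union
    (h2.image_of_continuousOn ((continuousOn_foldPoint q (-1)).mono h6))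

lemma nonempty_cubicOver (hr : -2 < r) (hrs : r ≤ s) (hs : s < 2)
    (hQ : ∀ x, r ≤ x → x ≤ s → 0 ≤ fibreQuartic q x) : (cubicOver q r s).Nonempty := by
  obtain ⟨Ω, -, -, h3, -, h5⟩ := cubicOver_aux hr hrs hs hQ
  rw [h5]
  exact ⟨_, Or.inl ⟨_, h3, rfl⟩⟩

/-- Each sheet is a continuous image of Ω. The two meet over r, where the fibre shrinks to a point
because the quartic vanishes. -/
lemma isPreconnected_cubicOver (hr : -2 < r) (hrs : r ≤ s) (hs : s < 2)
    (hQ : ∀ x, r ≤ x → x ≤ s → 0 ≤ fibreQuartic q x) (h0 : fibreQuartic q r = 0) :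
    IsPreconnected (cubicOver q r s) := by
  obtain ⟨Ω, h1, h2, h3, h4, h5⟩ := cubicOver_aux hr hrs hs hQ
  rw [h5]
  have h6 : Ω ⊆ {v | -2 < v.1} := fun v hv => (h4 hv).1
  refine IsPreconnected.union (foldPoint q 1 (r, (q 1 - q 2) / (2 - r))) ⟨_, h3, rfl⟩
    ⟨_, h3, ?_⟩ (h1.image _ ((continuousOn_foldPoint q 1).mono h6))
    (h1.image _ ((continuousOn_foldPoint q (-1)).mono h6))
  have h7 : foldDisc q (r, (q 1 - q 2) / (2 - r)) = 0 := by
    rw [foldDisc_of_lt hr (by linarith), h0, sub_self]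
    simp
  simp only [foldPoint, h7, Real.sqrt_zero, mul_zero]

end

/-! ### The unbounded components -/

/-- The point `m` lies in connected subsets of the surface reaching arbitrarily far. -/
def ReachesInfinity (q : Fin 4 → ℝ) (m : Fin 3 → ℝ) : Prop :=
  ∀ N : ℝ, ∃ T, IsPreconnected T ∧ T ⊆ realCubic q ∧ m ∈ T ∧ ∃ m' ∈ T, N < |m' 1| + |m' 2|

lemma ReachesInfinity.trans {q : Fin 4 → ℝ} {m m' : Fin 3 → ℝ} {T : Set (Fin 3 → ℝ)}
    (hT : IsPreconnected T) (hTq : T ⊆ realCubic q) (hm : m ∈ T) (hm' : m' ∈ T)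
    (h : ReachesInfinity q m') : ReachesInfinity q m := by
  intro N
  obtain ⟨T', h1, h2, h3, m'', h4, h5⟩ := h N
  exact ⟨T ∪ T', hT.union m' hm' h3 h1, Set.union_subset hTq h2, Or.inl hm, m'', Or.inr h4, h5⟩

lemma ReachesInfinity.not_isBounded {q : Fin 4 → ℝ} {m : Fin 3 → ℝ} (h : ReachesInfinity q m) :
    ¬ Bornology.IsBounded (connectedComponentIn (realCubic q) m) := by
  intro hb
  obtain ⟨N, hN⟩ := hb.exists_norm_le
  obtain ⟨T, h1, h2, h3, m', h4, h5⟩ := h (N + N)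
  have h6 := hN m' (h1.subset_connectedComponentIn h3 h2 h4)
  have h7 := (norm_le_pi_norm m' 1).trans h6
  have h8 := (norm_le_pi_norm m' 2).trans h6
  rw [Real.norm_eq_abs] at h7 h8
  linarith

/-- The map (x, y, z) ↦ (-x, y, -z) carries the surface to one of the same family, so the part at
the left end can be handled as the part at the right end. -/
lemma ReachesInfinity.of_mirror {q : Fin 4 → ℝ} {m : Fin 3 → ℝ}
    (h : ReachesInfinity ![-q 0, q 1, -q 2, q 3] ![-m 0, m 1, -m 2]) : ReachesInfinity q m := by
  intro N
  obtain ⟨T, h1, h2, h3, m', h4, h5⟩ := h N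
  refine ⟨(fun v => ![-v 0, v 1, -v 2]) '' T, h1.image _ ?_, ?_, ⟨_, h3, ?_⟩, _, ⟨m', h4, rfl⟩, ?_⟩
  · refine Continuous.continuousOn (continuous_pi fun i => ?_)
    fin_cases i <;> simp <;> fun_prop
  · rintro _ ⟨v, hv, rfl⟩
    have := h2 hv
    simp only [realCubic, Set.mem_ofPred_eq, Matrix.cons_val] at this ⊢
    linarith
  · funext i
    fin_cases i <;> simp
  · simpa using h5

lemma sub_snd_foldPoint (q : Fin 4 → ℝ) (ε : ℝ) (v : ℝ × ℝ) :
    foldPoint q ε v 1 - foldPoint q ε v 2 = v.2 := by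
  simp only [foldPoint, Matrix.cons_val]
  ring

section

variable {q : Fin 4 → ℝ} {ε : ℝ}

lemma ReachesInfinity.of_fold (hε : ε ^ 2 = 1) {Ω : Set (ℝ × ℝ)} (hΩ : IsPreconnected Ω)
    (hd : Ω ⊆ foldDomain q) {v w : ℝ × ℝ} (hv : v ∈ Ω) (hw : w ∈ Ω)
    (h : ReachesInfinity q (foldPoint q ε w)) : ReachesInfinity q (foldPoint q ε v) := by
  refine ReachesInfinity.trans
    (hΩ.image _ ((continuousOn_foldPoint q ε).mono fun v hv => (hd hv).1)) ?_
    (Set.mem_image_of_mem _ hv) (Set.mem_image_of_mem _ hw) h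
  rintro _ ⟨u, hu, rfl⟩
  exact foldPoint_mem hε (hd hu)

lemma ReachesInfinity.of_fold_unbounded (hε : ε ^ 2 = 1) {v : ℝ × ℝ}
    (h : ∀ N : ℝ, ∃ Ω : Set (ℝ × ℝ), IsPreconnected Ω ∧ Ω ⊆ foldDomain q ∧ v ∈ Ω ∧
      ∃ w ∈ Ω, N < |w.2|) : ReachesInfinity q (foldPoint q ε v) := by
  intro N
  obtain ⟨Ω, h1, h2, h3, w, h4, h5⟩ := h N
  refine ⟨foldPoint q ε '' Ω,
    h1.image _ ((continuousOn_foldPoint q ε).mono fun v hv => (h2 hv).1), ?_,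
    Set.mem_image_of_mem _ h3, _, Set.mem_image_of_mem _ h4, ?_⟩
  · rintro _ ⟨u, hu, rfl⟩
    exact foldPoint_mem hε (h2 hu)
  · rw [← sub_snd_foldPoint q ε w] at h5
    exact h5.trans_le (abs_sub _ _)

lemma isPreconnected_vertical (x : ℝ) {s : Set ℝ} (hs : IsPreconnected s) :
    IsPreconnected ((fun t => (x, t)) '' s) := hs.image _ (by fun_prop)

/-- For x ≥ 2 the function `foldDisc` is convex in t. Moving t in the direction in which it does not
decrease keeps it nonnegative for ever. -/
lemma reachesInfinity_of_two_le (hε : ε ^ 2 = 1) {x t : ℝ} (hx : 2 ≤ x)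
    (hv : (x, t) ∈ foldDomain q) : ReachesInfinity q (foldPoint q ε (x, t)) := by
  apply ReachesInfinity.of_fold_unbounded hε
  intro N
  have h1 : ∀ t', foldDisc q (x, t') = foldDisc q (x, t)
      + (t' - t) * (2 * (q 1 - q 2) + (x - 2) * (t' + t)) / (2 + x) := by
    intro t'
    have : 2 + x ≠ 0 := by linarith
    simp only [foldDisc]
    field_simp
    ring
  have h2 : ∀ t', 0 ≤ (t' - t) * (2 * (q 1 - q 2) + (x - 2) * (t' + t)) →
      (x, t') ∈ foldDomain q := by
    intro t' h
    refine ⟨hv.1, ?_⟩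
    rw [h1]
    exact add_nonneg hv.2 (div_nonneg h (by linarith))
  rcases le_total 0 (2 * (q 1 - q 2) + (x - 2) * (t + t)) with h | h
  · refine ⟨(fun t => (x, t)) '' Set.Ici t, isPreconnected_vertical x isPreconnected_Ici, ?_,
      ⟨t, Set.mem_Ici.2 le_rfl, rfl⟩, (x, max t (|N| + 1)),
      ⟨_, Set.mem_Ici.2 (le_max_left _ _), rfl⟩, ?_⟩
    · rintro _ ⟨t', ht', rfl⟩
      have ht' : t ≤ t' := ht'
      refine h2 t' (mul_nonneg (by linarith) ?_)
      nlinarith [mul_nonneg (sub_nonneg.2 hx) (sub_nonneg.2 ht')]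
    · exact (lt_of_lt_of_le (by linarith [le_abs_self N]) (le_max_right _ _)).trans_le
        (le_abs_self _)
  · refine ⟨(fun t => (x, t)) '' Set.Iic t, isPreconnected_vertical x isPreconnected_Iic, ?_,
      ⟨t, Set.mem_Iic.2 le_rfl, rfl⟩, (x, min t (-(|N| + 1))),
      ⟨_, Set.mem_Iic.2 (min_le_left _ _), rfl⟩, ?_⟩
    · rintro _ ⟨t', ht', rfl⟩
      have ht' : t' ≤ t := ht'
      refine h2 t' (mul_nonneg_of_nonpos_of_nonpos (by linarith) ?_)
      nlinarith [mul_nonneg (sub_nonneg.2 hx) (sub_nonneg.2 ht')]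
    · refine lt_of_lt_of_le ?_ (neg_le_abs _)
      have : min t (-(|N| + 1)) ≤ -(|N| + 1) := min_le_right _ _
      simp only
      linarith [le_abs_self N]

/-- The curve of interval centres stays in the domain, and (q 1 - q 2) / (2 - x) blows up as x tends
to 2. -/
lemma reachesInfinity_center_of_ne (hε : ε ^ 2 = 1) {x : ℝ} (h1 : -2 < x) (h2 : x < 2)
    (hQ : ∀ x', x ≤ x' → x' < 2 → 0 ≤ fibreQuartic q x') (hne : q 1 ≠ q 2) :
    ReachesInfinity q (foldPoint q ε (x, (q 1 - q 2) / (2 - x))) := by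
  apply ReachesInfinity.of_fold_unbounded hε
  intro N
  have hpos : 0 < |q 1 - q 2| := abs_pos.2 (sub_ne_zero.2 hne)
  refine ⟨(fun x => (x, (q 1 - q 2) / (2 - x))) '' Set.Ico x 2, isPreconnected_Ico.image _ ?_, ?_,
    ⟨x, ⟨le_rfl, h2⟩, rfl⟩, ?_⟩
  · refine ContinuousOn.prodMk (by fun_prop) (ContinuousOn.div (by fun_prop) (by fun_prop) ?_)
    intro y hy
    linarith [hy.2]
  · rintro _ ⟨y, ⟨hy1, hy2⟩, rfl⟩
    refine ⟨by show -2 < y; linarith, ?_⟩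
    rw [foldDisc_nonneg_iff (by linarith) hy2, sub_self, zero_pow two_ne_zero]
    exact div_nonneg (by linarith [hQ y hy1 hy2]) (mul_nonneg (by linarith) (sq_nonneg _))
  · obtain ⟨δ, hδ, hδ1, hδ2⟩ : ∃ δ, 0 < δ ∧ δ ≤ 2 - x ∧ N * δ < |q 1 - q 2| := by
      refine ⟨min (2 - x) (|q 1 - q 2| / (|N| + 1)), lt_min (by linarith) (by positivity),
        min_le_left _ _, ?_⟩
      have h3 : min (2 - x) (|q 1 - q 2| / (|N| + 1)) * (|N| + 1) ≤ |q 1 - q 2| := by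
        rw [← le_div_iff₀ (by positivity)]
        exact min_le_right _ _
      have h4 : 0 < min (2 - x) (|q 1 - q 2| / (|N| + 1)) := lt_min (by linarith) (by positivity)
      nlinarith [mul_le_mul_of_nonneg_right (le_abs_self N) h4.le]
    refine ⟨_, ⟨2 - δ, ⟨by linarith, by linarith⟩, rfl⟩, ?_⟩
    simp only [sub_sub_cancel]
    rwa [abs_div, abs_of_pos hδ, lt_div_iff₀ hδ]

/-- Here the centres are all at t = 0, and this segment can be followed up to x = 2, where the fibre
is unbounded. -/
lemma reachesInfinity_center_of_eq (hε : ε ^ 2 = 1) {x : ℝ} (h1 : -2 < x) (h2 : x < 2)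
    (hQ : ∀ x', x ≤ x' → x' < 2 → 0 ≤ fibreQuartic q x') (heq : q 1 = q 2) :
    ReachesInfinity q (foldPoint q ε (x, 0)) := by
  have h3 : ∀ y ∈ Set.Ico x 2, 0 ≤ q 1 ^ 2 + (2 + y) * (q 0 * y + q 3 - y ^ 2) := by
    rintro y ⟨hy1, hy2⟩
    have h := hQ y hy1 hy2
    have h' : fibreQuartic q y = (2 - y) * (q 1 ^ 2 + (2 + y) * (q 0 * y + q 3 - y ^ 2)) := by
      rw [fibreQuartic, ← heq]; ring
    rw [h'] at h
    exact nonneg_of_mul_nonneg_right h (by linarith)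
  -- The quartic has a factor 2 - y and says nothing at y = 2 itself. The inequality for the
  -- cofactor extends there by continuity.
  have h4 : ∀ y ∈ Set.Icc x 2, 0 ≤ q 1 ^ 2 + (2 + y) * (q 0 * y + q 3 - y ^ 2) := by
    rw [← closure_Ico h2.ne]
    intro y hy
    have hc : IsClosed {y : ℝ | 0 ≤ q 1 ^ 2 + (2 + y) * (q 0 * y + q 3 - y ^ 2)} :=
      isClosed_le continuous_const (by fun_prop)
    exact closure_minimal h3 hc hy
  have hd : (fun y : ℝ => (y, (0 : ℝ))) '' Set.Icc x 2 ⊆ foldDomain q := by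
    rintro _ ⟨y, hy, rfl⟩
    refine ⟨by show -2 < y; linarith [hy.1], ?_⟩
    have h5 : 0 < 2 + y := by linarith [hy.1]
    have h6 : foldDisc q (y, 0) =
        4 * (q 1 ^ 2 + (2 + y) * (q 0 * y + q 3 - y ^ 2)) / (2 + y) ^ 2 := by
      simp only [foldDisc, ← heq]
      field_simp
      ring
    rw [h6]
    exact div_nonneg (by linarith [h4 y hy]) (sq_nonneg _)
  have hmem : ((2 : ℝ), (0 : ℝ)) ∈ (fun y : ℝ => (y, (0 : ℝ))) '' Set.Icc x 2 :=
    ⟨2, ⟨h2.le, le_rfl⟩, rfl⟩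
  exact ReachesInfinity.of_fold hε (isPreconnected_Icc.image _ (by fun_prop)) hd
    ⟨x, ⟨le_rfl, h2.le⟩, rfl⟩ hmem (reachesInfinity_of_two_le hε le_rfl (hd hmem))

/-- Inside its fibre, and on its own sheet, the point is moved to the centre of the interval of
admissible t. From there one of the two paths of centres applies. -/
lemma reachesInfinity_of_nonneg {m : Fin 3 → ℝ} (hm : m ∈ realCubic q) (h1 : -2 < m 0)
    (hQ : ∀ x', m 0 ≤ x' → x' < 2 → 0 ≤ fibreQuartic q x') : ReachesInfinity q m := by
  obtain ⟨hd, ε, hε, hmε⟩ := exists_foldPoint hm h1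
  have hε : ε ^ 2 = 1 := by rcases hε with rfl | rfl <;> norm_num
  rw [hmε]
  generalize m 1 - m 2 = t at *
  generalize m 0 = x at *
  rcases le_or_gt 2 x with h2 | h2
  · exact reachesInfinity_of_two_le hε h2 hd
  have hc : ReachesInfinity q (foldPoint q ε (x, (q 1 - q 2) / (2 - x))) := by
    by_cases h : q 1 = q 2
    · have := reachesInfinity_center_of_eq hε h1 h2 hQ h
      rwa [h, sub_self, zero_div]
    · exact reachesInfinity_center_of_ne hε h1 h2 hQ h
  refine ReachesInfinity.of_fold hε (Ω := (fun t => (x, t)) '' Set.uIcc t ((q 1 - q 2) / (2 - x)))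
    (isPreconnected_vertical x isPreconnected_uIcc) ?_
    ⟨_, Set.left_mem_uIcc, rfl⟩ ⟨_, Set.right_mem_uIcc, rfl⟩ hc
  rintro _ ⟨t', ht', rfl⟩
  refine ⟨h1, ?_⟩
  rw [foldDisc_nonneg_iff h1 h2]
  refine le_trans ?_ ((foldDisc_nonneg_iff h1 h2 t).1 hd.2)
  rw [sq_le_sq, abs_sub_comm t', abs_sub_comm t]
  exact Set.abs_sub_le_of_uIcc_subset_uIcc (Set.uIcc_subset_uIcc_right ht')

end

/-- If the quartic has four simple real roots in `[-2, 2]`, then the part of the surface between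
the two middle ones is its only bounded component. -/
theorem bounded_component_unique {q : Fin 4 → ℝ} {x1 x2 x3 x4 : ℝ}
    (hQ : ∀ x, fibreQuartic q x = (x - x1) * (x - x2) * (x - x3) * (x - x4))
    (h1 : -2 ≤ x1) (h12 : x1 < x2) (h23 : x2 < x3) (h34 : x3 < x4) (h4 : x4 ≤ 2) :
    cubicOver q x2 x3 ∈ componentsOf (realCubic q) ∧
      Bornology.IsBounded (cubicOver q x2 x3) ∧
      ∀ C ∈ componentsOf (realCubic q), Bornology.IsBounded C → C = cubicOver q x2 x3 := by
  have hmid : ∀ x, x2 ≤ x → x ≤ x3 → 0 ≤ fibreQuartic q x := by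
    intro x h5 h6
    rw [hQ]
    exact mul_nonneg_of_nonpos_of_nonpos (mul_nonpos_of_nonneg_of_nonpos
      (mul_nonneg (by linarith) (by linarith)) (by linarith)) (by linarith)
  have hright : ∀ x, x4 ≤ x → 0 ≤ fibreQuartic q x := by
    intro x h5
    rw [hQ]
    exact mul_nonneg (mul_nonneg (mul_nonneg (by linarith) (by linarith)) (by linarith))
      (by linarith)
  have hleft : ∀ x, x ≤ x1 → 0 ≤ fibreQuartic q x := by
    intro x h5
    rw [hQ]
    exact mul_nonneg_of_nonpos_of_nonpos (mul_nonpos_of_nonneg_of_nonpos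
      (mul_nonneg_of_nonpos_of_nonpos (by linarith) (by linarith)) (by linarith)) (by linarith)
  have hgap1 : ∀ x, x1 < x → x < x2 → fibreQuartic q x < 0 := by
    intro x h5 h6
    rw [hQ]
    exact mul_neg_of_pos_of_neg (mul_pos_of_neg_of_neg
      (mul_neg_of_pos_of_neg (by linarith) (by linarith)) (by linarith)) (by linarith)
  have hgap3 : ∀ x, x3 < x → x < x4 → fibreQuartic q x < 0 := by
    intro x h5 h6
    rw [hQ]
    exact mul_neg_of_pos_of_neg (mul_pos (mul_pos (by linarith) (by linarith)) (by linarith))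
      (by linarith)
  have htri : ∀ m ∈ realCubic q, m 0 ≤ x1 ∨ (x2 ≤ m 0 ∧ m 0 ≤ x3) ∨ x4 ≤ m 0 := by
    intro m hm
    by_contra! h
    obtain ⟨h5, h6, h7⟩ := h
    have h8 := fibreQuartic_nonneg hm (by linarith) (by linarith)
    rcases lt_or_ge (m 0) x2 with h9 | h9
    · exact absurd (hgap1 _ h5 h9) (not_lt.2 h8)
    · exact absurd (hgap3 _ (h6 h9) h7) (not_lt.2 h8)
  have hcomp : ∀ k ∈ cubicOver q x2 x3,
      connectedComponentIn (realCubic q) k = cubicOver q x2 x3 := by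
    intro k hk
    -- The surface has no points over the two gaps where the quartic is negative. The separating
    -- open sets are cut at the midpoints of these gaps.
    refine connectedComponentIn_eq_of_separated
      (O := {m | (x1 + x2) / 2 < m 0 ∧ m 0 < (x3 + x4) / 2})
      (O' := {m | m 0 < (x1 + x2) / 2 ∨ (x3 + x4) / 2 < m 0})
      (isPreconnected_cubicOver (by linarith) h23.le (by linarith) hmid
        (by rw [hQ]; ring)) ?_ ?_ ?_ ?_ ?_ hk
    · exact (isOpen_lt continuous_const (continuous_apply 0)).inter
        (isOpen_lt (continuous_apply 0) continuous_const)
    · exact (isOpen_lt (continuous_apply 0) continuous_const).union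
        (isOpen_lt continuous_const (continuous_apply 0))
    · rw [Set.disjoint_left]
      rintro m ⟨h5, h6⟩ (h7 | h7) <;> linarith
    · intro m hm
      rcases htri m hm with h | h | h
      · exact Or.inr (Or.inl (by linarith))
      · exact Or.inl ⟨by linarith, by linarith⟩
      · exact Or.inr (Or.inr (by linarith))
    · ext m
      constructor
      · rintro ⟨h5, h6, h7⟩
        exact ⟨h5, by linarith, by linarith⟩
      · rintro ⟨h5, h6, h7⟩
        rcases htri m h5 with h | h | h
        · linarith
        · exact ⟨h5, h⟩
        · linarith
  obtain ⟨k, hk⟩ := nonempty_cubicOver (by linarith) h23.le (by linarith) hmid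
  refine ⟨⟨k, hk.1, (hcomp k hk).symm⟩,
    (isCompact_cubicOver (by linarith) h23.le (by linarith) hmid).isBounded, ?_⟩
  rintro _ ⟨m, hm, rfl⟩ hb
  rcases htri m hm with h | h | h
  · refine absurd hb (ReachesInfinity.not_isBounded (ReachesInfinity.of_mirror
      (reachesInfinity_of_nonneg ?_ ?_ ?_)))
    · have hm' : m 0 ^ 2 + m 1 ^ 2 + m 2 ^ 2 + m 0 * m 1 * m 2
        = q 0 * m 0 + q 1 * m 1 + q 2 * m 2 + q 3 := hm
      simp only [realCubic, Set.mem_ofPred_eq, Matrix.cons_val]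
      linarith
    · simp only [Matrix.cons_val]
      linarith
    · intro x h5 h6
      simp only [Matrix.cons_val] at h5
      have h7 := hleft (-x) (by linarith)
      simp only [fibreQuartic, Matrix.cons_val] at h7 ⊢
      linarith
  · exact hcomp m ⟨hm, h⟩
  · exact absurd hb (ReachesInfinity.not_isBounded
      (reachesInfinity_of_nonneg hm (by linarith) fun x h5 _ => hright x (by linarith)))

/-! ### Parameters in the cube -/

lemma commDisc_eq_of_roots {a b l h : ℝ} (h1 : l + h = a * b) (h2 : l * h = a ^ 2 + b ^ 2 - 4)
    (x : ℝ) : commDisc a b x = (x - l) * (x - h) := by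
  unfold commDisc
  linear_combination x * h1 - h2

/-- `Δ` is the resultant of the two quadratic polynomials. -/
lemma reducibleDisc_eq {a b c d l h l' h' : ℝ} (h1 : l + h = a * b)
    (h2 : l * h = a ^ 2 + b ^ 2 - 4) (h1' : l' + h' = c * d) (h2' : l' * h' = c ^ 2 + d ^ 2 - 4) :
    reducibleDisc ![a, b, c, d] = 4 * ((l - l') * (l - h') * (h - l') * (h - h')) := by
  have e : (l - l') * (l - h') * (h - l') * (h - h')
      = (l * h - l' * h') ^ 2 + ((l + h) - (l' + h')) *
        ((l + h) * (l' * h') - (l' + h') * (l * h)) := by ring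
  rw [e, h1, h2, h1', h2', reducibleDisc]
  simp only [Matrix.cons_val]
  ring

/-- This factorization links the topology of the surface, governed by the sign of the product, with
the type of representation, governed by the signs of the factors. -/
lemma fibreQuartic_cubicParams (a b c d x : ℝ) :
    fibreQuartic (cubicParams ![a, b, c, d]) x = commDisc a b x * commDisc c d x := by
  simp only [fibreQuartic, cubicParams, commDisc, Matrix.cons_val]
  ring

section

variable {a b c d : ℝ}

lemma mem_realCubic_cubicParams {m : Fin 3 → ℝ} :
    m ∈ realCubic (cubicParams ![a, b, c, d]) ↔
      m 0 ^ 2 + m 1 ^ 2 + m 2 ^ 2 + m 0 * m 1 * m 2 = (a * b + c * d) * m 0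
      + (b * c + a * d) * m 1 + (a * c + b * d) * m 2
      + (4 - a ^ 2 - b ^ 2 - c ^ 2 - d ^ 2 - a * b * c * d) := by
  simp only [realCubic, cubicParams, Set.mem_ofPred_eq, Matrix.cons_val]

/-- The surface is smooth if the four roots of its quartic are distinct. -/
lemma smoothPart_eq_realCubic {l h l' h' : ℝ} (hlh : l < h) (hlh' : l' < h')
    (h1 : l + h = a * b) (h2 : l * h = a ^ 2 + b ^ 2 - 4)
    (h1' : l' + h' = c * d) (h2' : l' * h' = c ^ 2 + d ^ 2 - 4)
    (hne : l ≠ l' ∧ l ≠ h' ∧ h ≠ l' ∧ h ≠ h') :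
    smoothPart (cubicParams ![a, b, c, d]) = realCubic (cubicParams ![a, b, c, d]) := by
  apply Set.Subset.antisymm (fun m hm => hm.1)
  rintro m hm
  refine ⟨hm, ?_⟩
  rintro ⟨hA, hB, hC⟩
  rw [mem_realCubic_cubicParams] at hm
  simp only [cubicParams, Matrix.cons_val] at hA hB hC
  generalize m 0 = x at *
  generalize m 1 = y at *
  generalize m 2 = z at *
  have hF := commDisc_eq_of_roots h1 h2 x
  have hF' := commDisc_eq_of_roots h1' h2' x
  have hA' : 2 * x + y * z = a * b + c * d := hA
  obtain ⟨A, hAd⟩ : ∃ A, A = a * b + c * d := ⟨_, rfl⟩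
  obtain ⟨B, hBd⟩ : ∃ B, B = b * c + a * d := ⟨_, rfl⟩
  obtain ⟨C, hCd⟩ : ∃ C, C = a * c + b * d := ⟨_, rfl⟩
  obtain ⟨D, hDd⟩ : ∃ D, D = 4 - a ^ 2 - b ^ 2 - c ^ 2 - d ^ 2 - a * b * c * d := ⟨_, rfl⟩
  -- At a singular point the fibre over x is singular, so the quartic vanishes at x. The x-component
  -- of the gradient then makes its derivative vanish as well, so x would be a double root.
  have hQ : commDisc a b x * commDisc c d x = 0 := by
    have e : commDisc a b x * commDisc c d x
        = B ^ 2 + C ^ 2 - B * C * x + (4 - x ^ 2) * (A * x + D - x ^ 2) := by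
      rw [hAd, hBd, hCd, hDd, commDisc, commDisc]; ring
    rw [← hAd, ← hBd, ← hCd, ← hDd] at hm
    rw [← hBd] at hB
    rw [← hCd] at hC
    have hD : A * x + D - x ^ 2 = y ^ 2 + z ^ 2 + x * y * z - B * y - C * z := by linarith
    rw [e, hD, ← hB, ← hC]
    ring
  have hQ' : (2 * x - a * b) * commDisc c d x + commDisc a b x * (2 * x - c * d) = 0 := by
    have e : (2 * x - a * b) * commDisc c d x + commDisc a b x * (2 * x - c * d)
        = -(B * C) - 2 * x * (A * x + D - x ^ 2) + (4 - x ^ 2) * (A - 2 * x) := by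
      rw [hAd, hBd, hCd, hDd, commDisc, commDisc]; ring
    rw [← hAd, ← hBd, ← hCd, ← hDd] at hm
    rw [← hAd] at hA
    rw [← hBd] at hB
    rw [← hCd] at hC
    have hD : A * x + D - x ^ 2 = y ^ 2 + z ^ 2 + x * y * z - B * y - C * z := by linarith
    rw [e, hD, ← hB, ← hC, ← hA]
    ring
  rw [← h1, ← h1', hF, hF'] at hQ'
  rw [hF, hF'] at hQ
  obtain ⟨n1, n2, n3, n4⟩ := hne
  have key : (x = l ∨ x = h) ∨ x = l' ∨ x = h' := by
    rcases mul_eq_zero.1 hQ with h | h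
    · rcases mul_eq_zero.1 h with h | h
      · exact Or.inl (Or.inl (sub_eq_zero.1 h))
      · exact Or.inl (Or.inr (sub_eq_zero.1 h))
    · rcases mul_eq_zero.1 h with h | h
      · exact Or.inr (Or.inl (sub_eq_zero.1 h))
      · exact Or.inr (Or.inr (sub_eq_zero.1 h))
  rcases key with (rfl | rfl) | rfl | rfl
  · have : (x - h) * ((x - l') * (x - h')) = 0 := by linear_combination hQ'
    simp [sub_eq_zero, n1, n2, hlh.ne] at this
  · have : (x - l) * ((x - l') * (x - h')) = 0 := by linear_combination hQ'
    simp [sub_eq_zero, n3, n4, hlh.ne'] at this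
  · have : (x - h') * ((x - l) * (x - h)) = 0 := by linear_combination hQ'
    simp [sub_eq_zero, n1.symm, n3.symm, hlh'.ne] at this
  · have : (x - l') * ((x - l) * (x - h)) = 0 := by linear_combination hQ'
    simp [sub_eq_zero, n2.symm, n4.symm, hlh'.ne'] at this

/-- One of the two quadratics is strictly negative, and the representation is built from the
corresponding pair. A real representation would force both to be ≥ 0, hence both to vanish. -/
lemma realized_unitary_of_nonpos {m : Fin 3 → ℝ} (ha : a ^ 2 < 4) (hc : c ^ 2 < 4)
    (hm : m ∈ realCubic (cubicParams ![a, b, c, d])) (h1 : commDisc a b (m 0) ≤ 0)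
    (h2 : commDisc c d (m 0) ≤ 0) (h3 : commDisc a b (m 0) ≠ 0 ∨ commDisc c d (m 0) ≠ 0) :
    RealizedInSU2 ![a, b, c, d] m ∧ ¬ RealizedInSL2R ![a, b, c, d] m := by
  rw [mem_realCubic_cubicParams] at hm
  have hm3 : m = ![m 0, m 1, m 2] := by funext i; fin_cases i <;> rfl
  rw [realizedInSU2_iff, realizedInSL2R_iff, hm3]
  constructor
  · rcases h3 with h3 | h3
    · exact realizedIn_unitary_of_lt ha (lt_of_le_of_ne h1 h3) hm
    · refine RealizedIn.rotate (realizedIn_unitary_of_lt hc (lt_of_le_of_ne h2 h3) ?_)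
      linear_combination hm
  · intro h
    obtain ⟨h4, h5⟩ := h.commDisc_nonneg ha hc
    rcases h3 with h3 | h3
    · exact h3 (le_antisymm h1 h4)
    · exact h3 (le_antisymm h2 h5)

lemma realized_real_of_nonneg {m : Fin 3 → ℝ} (ha : a ^ 2 < 4) (hc : c ^ 2 < 4)
    (hm : m ∈ realCubic (cubicParams ![a, b, c, d])) (h1 : 0 ≤ commDisc a b (m 0))
    (h2 : 0 ≤ commDisc c d (m 0)) (h3 : commDisc a b (m 0) ≠ 0 ∨ commDisc c d (m 0) ≠ 0) :
    RealizedInSL2R ![a, b, c, d] m ∧ ¬ RealizedInSU2 ![a, b, c, d] m := by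
  rw [mem_realCubic_cubicParams] at hm
  have hm3 : m = ![m 0, m 1, m 2] := by funext i; fin_cases i <;> rfl
  rw [realizedInSU2_iff, realizedInSL2R_iff, hm3]
  constructor
  · rcases h3 with h3 | h3
    · exact realizedIn_real_of_lt ha (lt_of_le_of_ne h1 h3.symm) hm
    · refine RealizedIn.rotate (realizedIn_real_of_lt hc (lt_of_le_of_ne h2 h3.symm) ?_)
      linear_combination hm
  · intro h
    obtain ⟨h4, h5⟩ := h.commDisc_nonpos
    rcases h3 with h3 | h3
    · exact h3 (le_antisymm h4 h1)
    · exact h3 (le_antisymm h5 h2)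

/-- The smooth part of the surface with parameters `Π(p)` has exactly one bounded component, and
all points of it have the property `P`. -/
def UniqueBoundedComponent (p : Fin 4 → ℝ) (P : (Fin 3 → ℝ) → Prop) : Prop :=
  ∃ C, IsBoundedComponent (cubicParams p) C ∧
    (∀ C', IsBoundedComponent (cubicParams p) C' → C' = C) ∧ ∀ m ∈ C, P m

/-- A component is nonempty, so incompatible properties cannot both hold on it. This keeps the
counts of the two kinds exact. -/
lemma UniqueBoundedComponent.not_of_imp_not {p : Fin 4 → ℝ} {P P' : (Fin 3 → ℝ) → Prop}
    (h : UniqueBoundedComponent p P) (hP : ∀ m, P m → ¬ P' m) : ¬ UniqueBoundedComponent p P' := by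
  rintro ⟨C', hC', -, h2'⟩
  obtain ⟨C, hC, h1, h2⟩ := h
  obtain rfl := h1 C' hC'
  obtain ⟨⟨m, hm, rfl⟩, -⟩ := hC
  exact hP m (h2 m (mem_connectedComponentIn hm)) (h2' m (mem_connectedComponentIn hm))

lemma uniqueBoundedComponent_of_roots {l h l' h' : ℝ} (hlh : l < h) (hlh' : l' < h')
    (h1 : l + h = a * b) (h2 : l * h = a ^ 2 + b ^ 2 - 4)
    (h1' : l' + h' = c * d) (h2' : l' * h' = c ^ 2 + d ^ 2 - 4)
    (hne : l ≠ l' ∧ l ≠ h' ∧ h ≠ l' ∧ h ≠ h')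
    {x1 x2 x3 x4 : ℝ} (hx : ∀ x, (x - l) * (x - h) * ((x - l') * (x - h'))
      = (x - x1) * (x - x2) * (x - x3) * (x - x4))
    (hx1 : -2 ≤ x1) (h12 : x1 < x2) (h23 : x2 < x3) (h34 : x3 < x4) (h4 : x4 ≤ 2)
    {P : (Fin 3 → ℝ) → Prop}
    (hP : ∀ m ∈ realCubic (cubicParams ![a, b, c, d]), x2 ≤ m 0 → m 0 ≤ x3 → P m) :
    UniqueBoundedComponent ![a, b, c, d] P := by
  obtain ⟨k1, k2, k3⟩ := bounded_component_unique (q := cubicParams ![a, b, c, d])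
    (fun x => by rw [fibreQuartic_cubicParams, commDisc_eq_of_roots h1 h2,
      commDisc_eq_of_roots h1' h2', hx]) hx1 h12 h23 h34 h4
  have hs := smoothPart_eq_realCubic hlh hlh' h1 h2 h1' h2' hne
  refine ⟨_, ⟨by rw [hs]; exact k1, k2⟩, ?_, fun m hm => hP m hm.1 hm.2.1 hm.2.2⟩
  rintro C' ⟨h3, h4⟩
  rw [hs] at h3
  exact k3 C' h3 h4

variable {l h l' h' : ℝ}

/-- The two middle roots are max l l' and min h h'. The interval between them is the intersection of
the two root intervals, where both quadratics are ≤ 0. -/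
lemma uniqueBoundedComponent_of_overlap (ha : a ^ 2 < 4) (hc : c ^ 2 < 4)
    (h1 : l + h = a * b) (h2 : l * h = a ^ 2 + b ^ 2 - 4)
    (h1' : l' + h' = c * d) (h2' : l' * h' = c ^ 2 + d ^ 2 - 4)
    (hlh : l < h) (hlh' : l' < h') (hl : -2 ≤ l) (hh : h ≤ 2) (hl' : -2 ≤ l') (hh' : h' ≤ 2)
    (h3 : l < h') (h4 : l' < h) (h5 : l ≠ l') (h6 : h ≠ h') :
    UniqueBoundedComponent ![a, b, c, d]
      fun m => RealizedInSU2 ![a, b, c, d] m ∧ ¬ RealizedInSL2R ![a, b, c, d] m := by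
  have hne : l ≠ l' ∧ l ≠ h' ∧ h ≠ l' ∧ h ≠ h' := ⟨h5, h3.ne, h4.ne', h6⟩
  have hF := commDisc_eq_of_roots h1 h2
  have hF' := commDisc_eq_of_roots h1' h2'
  have hP : ∀ m ∈ realCubic (cubicParams ![a, b, c, d]), max l l' ≤ m 0 → m 0 ≤ min h h' →
      RealizedInSU2 ![a, b, c, d] m ∧ ¬ RealizedInSL2R ![a, b, c, d] m := by
    intro m hm h7 h8
    obtain ⟨h9, h10⟩ := max_le_iff.1 h7
    obtain ⟨h11, h12⟩ := le_min_iff.1 h8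
    refine realized_unitary_of_nonpos ha hc hm ?_ ?_ ?_
    · rw [hF]; exact mul_nonpos_of_nonneg_of_nonpos (by linarith) (by linarith)
    · rw [hF']; exact mul_nonpos_of_nonneg_of_nonpos (by linarith) (by linarith)
    · rw [hF, hF']
      by_contra! h0
      rcases mul_eq_zero.1 h0.1 with e | e <;> rcases mul_eq_zero.1 h0.2 with e' | e' <;>
        rw [sub_eq_zero] at e e' <;> rw [e] at e'
      exacts [h5 e', h3.ne e', h4.ne' e', h6 e']
  rcases lt_or_gt_of_ne h5 with h7 | h7 <;> rcases lt_or_gt_of_ne h6 with h8 | h8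
  · rw [max_eq_right h7.le, min_eq_left h8.le] at hP
    exact uniqueBoundedComponent_of_roots hlh hlh' h1 h2 h1' h2' hne (fun x => by ring)
      hl h7 h4 h8 hh' hP
  · rw [max_eq_right h7.le, min_eq_right h8.le] at hP
    exact uniqueBoundedComponent_of_roots hlh hlh' h1 h2 h1' h2' hne (fun x => by ring)
      hl h7 hlh' h8 hh hP
  · rw [max_eq_left h7.le, min_eq_left h8.le] at hP
    exact uniqueBoundedComponent_of_roots hlh hlh' h1 h2 h1' h2' hne (fun x => by ring)
      hl' h7 hlh h8 hh' hP
  · rw [max_eq_left h7.le, min_eq_right h8.le] at hP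
    exact uniqueBoundedComponent_of_roots hlh hlh' h1 h2 h1' h2' hne (fun x => by ring)
      hl' h7 h3 h8 hh hP

/-- Now the middle interval is the gap between the two root intervals, where both quadratics are ≥
0. -/
lemma uniqueBoundedComponent_of_disjoint (ha : a ^ 2 < 4) (hc : c ^ 2 < 4)
    (h1 : l + h = a * b) (h2 : l * h = a ^ 2 + b ^ 2 - 4)
    (h1' : l' + h' = c * d) (h2' : l' * h' = c ^ 2 + d ^ 2 - 4)
    (hlh : l < h) (hlh' : l' < h') (hl : -2 ≤ l) (hh : h ≤ 2) (hl' : -2 ≤ l') (hh' : h' ≤ 2)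
    (h3 : h < l' ∨ h' < l) :
    UniqueBoundedComponent ![a, b, c, d]
      fun m => RealizedInSL2R ![a, b, c, d] m ∧ ¬ RealizedInSU2 ![a, b, c, d] m := by
  have hF := commDisc_eq_of_roots h1 h2
  have hF' := commDisc_eq_of_roots h1' h2'
  rcases h3 with h3 | h3
  · refine uniqueBoundedComponent_of_roots hlh hlh' h1 h2 h1' h2'
      ⟨by linarith, by linarith, by linarith, by linarith⟩ (x1 := l) (x2 := h) (x3 := l')
      (x4 := h') (fun x => by ring) hl hlh h3 hlh' hh' ?_
    intro m hm h4 h5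
    refine realized_real_of_nonneg ha hc hm ?_ ?_ ?_
    · rw [hF]; exact mul_nonneg (by linarith) (by linarith)
    · rw [hF']; exact mul_nonneg_of_nonpos_of_nonpos (by linarith) (by linarith)
    · rw [hF, hF']
      by_contra! h0
      rcases mul_eq_zero.1 h0.1 with e | e <;> rcases mul_eq_zero.1 h0.2 with e' | e' <;> linarith
  · refine uniqueBoundedComponent_of_roots hlh hlh' h1 h2 h1' h2'
      ⟨by linarith, by linarith, by linarith, by linarith⟩ (x1 := l') (x2 := h') (x3 := l)
      (x4 := h) (fun x => by ring) hl' hlh' h3 hlh hh ?_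
    intro m hm h4 h5
    refine realized_real_of_nonneg ha hc hm ?_ ?_ ?_
    · rw [hF]; exact mul_nonneg_of_nonpos_of_nonpos (by linarith) (by linarith)
    · rw [hF']; exact mul_nonneg (by linarith) (by linarith)
    · rw [hF, hF']
      by_contra! h0
      rcases mul_eq_zero.1 h0.1 with e | e <;> rcases mul_eq_zero.1 h0.2 with e' | e' <;> linarith

end

/-! ### Angle coordinates -/

/-- The map `θ ↦ (2 cos πθ₁, …, 2 cos πθ₄)` for real `θ`. -/
noncomputable def cosTrace (θ : Fin 4 → ℝ) : Fin 4 → ℝ := fun i => 2 * Real.cos (Real.pi * θ i)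

/-- The inverse of `cosTrace` with values in `[0, 1]⁴`. -/
noncomputable def arccosTheta (p : Fin 4 → ℝ) : Fin 4 → ℝ :=
  fun i => Real.arccos (p i / 2) / Real.pi

/-- The real angle vectors off all walls `θᵢ = k` and `± θ₁ ± θ₂ ± θ₃ ± θ₄ = 2k`. -/
def regularTheta : Set (Fin 4 → ℝ) :=
  {θ | (∀ i, ∀ k : ℤ, θ i ≠ k) ∧ ∀ ε : Fin 4 → ℤˣ, ∀ k : ℤ, ∑ i, ((ε i : ℤ) : ℝ) * θ i ≠ 2 * k}

lemma continuous_cosTrace : Continuous cosTrace := by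
  unfold cosTrace
  fun_prop

lemma continuous_arccosTheta : Continuous arccosTheta := by
  unfold arccosTheta
  exact continuous_pi fun i =>
    (Real.continuous_arccos.comp ((continuous_apply i).div_const 2)).div_const _

lemma cosTrace_arccosTheta {p : Fin 4 → ℝ} (hp : p ∈ openCube) : cosTrace (arccosTheta p) = p := by
  funext i
  have h := hp i
  rw [cosTrace, arccosTheta, mul_div_cancel₀ _ Real.pi_ne_zero,
    Real.cos_arccos (by linarith) (by linarith)]
  ring

lemma arccosTheta_cosTrace {θ : Fin 4 → ℝ} (h : ∀ i, 0 ≤ θ i ∧ θ i ≤ 1) :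
    arccosTheta (cosTrace θ) = θ := by
  funext i
  rw [arccosTheta, cosTrace, mul_div_cancel_left₀ _ two_ne_zero,
    Real.arccos_cos (mul_nonneg Real.pi_pos.le (h i).1)
      (mul_le_of_le_one_right Real.pi_pos.le (h i).2), mul_div_cancel_left₀ _ Real.pi_ne_zero]

lemma arccosTheta_mem {p : Fin 4 → ℝ} (hp : p ∈ openCube) (i : Fin 4) :
    0 < arccosTheta p i ∧ arccosTheta p i < 1 := by
  have h := hp i
  refine ⟨div_pos (Real.arccos_pos.2 (by linarith)) Real.pi_pos, ?_⟩
  rw [arccosTheta, div_lt_one Real.pi_pos]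
  refine lt_of_le_of_ne (Real.arccos_le_pi _) fun h' => ?_
  rw [Real.arccos_eq_pi] at h'
  linarith

lemma cos_pi_mul_eq_iff {u v : ℝ} :
    Real.cos (Real.pi * u) = Real.cos (Real.pi * v) ↔ ∃ k : ℤ, u + v = 2 * k ∨ u - v = 2 * k := by
  rw [Real.cos_eq_cos_iff]
  have hpi := Real.pi_ne_zero
  constructor
  · rintro ⟨k, h | h⟩
    · refine ⟨-k, Or.inr ?_⟩
      apply mul_left_cancel₀ hpi
      push_cast
      linear_combination -h
    · refine ⟨k, Or.inl ?_⟩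
      apply mul_left_cancel₀ hpi
      linear_combination h
  · rintro ⟨k, h | h⟩
    · exact ⟨k, Or.inr (by linear_combination Real.pi * h)⟩
    · exact ⟨-k, Or.inl (by push_cast; linear_combination -Real.pi * h)⟩

lemma cos_pi_mul_lt {u v : ℝ} (h1 : 0 < u + v) (h2 : u + v < 2) (h3 : 0 < u - v)
    (h4 : u - v < 2) : Real.cos (Real.pi * u) < Real.cos (Real.pi * v) := by
  have hpi := Real.pi_pos
  have e := Real.cos_sub_cos (Real.pi * v) (Real.pi * u)
  have p1 : 0 < Real.sin ((Real.pi * v + Real.pi * u) / 2) :=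
    Real.sin_pos_of_pos_of_lt_pi (by nlinarith) (by nlinarith)
  have p2 : 0 < Real.sin (-((Real.pi * v - Real.pi * u) / 2)) :=
    Real.sin_pos_of_pos_of_lt_pi (by nlinarith) (by nlinarith)
  rw [Real.sin_neg] at p2
  nlinarith [mul_pos p1 p2]

/-- Together with the product formula for the same two numbers, this identifies 2cos π(s ± t) as the
roots of `commDisc` for the traces 2cos πs and 2cos πt. -/
lemma cos_pi_add_add_cos_pi_sub (s t : ℝ) :
    2 * Real.cos (Real.pi * (s + t)) + 2 * Real.cos (Real.pi * (s - t))
      = (2 * Real.cos (Real.pi * s)) * (2 * Real.cos (Real.pi * t)) := by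
  rw [mul_add, mul_sub, Real.cos_add, Real.cos_sub]
  ring

lemma cos_pi_add_mul_cos_pi_sub (s t : ℝ) :
    2 * Real.cos (Real.pi * (s + t)) * (2 * Real.cos (Real.pi * (s - t)))
      = (2 * Real.cos (Real.pi * s)) ^ 2 + (2 * Real.cos (Real.pi * t)) ^ 2 - 4 := by
  rw [mul_add, mul_sub, Real.cos_add, Real.cos_sub]
  have h1 := Real.sin_sq (Real.pi * s)
  have h2 := Real.sin_sq (Real.pi * t)
  linear_combination (-4 * Real.sin (Real.pi * t) ^ 2) * h1
    - 4 * (1 - Real.cos (Real.pi * s) ^ 2) * h2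

lemma cosTrace_eq (θ : Fin 4 → ℝ) : cosTrace θ = ![2 * Real.cos (Real.pi * θ 0),
    2 * Real.cos (Real.pi * θ 1), 2 * Real.cos (Real.pi * θ 2), 2 * Real.cos (Real.pi * θ 3)] := by
  funext i
  fin_cases i <;> rfl

lemma reducibleDisc_cosTrace (θ : Fin 4 → ℝ) : reducibleDisc (cosTrace θ) =
    4 * ((2 * Real.cos (Real.pi * (θ 0 + θ 1)) - 2 * Real.cos (Real.pi * (θ 2 + θ 3))) *
      (2 * Real.cos (Real.pi * (θ 0 + θ 1)) - 2 * Real.cos (Real.pi * (θ 2 - θ 3))) *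
      (2 * Real.cos (Real.pi * (θ 0 - θ 1)) - 2 * Real.cos (Real.pi * (θ 2 + θ 3))) *
      (2 * Real.cos (Real.pi * (θ 0 - θ 1)) - 2 * Real.cos (Real.pi * (θ 2 - θ 3)))) := by
  rw [cosTrace_eq]
  exact reducibleDisc_eq (cos_pi_add_add_cos_pi_sub _ _) (cos_pi_add_mul_cos_pi_sub _ _)
    (cos_pi_add_add_cos_pi_sub _ _) (cos_pi_add_mul_cos_pi_sub _ _)

lemma cosTrace_mem_openCube_iff {θ : Fin 4 → ℝ} :
    cosTrace θ ∈ openCube ↔ ∀ i, ∀ k : ℤ, θ i ≠ k := by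
  refine forall_congr' fun i => ?_
  constructor
  · rintro ⟨h1, h2⟩ k hk
    have h3 : Real.sin (Real.pi * θ i) = 0 := by
      rw [hk, mul_comm]; exact Real.sin_int_mul_pi k
    have h4 := Real.sin_sq_add_cos_sq (Real.pi * θ i)
    unfold cosTrace at h1 h2
    rw [h3] at h4
    nlinarith
  · intro h
    have h3 : Real.sin (Real.pi * θ i) ≠ 0 := by
      intro h0
      obtain ⟨n, hn⟩ := Real.sin_eq_zero_iff.1 h0
      apply h n
      apply mul_left_cancel₀ Real.pi_ne_zero
      linear_combination -hn
    have h4 := Real.sin_sq_add_cos_sq (Real.pi * θ i)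
    have h5 : 0 < Real.sin (Real.pi * θ i) ^ 2 := by positivity
    unfold cosTrace
    constructor <;> nlinarith

lemma cos_pi_units (s t : ℝ) (ε ε' : ℤˣ) :
    Real.cos (Real.pi * (((ε : ℤ) : ℝ) * s + ((ε' : ℤ) : ℝ) * t)) = Real.cos (Real.pi * (s + t)) ∨
    Real.cos (Real.pi * (((ε : ℤ) : ℝ) * s + ((ε' : ℤ) : ℝ) * t))
      = Real.cos (Real.pi * (s - t)) := by
  rcases Int.units_eq_one_or ε with rfl | rfl <;> rcases Int.units_eq_one_or ε' with rfl | rfl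
  · left; simp
  · right; simp [sub_eq_add_neg]
  · right
    rw [← Real.cos_neg]
    congr 1
    push_cast
    ring
  · left
    rw [← Real.cos_neg]
    congr 1
    push_cast
    ring

/-- Each of the four factors of Δ is a difference of cosines, cos π(θ 0 ± θ 1) - cos π(θ 2 ± θ 3).
It vanishes exactly when a signed sum of all four angles is an even integer. -/
lemma cosTrace_mem_regularCube_iff {θ : Fin 4 → ℝ} :
    cosTrace θ ∈ regularCube ↔ θ ∈ regularTheta := by
  refine and_congr cosTrace_mem_openCube_iff ?_
  rw [reducibleDisc_cosTrace]
  constructor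
  · intro h ε k hk
    apply h
    have h1 : Real.cos (Real.pi * (((ε 0 : ℤ) : ℝ) * θ 0 + ((ε 1 : ℤ) : ℝ) * θ 1))
        = Real.cos (Real.pi * (((ε 2 : ℤ) : ℝ) * θ 2 + ((ε 3 : ℤ) : ℝ) * θ 3)) := by
      rw [cos_pi_mul_eq_iff]
      rw [Fin.sum_univ_four] at hk
      exact ⟨k, Or.inl (by rw [← hk]; ring)⟩
    rcases cos_pi_units (θ 0) (θ 1) (ε 0) (ε 1) with h2 | h2 <;>
      rcases cos_pi_units (θ 2) (θ 3) (ε 2) (ε 3) with h3 | h3 <;>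
      rw [h2, h3] at h1 <;> rw [h1] <;> ring
  · intro h
    have key : ∀ s t : ℤˣ, Real.cos (Real.pi * (θ 0 + ((s : ℤ) : ℝ) * θ 1))
        ≠ Real.cos (Real.pi * (θ 2 + ((t : ℤ) : ℝ) * θ 3)) := by
      intro s t hst
      obtain ⟨k, hk | hk⟩ := cos_pi_mul_eq_iff.1 hst
      · apply h ![1, s, 1, t] k
        simp only [Fin.sum_univ_four, Matrix.cons_val]
        push_cast
        linarith
      · apply h ![1, s, -1, -t] k
        simp only [Fin.sum_univ_four, Matrix.cons_val]
        push_cast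
        linarith
    have k1 := key 1 1
    have k2 := key 1 (-1)
    have k3 := key (-1) 1
    have k4 := key (-1) (-1)
    push_cast at k1 k2 k3 k4
    simp only [one_mul, neg_mul, ← sub_eq_add_neg] at k1 k2 k3 k4
    simp only [ne_eq, mul_eq_zero, OfNat.ofNat_ne_zero, sub_eq_zero, mul_eq_mul_left_iff, k1, k2,
      k3, k4, or_self, not_false_eq_true]

/-! ### The 24 chambers -/

/-- The sum of the coordinates. -/
def thetaSum (θ : Fin 4 → ℝ) : ℝ := θ 0 + θ 1 + θ 2 + θ 3

/-- Four orthogonal coordinates on the angle space, centred at `(1/2, 1/2, 1/2, 1/2)`. -/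
def centralForm (θ : Fin 4 → ℝ) : Fin 4 → ℝ :=
  ![θ 0 + θ 1 + θ 2 + θ 3 - 2, θ 0 + θ 1 - θ 2 - θ 3, θ 0 - θ 1 + θ 2 - θ 3, θ 0 - θ 1 - θ 2 + θ 3]

/-- The sign `± 1` given by a Boolean. -/
def boolSign (b : Bool) : ℝ := if b then 1 else -1

/-- Chambers cutting off a vertex of the unit cube, and chambers at its centre. -/
abbrev ChamberLabel : Type := (Fin 4 × Bool) ⊕ (Fin 4 → Bool)

/-- The conditions on the angles defining the chamber with a given label, in the unit cube. -/
def ChamberCond : ChamberLabel → (Fin 4 → ℝ) → Prop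
  | Sum.inl (i, false), θ => thetaSum θ - 2 * θ i < 0
  | Sum.inl (i, true), θ => 2 < thetaSum θ - 2 * θ i
  | Sum.inr ε, θ => (∀ i, 0 < thetaSum θ - 2 * θ i ∧ thetaSum θ - 2 * θ i < 2) ∧
      ∀ k, 0 < boolSign (ε k) * centralForm θ k

/-- The chamber with a given label. -/
def chamber (c : ChamberLabel) : Set (Fin 4 → ℝ) :=
  {θ | (∀ i, 0 < θ i ∧ θ i < 1) ∧ ChamberCond c θ}

lemma convex_chamber (c : ChamberLabel) : Convex ℝ (chamber c) := by
  intro θ hθ θ' hθ' s t hs ht hst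
  have comb : ∀ {u v : ℝ}, 0 < u → 0 < v → 0 < s * u + t * v := by
    intro u v hu hv
    rcases hs.eq_or_lt with rfl | hs
    · rw [zero_add] at hst; rw [hst]; linarith
    · exact add_pos_of_pos_of_nonneg (mul_pos hs hu) (mul_nonneg ht hv.le)
  obtain ⟨h1, h2⟩ := hθ
  obtain ⟨h1', h2'⟩ := hθ'
  have hsum : thetaSum (s • θ + t • θ') = s * thetaSum θ + t * thetaSum θ' := by
    simp only [thetaSum, Pi.add_apply, Pi.smul_apply, smul_eq_mul]; ring
  have hform : ∀ k, centralForm (s • θ + t • θ') k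
      = s * centralForm θ k + t * centralForm θ' k := by
    intro k
    fin_cases k
    · simp only [centralForm, Pi.add_apply, Pi.smul_apply, smul_eq_mul, Fin.zero_eta,
        Matrix.cons_val]
      -- The form with index 0 is affine with constant term -2, so here the weights must sum to one.
      linear_combination 2 * hst
    all_goals
      simp only [centralForm, Pi.add_apply, Pi.smul_apply, smul_eq_mul, Matrix.cons_val,
        Fin.mk_one, Fin.reduceFinMk]
      ring
  refine ⟨fun i => ?_, ?_⟩
  · have k1 := comb (h1 i).1 (h1' i).1
    have k2 := comb (sub_pos.2 (h1 i).2) (sub_pos.2 (h1' i).2)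
    simp only [Pi.add_apply, Pi.smul_apply, smul_eq_mul]
    constructor <;> linarith
  · rcases c with ⟨i, _ | _⟩ | ε
    · have k1 := comb (neg_pos.2 h2) (neg_pos.2 h2')
      simp only [ChamberCond, hsum, Pi.add_apply, Pi.smul_apply, smul_eq_mul]
      linarith
    · have k1 := comb (sub_pos.2 h2) (sub_pos.2 h2')
      simp only [ChamberCond, hsum, Pi.add_apply, Pi.smul_apply, smul_eq_mul]
      linarith
    · refine ⟨fun i => ?_, fun k => ?_⟩
      · have k1 := comb (h2.1 i).1 (h2'.1 i).1
        have k2 := comb (sub_pos.2 (h2.1 i).2) (sub_pos.2 (h2'.1 i).2)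
        simp only [hsum, Pi.add_apply, Pi.smul_apply, smul_eq_mul]
        constructor <;> linarith
      · have k1 := comb (h2.2 k) (h2'.2 k)
        rw [hform]
        linarith

lemma continuous_thetaSum : Continuous thetaSum := by
  unfold thetaSum
  fun_prop

lemma continuous_centralForm (k : Fin 4) : Continuous fun θ => centralForm θ k := by
  fin_cases k <;> simp [centralForm] <;> fun_prop

lemma isOpen_forall_of_finite {α ι : Type*} [TopologicalSpace α] [Finite ι] {P : ι → α → Prop}
    (h : ∀ i, IsOpen {x | P i x}) : IsOpen {x | ∀ i, P i x} := by
  rw [Set.ofPred_forall]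
  exact isOpen_iInter_of_finite h

lemma isOpen_chamber (c : ChamberLabel) : IsOpen (chamber c) := by
  have hs := continuous_thetaSum
  have h : ∀ i : Fin 4, Continuous fun θ : Fin 4 → ℝ => thetaSum θ - 2 * θ i :=
    fun i => hs.sub (by fun_prop)
  refine IsOpen.inter ?_ ?_
  · exact isOpen_forall_of_finite fun i =>
      (isOpen_lt continuous_const (continuous_apply i)).inter
        (isOpen_lt (continuous_apply i) continuous_const)
  · rcases c with ⟨i, _ | _⟩ | ε
    · exact isOpen_lt (h i) continuous_const
    · exact isOpen_lt continuous_const (h i)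
    · refine IsOpen.inter ?_ ?_
      · exact isOpen_forall_of_finite fun i =>
          (isOpen_lt continuous_const (h i)).inter (isOpen_lt (h i) continuous_const)
      · exact isOpen_forall_of_finite fun k =>
          isOpen_lt continuous_const (continuous_const.mul (continuous_centralForm k))

lemma boolSign_cases (b : Bool) : boolSign b = 1 ∨ boolSign b = -1 := by
  cases b <;> simp [boolSign]

lemma nonempty_chamber (c : ChamberLabel) : (chamber c).Nonempty := by
  rcases c with ⟨i, _ | _⟩ | ε
  · refine ⟨fun j => if j = i then 1 / 2 else 1 / 10, fun j => ?_, ?_⟩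
    · dsimp only
      split_ifs <;> norm_num
    · simp only [ChamberCond, thetaSum]
      fin_cases i <;> norm_num <;> simp <;> norm_num
  · refine ⟨fun j => if j = i then 1 / 2 else 9 / 10, fun j => ?_, ?_⟩
    · dsimp only
      split_ifs <;> norm_num
    · simp only [ChamberCond, thetaSum]
      fin_cases i <;> norm_num <;> simp <;> norm_num
  · have hb : ∀ k, -1 ≤ boolSign (ε k) ∧ boolSign (ε k) ≤ 1 := fun k => by
      rcases boolSign_cases (ε k) with h | h <;> rw [h] <;> norm_num
    have hsq : ∀ k, 0 < boolSign (ε k) * boolSign (ε k) := fun k => by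
      rcases boolSign_cases (ε k) with h | h <;> rw [h] <;> norm_num
    obtain ⟨h0, h0'⟩ := hb 0
    obtain ⟨h1, h1'⟩ := hb 1
    obtain ⟨h2, h2'⟩ := hb 2
    obtain ⟨h3, h3'⟩ := hb 3
    have k0 := hsq 0
    have k1 := hsq 1
    have k2 := hsq 2
    have k3 := hsq 3
    -- Obtained by solving `centralForm θ k = boolSign (ε k) / 4`. The sum of absolute values is 1,
    -- well inside the cross-polytope.
    refine ⟨![1 / 2 + (boolSign (ε 0) + boolSign (ε 1) + boolSign (ε 2) + boolSign (ε 3)) / 16,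
      1 / 2 + (boolSign (ε 0) + boolSign (ε 1) - boolSign (ε 2) - boolSign (ε 3)) / 16,
      1 / 2 + (boolSign (ε 0) - boolSign (ε 1) + boolSign (ε 2) - boolSign (ε 3)) / 16,
      1 / 2 + (boolSign (ε 0) - boolSign (ε 1) - boolSign (ε 2) + boolSign (ε 3)) / 16],
      fun j => ?_, fun j => ?_, fun k => ?_⟩
    · fin_cases j <;> simp only [Fin.zero_eta, Fin.mk_one, Fin.reduceFinMk, Matrix.cons_val] <;>
        constructor <;> linarith
    · fin_cases j <;> simp only [thetaSum, Fin.zero_eta, Fin.mk_one, Fin.reduceFinMk,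
        Matrix.cons_val] <;> constructor <;> linarith
    · fin_cases k <;> simp only [centralForm, Fin.zero_eta, Fin.mk_one, Fin.reduceFinMk,
        Matrix.cons_val] <;> linarith

/-- Adding the conditions of two corner chambers of the same kind, for i ≠ j, would contradict one
of these bounds. -/
lemma add_lt_thetaSum {θ : Fin 4 → ℝ} (h : ∀ i, 0 < θ i ∧ θ i < 1) {i j : Fin 4} (hij : i ≠ j) :
    θ i + θ j < thetaSum θ ∧ thetaSum θ < θ i + θ j + 2 := by
  obtain ⟨h0, h0'⟩ := h 0
  obtain ⟨h1, h1'⟩ := h 1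
  obtain ⟨h2, h2'⟩ := h 2
  obtain ⟨h3, h3'⟩ := h 3
  unfold thetaSum
  fin_cases i <;> fin_cases j <;> first | exact absurd rfl hij | (constructor <;> simp <;> linarith)

lemma disjoint_chamber {c c' : ChamberLabel} (hne : c ≠ c') :
    Disjoint (chamber c) (chamber c') := by
  rw [Set.disjoint_left]
  rintro θ ⟨h, h1⟩ ⟨-, h2⟩
  rcases c with ⟨i, _ | _⟩ | ε <;> rcases c' with ⟨j, _ | _⟩ | ε' <;>
    simp only [ChamberCond] at h1 h2
  · have hij : i ≠ j := fun h => hne (by rw [h])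
    linarith [(add_lt_thetaSum h hij).1]
  · linarith [(h i).2, (h j).1]
  · linarith [(h2.1 i).1]
  · linarith [(h j).2, (h i).1]
  · have hij : i ≠ j := fun h => hne (by rw [h])
    linarith [(add_lt_thetaSum h hij).2]
  · linarith [(h2.1 i).2]
  · linarith [(h1.1 j).1]
  · linarith [(h1.1 j).2]
  · apply hne
    congr 1
    funext k
    have k1 := h1.2 k
    have k2 := h2.2 k
    cases hk : ε k <;> cases hk' : ε' k <;> rw [hk] at k1 <;> rw [hk'] at k2 <;>
      simp [boolSign] at k1 k2 ⊢ <;> linarith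

lemma exists_mem_chamber {θ : Fin 4 → ℝ} (h : ∀ i, 0 < θ i ∧ θ i < 1) (hr : θ ∈ regularTheta) :
    ∃ c, θ ∈ chamber c := by
  have hne : ∀ i, thetaSum θ - 2 * θ i ≠ 0 ∧ thetaSum θ - 2 * θ i ≠ 2 := by
    intro i
    have key : ∑ j, (((Function.update (1 : Fin 4 → ℤˣ) i (-1) j : ℤˣ) : ℤ) : ℝ) * θ j
        = thetaSum θ - 2 * θ i := by
      rw [Fin.sum_univ_four, thetaSum]
      fin_cases i <;> simp [Function.update] <;> ring
    have h1 := hr.2 (Function.update 1 i (-1)) 0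
    have h2 := hr.2 (Function.update 1 i (-1)) 1
    rw [key] at h1 h2
    push_cast at h1 h2
    rw [mul_zero] at h1
    rw [mul_one] at h2
    exact ⟨h1, h2⟩
  have hq : ∀ k, centralForm θ k ≠ 0 := by
    have h0 := hr.2 1 1
    have h1 := hr.2 ![1, 1, -1, -1] 0
    have h2 := hr.2 ![1, -1, 1, -1] 0
    have h3 := hr.2 ![1, -1, -1, 1] 0
    simp [Fin.sum_univ_four] at h0 h1 h2 h3
    intro k hk
    fin_cases k <;> simp [centralForm] at hk
    · exact h0 (by linarith)
    · exact h1 (by linarith)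
    · exact h2 (by linarith)
    · exact h3 (by linarith)
  by_cases h1 : ∃ i, thetaSum θ - 2 * θ i < 0
  · obtain ⟨i, hi⟩ := h1
    exact ⟨Sum.inl (i, false), h, hi⟩
  by_cases h2 : ∃ i, 2 < thetaSum θ - 2 * θ i
  · obtain ⟨i, hi⟩ := h2
    exact ⟨Sum.inl (i, true), h, hi⟩
  push Not at h1 h2
  refine ⟨Sum.inr fun k => decide (0 < centralForm θ k), h,
    fun i => ⟨lt_of_le_of_ne (h1 i) (hne i).1.symm, lt_of_le_of_ne (h2 i) (hne i).2⟩, fun k => ?_⟩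
  rcases lt_or_gt_of_ne (hq k) with h3 | h3
  · simp [boolSign, h3, h3.le, not_lt.2]
  · simp [boolSign, h3]

/-- The image of a chamber in the space of trace parameters. -/
def region (c : ChamberLabel) : Set (Fin 4 → ℝ) := cosTrace '' chamber c

/-- For example, θ 0 > θ 1 + θ 2 + θ 3 gives cos π(θ 0 - θ 1) < cos π(θ 2 + θ 3): one root interval
lies entirely below the other. At the opposite corners the sums exceed 1, and `per` first replaces
them by 2 minus the sum. -/
lemma corner_gap {i : Fin 4} {b : Bool} {θ : Fin 4 → ℝ} (hθ : θ ∈ chamber (Sum.inl (i, b))) :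
    2 * Real.cos (Real.pi * (θ 0 - θ 1)) < 2 * Real.cos (Real.pi * (θ 2 + θ 3)) ∨
    2 * Real.cos (Real.pi * (θ 2 - θ 3)) < 2 * Real.cos (Real.pi * (θ 0 + θ 1)) := by
  obtain ⟨h, hc⟩ := hθ
  obtain ⟨h0, h0'⟩ := h 0
  obtain ⟨h1, h1'⟩ := h 1
  obtain ⟨h2, h2'⟩ := h 2
  obtain ⟨h3, h3'⟩ := h 3
  have per : ∀ s, Real.cos (Real.pi * (2 - s)) = Real.cos (Real.pi * s) := by
    intro s
    rw [mul_sub, mul_comm Real.pi 2]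
    exact Real.cos_two_pi_sub _
  have sym : ∀ s t, Real.cos (Real.pi * (s - t)) = Real.cos (Real.pi * (t - s)) := by
    intro s t
    rw [← Real.cos_neg]
    congr 1
    ring
  simp only [mul_lt_mul_iff_right₀ (two_pos (α := ℝ))]
  cases b <;> fin_cases i <;> simp only [ChamberCond, thetaSum, Fin.zero_eta, Fin.mk_one,
    Fin.reduceFinMk] at hc
  · left; apply cos_pi_mul_lt <;> linarith
  · left; rw [sym]; apply cos_pi_mul_lt <;> linarith
  · right; apply cos_pi_mul_lt <;> linarith
  · right; rw [sym]; apply cos_pi_mul_lt <;> linarith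
  · left; rw [sym, ← per (θ 2 + θ 3)]; apply cos_pi_mul_lt <;> linarith
  · left; rw [← per (θ 2 + θ 3)]; apply cos_pi_mul_lt <;> linarith
  · right; rw [sym, ← per (θ 0 + θ 1)]; apply cos_pi_mul_lt <;> linarith
  · right; rw [← per (θ 0 + θ 1)]; apply cos_pi_mul_lt <;> linarith

lemma cos_pi_add_lt_cos_pi_sub {s t : ℝ} (hs : 0 < s ∧ s < 1) (ht : 0 < t ∧ t < 1) :
    2 * Real.cos (Real.pi * (s + t)) < 2 * Real.cos (Real.pi * (s - t)) := by
  simp only [mul_lt_mul_iff_right₀ (two_pos (α := ℝ))]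
  apply cos_pi_mul_lt <;> linarith

/-- The inequalities of the cross-polytope make the root intervals overlap, and the nonvanishing of
the four central forms keeps their lower ends, and their upper ends, apart. -/
lemma central_overlap {ε : Fin 4 → Bool} {θ : Fin 4 → ℝ} (hθ : θ ∈ chamber (Sum.inr ε)) :
    2 * Real.cos (Real.pi * (θ 0 + θ 1)) < 2 * Real.cos (Real.pi * (θ 2 - θ 3)) ∧
    2 * Real.cos (Real.pi * (θ 2 + θ 3)) < 2 * Real.cos (Real.pi * (θ 0 - θ 1)) ∧
    2 * Real.cos (Real.pi * (θ 0 + θ 1)) ≠ 2 * Real.cos (Real.pi * (θ 2 + θ 3)) ∧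
    2 * Real.cos (Real.pi * (θ 0 - θ 1)) ≠ 2 * Real.cos (Real.pi * (θ 2 - θ 3)) := by
  obtain ⟨h, hc, hq⟩ := hθ
  obtain ⟨h0, h0'⟩ := h 0
  obtain ⟨h1, h1'⟩ := h 1
  obtain ⟨h2, h2'⟩ := h 2
  obtain ⟨h3, h3'⟩ := h 3
  obtain ⟨c0, c0'⟩ := hc 0
  obtain ⟨c1, c1'⟩ := hc 1
  obtain ⟨c2, c2'⟩ := hc 2
  obtain ⟨c3, c3'⟩ := hc 3
  unfold thetaSum at *
  have hq' : ∀ k, centralForm θ k ≠ 0 := fun k hk => by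
    have := hq k
    rw [hk, mul_zero] at this
    exact lt_irrefl _ this
  have q0 : θ 0 + θ 1 + θ 2 + θ 3 - 2 ≠ 0 := hq' 0
  have q1 : θ 0 + θ 1 - θ 2 - θ 3 ≠ 0 := hq' 1
  have q2 : θ 0 - θ 1 + θ 2 - θ 3 ≠ 0 := hq' 2
  have q3 : θ 0 - θ 1 - θ 2 + θ 3 ≠ 0 := hq' 3
  -- In this cell the signed sums in question are confined to an open interval of length 4 around 0
  -- (around 2 for the full sum), so only one wall of each family can be met.
  have int0 : ∀ k : ℤ, (-2 : ℝ) < 2 * k → (2 : ℝ) * k < 2 → (2 : ℝ) * k = 0 := by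
    intro k hk1 hk2
    have hk1' : (-2 : ℤ) < 2 * k := by exact_mod_cast hk1
    have hk2' : 2 * k < 2 := by exact_mod_cast hk2
    have : k = 0 := by omega
    simp [this]
  simp only [mul_lt_mul_iff_right₀ (two_pos (α := ℝ))]
  refine ⟨by apply cos_pi_mul_lt <;> linarith, by apply cos_pi_mul_lt <;> linarith, ?_, ?_⟩
  · intro he
    obtain ⟨k, hk | hk⟩ := cos_pi_mul_eq_iff.1 (mul_left_cancel₀ two_ne_zero he)
    · have := int0 (k - 1) (by push_cast; linarith) (by push_cast; linarith)
      push_cast at this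
      exact q0 (by linarith)
    · exact q1 (by linarith [int0 k (by linarith) (by linarith)])
  · intro he
    obtain ⟨k, hk | hk⟩ := cos_pi_mul_eq_iff.1 (mul_left_cancel₀ two_ne_zero he)
    · exact q2 (by linarith [int0 k (by linarith) (by linarith)])
    · exact q3 (by linarith [int0 k (by linarith) (by linarith)])

lemma chamber_subset_regularTheta (c : ChamberLabel) : chamber c ⊆ regularTheta := by
  rintro θ ⟨h, hc⟩
  have h0 := h 0
  have h1 := h 1
  have h2 := h 2
  have h3 := h 3
  rw [← cosTrace_mem_regularCube_iff]
  refine ⟨cosTrace_mem_openCube_iff.2 fun i k hk => ?_, ?_⟩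
  · obtain ⟨h4, h5⟩ := h i
    rw [hk] at h4 h5
    have h4' : 0 < k := by exact_mod_cast h4
    have h5' : k < 1 := by exact_mod_cast h5
    omega
  rw [reducibleDisc_cosTrace]
  have k1 := cos_pi_add_lt_cos_pi_sub h0 h1
  have k2 := cos_pi_add_lt_cos_pi_sub h2 h3
  rcases c with ⟨i, b⟩ | ε
  · have k3 := corner_gap ⟨h, hc⟩
    have k4 : ∀ {l h l' h' : ℝ}, l < h → l' < h' → h < l' ∨ h' < l →
        4 * ((l - l') * (l - h') * (h - l') * (h - h')) ≠ 0 := by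
      rintro l h l' h' h1 h2 (h3 | h3)
      all_goals
        refine mul_ne_zero four_ne_zero (mul_ne_zero (mul_ne_zero (mul_ne_zero ?_ ?_) ?_) ?_)
        all_goals
          rw [sub_ne_zero]
          first | exact ne_of_gt (by linarith) | exact ne_of_lt (by linarith)
    exact k4 k1 k2 k3
  · obtain ⟨k3, k4, k5, k6⟩ := central_overlap ⟨h, hc⟩
    exact mul_ne_zero four_ne_zero (mul_ne_zero (mul_ne_zero (mul_ne_zero (sub_ne_zero.2 k5)
      (sub_ne_zero.2 k3.ne)) (sub_ne_zero.2 k4.ne')) (sub_ne_zero.2 k6))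

/-! ### The components of the complement of `Δ = 0` -/

lemma region_eq (c : ChamberLabel) : region c = openCube ∩ arccosTheta ⁻¹' chamber c := by
  ext p
  constructor
  · rintro ⟨θ, hθ, rfl⟩
    refine ⟨(cosTrace_mem_regularCube_iff.2 (chamber_subset_regularTheta c hθ)).1, ?_⟩
    rw [Set.mem_preimage, arccosTheta_cosTrace fun i => ⟨(hθ.1 i).1.le, (hθ.1 i).2.le⟩]
    exact hθ
  · rintro ⟨h1, h2⟩
    exact ⟨_, h2, cosTrace_arccosTheta h1⟩

lemma isOpen_openCube : IsOpen openCube :=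
  isOpen_forall_of_finite fun i => (isOpen_lt continuous_const (continuous_apply i)).inter
    (isOpen_lt (continuous_apply i) continuous_const)

lemma isOpen_region (c : ChamberLabel) : IsOpen (region c) := by
  rw [region_eq]
  exact isOpen_openCube.inter ((isOpen_chamber c).preimage continuous_arccosTheta)

lemma isPreconnected_region (c : ChamberLabel) : IsPreconnected (region c) :=
  (convex_chamber c).isPreconnected.image _ continuous_cosTrace.continuousOn

lemma disjoint_region {c c' : ChamberLabel} (hne : c ≠ c') : Disjoint (region c) (region c') := by
  rw [region_eq, region_eq, Set.disjoint_left]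
  exact fun p hp hp' => Set.disjoint_left.1 (disjoint_chamber hne) hp.2 hp'.2

lemma regularCube_eq_iUnion : regularCube = ⋃ c, region c := by
  ext p
  rw [Set.mem_iUnion]
  constructor
  · intro hp
    obtain ⟨c, hc⟩ := exists_mem_chamber (arccosTheta_mem hp.1) (by
      rw [← cosTrace_mem_regularCube_iff, cosTrace_arccosTheta hp.1]
      exact hp)
    exact ⟨c, _, hc, cosTrace_arccosTheta hp.1⟩
  · rintro ⟨c, θ, hθ, rfl⟩
    exact cosTrace_mem_regularCube_iff.2 (chamber_subset_regularTheta c hθ)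

/-- The regions are open, preconnected and pairwise disjoint, and they exhaust the complement of Δ =
0 in the cube. -/
lemma connectedComponentIn_regularCube {c : ChamberLabel} {p : Fin 4 → ℝ} (hp : p ∈ region c) :
    connectedComponentIn regularCube p = region c := by
  refine connectedComponentIn_eq_of_separated (O := region c)
    (O' := ⋃ c' ∈ {c' | c' ≠ c}, region c')
    (isPreconnected_region c) (isOpen_region c) ?_ ?_ ?_ ?_ hp
  · exact isOpen_biUnion fun c' _ => isOpen_region c'
  · rw [Set.disjoint_iUnion₂_right]
    exact fun c' hc' => disjoint_region (Ne.symm hc')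
  · rw [regularCube_eq_iUnion]
    refine Set.iUnion_subset fun c' => ?_
    by_cases h : c' = c
    · rw [h]; exact Set.subset_union_left
    · exact (Set.subset_biUnion_of_mem (u := fun c' => region c') h).trans Set.subset_union_right
  · rw [eq_comm, Set.inter_eq_right, regularCube_eq_iUnion]
    exact Set.subset_iUnion _ c

lemma componentsOf_regularCube : componentsOf regularCube = Set.range region := by
  ext U
  constructor
  · rintro ⟨p, hp, rfl⟩
    rw [regularCube_eq_iUnion, Set.mem_iUnion] at hp
    obtain ⟨c, hc⟩ := hp
    exact ⟨c, (connectedComponentIn_regularCube hc).symm⟩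
  · rintro ⟨c, rfl⟩
    obtain ⟨θ, hθ⟩ := nonempty_chamber c
    exact ⟨cosTrace θ, cosTrace_mem_regularCube_iff.2 (chamber_subset_regularTheta c hθ),
      (connectedComponentIn_regularCube ⟨θ, hθ, rfl⟩).symm⟩

lemma region_nonempty (c : ChamberLabel) : (region c).Nonempty := (nonempty_chamber c).image _

lemma region_injective : Function.Injective region := by
  intro c c' h
  by_contra hne
  have h1 := disjoint_region hne
  rw [h, disjoint_self] at h1
  exact (region_nonempty c').ne_empty h1

lemma sq_lt_four_of_cos {t : ℝ} (ht : 0 < t ∧ t < 1) : (2 * Real.cos (Real.pi * t)) ^ 2 < 4 := by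
  have h1 : 0 < Real.sin (Real.pi * t) := Real.sin_pos_of_pos_of_lt_pi
    (mul_pos Real.pi_pos ht.1) (by nlinarith [Real.pi_pos])
  nlinarith [Real.sin_sq_add_cos_sq (Real.pi * t), sq_pos_of_pos h1]

lemma neg_two_le_two_cos (t : ℝ) : -2 ≤ 2 * Real.cos t := by linarith [Real.neg_one_le_cos t]

lemma two_cos_le_two (t : ℝ) : 2 * Real.cos t ≤ 2 := by linarith [Real.cos_le_one t]

lemma correspondsToSL2R_corner (i : Fin 4) (b : Bool) :
    CorrespondsToSL2R (region (Sum.inl (i, b))) := by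
  rintro _ ⟨θ, hθ, rfl⟩
  rw [cosTrace_eq]
  exact uniqueBoundedComponent_of_disjoint (sq_lt_four_of_cos (hθ.1 0)) (sq_lt_four_of_cos (hθ.1 2))
    (cos_pi_add_add_cos_pi_sub _ _) (cos_pi_add_mul_cos_pi_sub _ _)
    (cos_pi_add_add_cos_pi_sub _ _) (cos_pi_add_mul_cos_pi_sub _ _)
    (cos_pi_add_lt_cos_pi_sub (hθ.1 0) (hθ.1 1)) (cos_pi_add_lt_cos_pi_sub (hθ.1 2) (hθ.1 3))
    (neg_two_le_two_cos _) (two_cos_le_two _) (neg_two_le_two_cos _) (two_cos_le_two _)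
    (corner_gap hθ)

lemma correspondsToSU2_central (ε : Fin 4 → Bool) : CorrespondsToSU2 (region (Sum.inr ε)) := by
  rintro _ ⟨θ, hθ, rfl⟩
  rw [cosTrace_eq]
  obtain ⟨h1, h2, h3, h4⟩ := central_overlap hθ
  exact uniqueBoundedComponent_of_overlap (sq_lt_four_of_cos (hθ.1 0)) (sq_lt_four_of_cos (hθ.1 2))
    (cos_pi_add_add_cos_pi_sub _ _) (cos_pi_add_mul_cos_pi_sub _ _)
    (cos_pi_add_add_cos_pi_sub _ _) (cos_pi_add_mul_cos_pi_sub _ _)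
    (cos_pi_add_lt_cos_pi_sub (hθ.1 0) (hθ.1 1)) (cos_pi_add_lt_cos_pi_sub (hθ.1 2) (hθ.1 3))
    (neg_two_le_two_cos _) (two_cos_le_two _) (neg_two_le_two_cos _) (two_cos_le_two _)
    h1 h2 h3 h4

lemma not_correspondsToSU2_of_correspondsToSL2R {U : Set (Fin 4 → ℝ)} (hU : U.Nonempty)
    (h : CorrespondsToSL2R U) : ¬ CorrespondsToSU2 U := by
  obtain ⟨p, hp⟩ := hU
  exact fun h' => UniqueBoundedComponent.not_of_imp_not (h p hp) (fun m hm hm' => hm.2 hm'.1)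
    (h' p hp)

lemma components_correspondsToSL2R : {U ∈ componentsOf regularCube | CorrespondsToSL2R U}
    = Set.range fun i : Fin 4 × Bool => region (Sum.inl i) := by
  rw [componentsOf_regularCube]
  ext U
  constructor
  · rintro ⟨⟨i | ε, rfl⟩, h⟩
    · exact ⟨i, rfl⟩
    · exact absurd (correspondsToSU2_central ε)
        (not_correspondsToSU2_of_correspondsToSL2R (region_nonempty _) h)
  · rintro ⟨i, rfl⟩
    exact ⟨⟨_, rfl⟩, correspondsToSL2R_corner i.1 i.2⟩

lemma components_correspondsToSU2 : {U ∈ componentsOf regularCube | CorrespondsToSU2 U}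
    = Set.range fun ε : Fin 4 → Bool => region (Sum.inr ε) := by
  rw [componentsOf_regularCube]
  ext U
  constructor
  · rintro ⟨⟨i | ε, rfl⟩, h⟩
    · exact absurd h (not_correspondsToSU2_of_correspondsToSL2R (region_nonempty _)
        (correspondsToSL2R_corner i.1 i.2))
    · exact ⟨ε, rfl⟩
  · rintro ⟨ε, rfl⟩
    exact ⟨⟨_, rfl⟩, correspondsToSU2_central ε⟩

lemma ncard_range_of_injective {α β : Type*} [Fintype α] {f : α → β} (hf : Function.Injective f) :
    (Set.range f).ncard = Fintype.card α := by
  rw [← Set.image_univ, Set.ncard_image_of_injective _ hf, Set.ncard_univ, Nat.card_eq_fintype_card]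

lemma ncard_components : (componentsOf regularCube).ncard = 24 := by
  rw [componentsOf_regularCube, ncard_range_of_injective region_injective]
  rfl

lemma ncard_components_SL2R :
    {U ∈ componentsOf regularCube | CorrespondsToSL2R U}.ncard = 8 := by
  rw [components_correspondsToSL2R,
    ncard_range_of_injective (f := fun i : Fin 4 × Bool => region (Sum.inl i))
      (region_injective.comp Sum.inl_injective)]
  rfl

lemma ncard_components_SU2 : {U ∈ componentsOf regularCube | CorrespondsToSU2 U}.ncard = 16 := by
  rw [components_correspondsToSU2,
    ncard_range_of_injective (f := fun ε : Fin 4 → Bool => region (Sum.inr ε))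
      (region_injective.comp Sum.inr_injective)]
  rfl

/-! ### Determinations of `θ` -/

lemma complexify_injective {n : ℕ} : Function.Injective (complexify (n := n)) := by
  intro v w h
  funext i
  exact Complex.ofReal_injective (congrFun h i)

lemma traceOfTheta_complexify (θ : Fin 4 → ℝ) :
    traceOfTheta (complexify θ) = complexify (cosTrace θ) := by
  funext i
  simp [traceOfTheta, complexify, cosTrace]

/-- A complex angle with the same cosine as a real one differs from plus or minus it by a multiple
of 2π, so every determination over the cube is automatically real. -/
lemma exists_real_theta {p : Fin 4 → ℝ} (hp : p ∈ openCube) {θ : Fin 4 → ℂ}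
    (h : traceOfTheta θ = complexify p) :
    θ = complexify (fun i => (θ i).re) ∧ cosTrace (fun i => (θ i).re) = p := by
  have key : θ = complexify (fun i => (θ i).re) := by
    funext i
    have h1 : Complex.cos (Real.pi * θ i)
        = Complex.cos (Real.pi * ((arccosTheta p i : ℝ) : ℂ)) := by
      have h2 := congrFun h i
      rw [← cosTrace_arccosTheta hp, ← traceOfTheta_complexify] at h2
      exact mul_left_cancel₀ two_ne_zero h2
    have hpi : (Real.pi : ℂ) ≠ 0 := Complex.ofReal_ne_zero.2 Real.pi_ne_zero
    have h3 : ∃ t : ℝ, θ i = t := by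
      obtain ⟨k, hk | hk⟩ := Complex.cos_eq_cos_iff.1 h1
      · refine ⟨arccosTheta p i - 2 * k, ?_⟩
        apply mul_left_cancel₀ hpi
        push_cast
        linear_combination -hk
      · refine ⟨2 * k - arccosTheta p i, ?_⟩
        apply mul_left_cancel₀ hpi
        push_cast
        linear_combination hk
    obtain ⟨t, ht⟩ := h3
    simp [complexify, ht]
  refine ⟨key, complexify_injective ?_⟩
  rw [← traceOfTheta_complexify, ← key, h]

lemma exists_thetaDetermination {U : Set (Fin 4 → ℝ)} (hU : U ⊆ openCube) :
    ∃ s, IsThetaDetermination U s := by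
  refine ⟨fun p => complexify (arccosTheta p), ?_, fun p hp => ?_⟩
  · refine Continuous.continuousOn (continuous_pi fun i => Complex.continuous_ofReal.comp ?_)
    exact (continuous_apply i).comp continuous_arccosTheta
  · rw [traceOfTheta_complexify, cosTrace_arccosTheta (hU hp)]

/-! ### The trace map on the components of the set of regular angles -/

lemma exists_fold_unit_interval (n : ℤ) : ∃ m : ℤ, ∃ ε : ℤˣ, ∀ t : ℝ, n < t → t < n + 1 →
    0 < ((ε : ℤ) : ℝ) * (t - 2 * m) ∧ ((ε : ℤ) : ℝ) * (t - 2 * m) < 1 := by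
  obtain ⟨m, hm⟩ := Int.even_or_odd' n
  rcases hm with rfl | rfl
  · refine ⟨m, 1, fun t h1 h2 => ?_⟩
    push_cast at *
    constructor <;> linarith
  · refine ⟨m + 1, -1, fun t h1 h2 => ?_⟩
    push_cast at *
    constructor <;> linarith

/-- The projection of a component to a coordinate is an interval without integers, so the integer
parts are constant on it. -/
lemma floor_eq_of_mem_component {θ w : Fin 4 → ℝ} (hθ : θ ∈ regularTheta)
    (hw : w ∈ connectedComponentIn regularTheta θ) (i : Fin 4) :
    (⌊θ i⌋ : ℝ) < w i ∧ w i < ⌊θ i⌋ + 1 := by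
  have hpre : IsPreconnected ((fun v : Fin 4 → ℝ => v i) '' connectedComponentIn regularTheta θ) :=
    isPreconnected_connectedComponentIn.image _ (by fun_prop)
  have hord := hpre.ordConnected
  have hθ' := Set.mem_image_of_mem (fun v : Fin 4 → ℝ => v i) (mem_connectedComponentIn hθ)
  have hw' := Set.mem_image_of_mem (fun v : Fin 4 → ℝ => v i) hw
  have hno : ∀ k : ℤ, (k : ℝ) ∉ (fun v : Fin 4 → ℝ => v i) ''
      connectedComponentIn regularTheta θ := by
    rintro k ⟨v, hv, hvk⟩
    exact (connectedComponentIn_subset _ _ hv).1 i k hvk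
  constructor
  · by_contra! h
    exact hno _ (hord.out hw' hθ' ⟨h, Int.floor_le _⟩)
  · by_contra! h
    refine hno (⌊θ i⌋ + 1) (hord.out hθ' hw' ⟨?_, ?_⟩)
    · push_cast; exact (Int.lt_floor_add_one _).le
    · push_cast; exact h

lemma mapsTo_component {α β : Type*} [TopologicalSpace α] [TopologicalSpace β] {f : α → β}
    {X : Set α} {Y : Set β} (hf : Continuous f) (h : Set.MapsTo f X Y) {x : α} (hx : x ∈ X) :
    Set.MapsTo f (connectedComponentIn X x) (connectedComponentIn Y (f x)) := fun _ hy =>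
  connectedComponentIn_mono _ h.image_subset (hf.continuousOn.mapsTo_connectedComponentIn hx hy)

/-- The trace map is a bijection from components of the set of regular angles to components. -/
lemma bijOn_cosTrace_component {θ : Fin 4 → ℝ} (hθ : θ ∈ regularTheta) :
    Set.BijOn cosTrace (connectedComponentIn regularTheta θ)
      (connectedComponentIn regularCube (cosTrace θ)) := by
  choose m ε hε using fun i => exists_fold_unit_interval ⌊θ i⌋
  -- The inverse branch belonging to this cell: the integers m i and signs ε i fold the unit box
  -- containing the cell onto the unit cube.
  let σ : (Fin 4 → ℝ) → (Fin 4 → ℝ) :=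
    fun p i => 2 * m i + ((ε i : ℤ) : ℝ) * arccosTheta p i
  have hεε : ∀ i, ((ε i : ℤ) : ℝ) * ((ε i : ℤ) : ℝ) = 1 := fun i => by
    rcases Int.units_eq_one_or (ε i) with h | h <;> simp [h]
  have hcos : ∀ u : Fin 4 → ℝ,
      cosTrace (fun i => 2 * m i + ((ε i : ℤ) : ℝ) * u i) = cosTrace u := by
    intro u
    funext i
    simp only [cosTrace]
    congr 1
    rw [cos_pi_mul_eq_iff]
    refine ⟨m i, ?_⟩
    rcases Int.units_eq_one_or (ε i) with h | h
    · right; rw [h]; push_cast; ring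
    · left; rw [h]; push_cast; ring
  have hσ : Continuous σ := by
    refine continuous_pi fun i => continuous_const.add (continuous_const.mul ?_)
    exact (continuous_apply i).comp continuous_arccosTheta
  have hright : ∀ p ∈ regularCube, cosTrace (σ p) = p := fun p hp => by
    rw [hcos, cosTrace_arccosTheta hp.1]
  have hleft : ∀ w ∈ connectedComponentIn regularTheta θ, σ (cosTrace w) = w := by
    intro w hw
    have h1 : ∀ i, 0 < ((ε i : ℤ) : ℝ) * (w i - 2 * m i) ∧
        ((ε i : ℤ) : ℝ) * (w i - 2 * m i) < 1 := fun i =>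
      hε i (w i) (floor_eq_of_mem_component hθ hw i).1 (floor_eq_of_mem_component hθ hw i).2
    obtain ⟨u, hu⟩ : ∃ u : Fin 4 → ℝ, u = fun i => ((ε i : ℤ) : ℝ) * (w i - 2 * m i) := ⟨_, rfl⟩
    have h2 : w = fun i => 2 * m i + ((ε i : ℤ) : ℝ) * u i := by
      funext i
      rw [hu]
      linear_combination (-(w i - 2 * m i)) * hεε i
    rw [h2, hcos]
    simp only [σ]
    rw [arccosTheta_cosTrace]
    intro i
    rw [hu]
    exact ⟨(h1 i).1.le, (h1 i).2.le⟩
  refine ⟨?_, Set.LeftInvOn.injOn (f₁' := σ) hleft, ?_⟩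
  · exact mapsTo_component continuous_cosTrace
      (fun v hv => cosTrace_mem_regularCube_iff.2 hv) hθ
  · intro p hp
    have h1 : Set.MapsTo σ regularCube regularTheta := fun v hv => by
      rw [← cosTrace_mem_regularCube_iff, hright v hv]
      exact hv
    have h2 := mapsTo_component hσ h1 (cosTrace_mem_regularCube_iff.2 hθ) hp
    rw [hleft θ (mem_connectedComponentIn hθ)] at h2
    exact ⟨_, h2, hright p (connectedComponentIn_subset _ _ hp)⟩

/-- A determination is continuous with a right-inverse property for the trace map, so it lands in a
single cell. Injectivity of the trace map on that cell makes it surjective onto the cell. -/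
lemma IsThetaDetermination.bijOn {U : Set (Fin 4 → ℝ)} (hU : U ∈ componentsOf regularCube)
    {s : (Fin 4 → ℝ) → (Fin 4 → ℂ)} (hs : IsThetaDetermination U s) {p : Fin 4 → ℝ} (hp : p ∈ U) :
    ∃ r : (Fin 4 → ℝ) → (Fin 4 → ℝ), (∀ v ∈ U, s v = complexify (r v)) ∧ r p ∈ regularTheta ∧
      Set.BijOn r U (connectedComponentIn regularTheta (r p)) := by
  obtain ⟨u, hu, rfl⟩ := hU
  have hsub := connectedComponentIn_subset regularCube p
  have hp0 := hp
  rw [connectedComponentIn_eq hp0] at hs hp ⊢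
  let r : (Fin 4 → ℝ) → (Fin 4 → ℝ) := fun v i => (s v i).re
  have hr : ∀ v ∈ connectedComponentIn regularCube p, s v = complexify (r v) ∧ cosTrace (r v) = v :=
    fun v hv => exists_real_theta (hsub hv).1 (hs.2 v hv)
  have hreg : ∀ v ∈ connectedComponentIn regularCube p, r v ∈ regularTheta := fun v hv => by
    rw [← cosTrace_mem_regularCube_iff, (hr v hv).2]
    exact hsub hv
  have hcont : ContinuousOn r (connectedComponentIn regularCube p) :=
    continuousOn_pi.2 fun i => Complex.continuous_re.comp_continuousOn
      ((continuous_apply i).comp_continuousOn hs.1)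
  have hmaps : Set.MapsTo r (connectedComponentIn regularCube p)
      (connectedComponentIn regularTheta (r p)) := by
    intro v hv
    refine (isPreconnected_connectedComponentIn.image r hcont).subset_connectedComponentIn
      ⟨p, hp, rfl⟩ ?_ ⟨v, hv, rfl⟩
    rintro _ ⟨w, hw, rfl⟩
    exact hreg w hw
  have hbij := bijOn_cosTrace_component (hreg p hp)
  rw [(hr p hp).2] at hbij
  refine ⟨r, fun v hv => (hr v hv).1, hreg p hp, hmaps,
    Set.LeftInvOn.injOn (f₁' := cosTrace) fun v hv => (hr v hv).2, ?_⟩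
  intro w hw
  have h1 := hbij.mapsTo hw
  exact ⟨cosTrace w, h1, hbij.injOn (hmaps h1) hw (hr _ h1).2⟩

/-! ### The action of the Okamoto group on real angles -/

/-- `g` restricts to a homeomorphism `f` of the real angles that preserves the regular ones. -/
def ActsOnRegular (g : Equiv.Perm (Fin 4 → ℂ)) (f : (Fin 4 → ℝ) ≃ₜ (Fin 4 → ℝ)) : Prop :=
  (∀ θ, g (complexify θ) = complexify (f θ)) ∧ ∀ θ, f θ ∈ regularTheta ↔ θ ∈ regularTheta

lemma ActsOnRegular.mul {g g' : Equiv.Perm (Fin 4 → ℂ)} {f f' : (Fin 4 → ℝ) ≃ₜ (Fin 4 → ℝ)}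
    (h : ActsOnRegular g f) (h' : ActsOnRegular g' f') : ActsOnRegular (g * g') (f'.trans f) :=
  ⟨fun θ => by rw [Equiv.Perm.mul_apply, h'.1, h.1]; rfl,
    fun θ => (h.2 (f' θ)).trans (h'.2 θ)⟩

lemma ActsOnRegular.inv {g : Equiv.Perm (Fin 4 → ℂ)} {f : (Fin 4 → ℝ) ≃ₜ (Fin 4 → ℝ)}
    (h : ActsOnRegular g f) : ActsOnRegular g⁻¹ f.symm :=
  ⟨fun θ => by rw [Equiv.Perm.inv_eq_iff_eq, h.1, f.apply_symm_apply],
    fun θ => by rw [← h.2, f.apply_symm_apply]⟩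

lemma ActsOnRegular.image_component {g : Equiv.Perm (Fin 4 → ℂ)} {f : (Fin 4 → ℝ) ≃ₜ (Fin 4 → ℝ)}
    (h : ActsOnRegular g f) {θ : Fin 4 → ℝ} (hθ : θ ∈ regularTheta) :
    f '' connectedComponentIn regularTheta θ = connectedComponentIn regularTheta (f θ) := by
  rw [f.image_connectedComponentIn hθ]
  congr 1
  ext v
  constructor
  · rintro ⟨w, hw, rfl⟩
    exact (h.2 w).2 hw
  · intro hv
    refine ⟨f.symm v, ?_, f.apply_symm_apply v⟩
    rw [← h.2, f.apply_symm_apply]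
    exact hv

/-- The branch is a composite of three bijections: the determination onto a cell, the symmetry onto
another cell, and the trace map onto a component. -/
lemma okamotoCarries_component {U : Set (Fin 4 → ℝ)} (hU : U ∈ componentsOf regularCube)
    {s : (Fin 4 → ℝ) → (Fin 4 → ℂ)} (hs : IsThetaDetermination U s) {p : Fin 4 → ℝ} (hp : p ∈ U) :
    ∃ θ ∈ regularTheta, s p = complexify θ ∧ ∀ g f, ActsOnRegular g f →
      OkamotoCarries g s U (connectedComponentIn regularCube (cosTrace (f θ))) := by
  obtain ⟨r, h1, h2, h3⟩ := hs.bijOn hU hp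
  refine ⟨r p, h2, h1 p hp, fun g f hgf => ?_⟩
  have h4 : Set.BijOn f (connectedComponentIn regularTheta (r p))
      (connectedComponentIn regularTheta (f (r p))) := by
    rw [← hgf.image_component h2]
    exact f.injective.injOn.bijOn_image
  have h5 := bijOn_cosTrace_component ((hgf.2 (r p)).2 h2)
  have h6 := (complexify_injective (n := 4)).injOn.bijOn_image
    (s := connectedComponentIn regularCube (cosTrace (f (r p))))
  refine (h6.comp (h5.comp (h4.comp h3))).congr fun v hv => ?_
  simp only [Function.comp_apply, okamotoBranch]
  rw [h1 v hv, hgf.1, traceOfTheta_complexify]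

/-- A homeomorphism from a pair of inverse continuous maps, preserving the regular angles. -/
lemma exists_actsOnRegular {g : Equiv.Perm (Fin 4 → ℂ)} (F F' : (Fin 4 → ℝ) → (Fin 4 → ℝ))
    (hF : Continuous F) (hF' : Continuous F') (h1 : ∀ θ, g (complexify θ) = complexify (F θ))
    (h2 : ∀ θ, g.symm (complexify θ) = complexify (F' θ))
    (h3 : ∀ θ ∈ regularTheta, F θ ∈ regularTheta) (h4 : ∀ θ ∈ regularTheta, F' θ ∈ regularTheta) :
    ∃ f, ActsOnRegular g f := by
  have e1 : ∀ θ, F' (F θ) = θ := fun θ => complexify_injective (by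
    rw [← h2, ← h1, Equiv.symm_apply_apply])
  have e2 : ∀ θ, F (F' θ) = θ := fun θ => complexify_injective (by
    rw [← h1, ← h2, Equiv.apply_symm_apply])
  refine ⟨⟨⟨F, F', e1, e2⟩, hF, hF'⟩, h1, fun θ => ⟨fun h => ?_, h3 θ⟩⟩
  have := h4 _ h
  rwa [← e1 θ]

/-- Changing signs of the nᵢ alters their sum by an even number, so evenness of the sum moves every
wall ±θ₁ ± θ₂ ± θ₃ ± θ₄ = 2k to a wall of the same kind. -/
lemma regularTheta_translate {θ : Fin 4 → ℝ} (hθ : θ ∈ regularTheta) {n : Fin 4 → ℤ}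
    (hn : Even (∑ i, n i)) : (fun i => θ i + n i) ∈ regularTheta := by
  refine ⟨fun i k hk => hθ.1 i (k - n i) (by push_cast; linarith), fun ε k hk => ?_⟩
  have heven : Even (∑ i, (ε i : ℤ) * n i) := by
    have h : ∀ e : ℤˣ, ∀ x : ℤ, ∃ y, (e : ℤ) * x = x + 2 * y := fun e x => by
      rcases Int.units_eq_one_or e with rfl | rfl
      · exact ⟨0, by simp⟩
      · exact ⟨-x, by push_cast; ring⟩
    choose y hy using fun i => h (ε i) (n i)
    simp only [hy, Finset.sum_add_distrib, ← Finset.mul_sum]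
    exact hn.add (even_two_mul _)
  obtain ⟨j, hj⟩ := heven
  apply hθ.2 ε (k - j)
  have hj' : ∑ i, ((ε i : ℤ) : ℝ) * (n i : ℝ) = j + j := by
    exact_mod_cast congrArg (Int.cast (R := ℝ)) hj
  simp only [mul_add, Finset.sum_add_distrib, hj'] at hk
  push_cast
  linarith

lemma regularTheta_permute {θ : Fin 4 → ℝ} (hθ : θ ∈ regularTheta) (σ : Equiv.Perm (Fin 4)) :
    (fun i => θ (σ i)) ∈ regularTheta := by
  refine ⟨fun i => hθ.1 (σ i), fun ε k hk => hθ.2 (fun i => ε (σ.symm i)) k ?_⟩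
  rw [← hk]
  exact (Fintype.sum_equiv σ _ _ fun i => by simp).symm

lemma regularTheta_signs {θ : Fin 4 → ℝ} (hθ : θ ∈ regularTheta) (ε : Fin 4 → ℤˣ) :
    (fun i => ((ε i : ℤ) : ℝ) * θ i) ∈ regularTheta := by
  refine ⟨fun i k hk => ?_, fun ε' k hk => hθ.2 (fun i => ε' i * ε i) k ?_⟩
  · rcases Int.units_eq_one_or (ε i) with h | h <;> simp only [h] at hk
    · exact hθ.1 i k (by simpa using hk)
    · exact hθ.1 i (-k) (by push_cast at hk ⊢; linarith)
  · rw [← hk]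
    refine Finset.sum_congr rfl fun i _ => ?_
    push_cast
    ring

/-- The symmetry exchanges the walls θᵢ = k with the sign walls having one or three minus signs,
fixes each wall with two minus signs, and permutes the walls with all signs equal. -/
lemma regularTheta_okamoto {θ : Fin 4 → ℝ} (hθ : θ ∈ regularTheta) :
    (fun i => θ i - (∑ j, θ j) / 2 + 1) ∈ regularTheta := by
  constructor
  · intro i k hk
    apply hθ.2 (Function.update 1 i (-1)) (1 - k)
    rw [Fin.sum_univ_four] at *
    fin_cases i <;> simp [Function.update] at hk ⊢ <;> linarith
  · intro ε k hk
    have h1 := hθ.2 1 (2 - k)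
    have h2 := hθ.2 1 (k + 2)
    have h3 := hθ.2 ε k
    have h4 := fun i => hθ.1 i (1 - k)
    have h5 := fun i => hθ.1 i (k + 1)
    push_cast at h1 h2 h4 h5
    simp only [Fin.sum_univ_four, Pi.one_apply, Units.val_one, Int.cast_one, one_mul] at h1 h2 h3 hk
    rcases Int.units_eq_one_or (ε 0) with e0 | e0 <;>
    rcases Int.units_eq_one_or (ε 1) with e1 | e1 <;>
    rcases Int.units_eq_one_or (ε 2) with e2 | e2 <;>
    rcases Int.units_eq_one_or (ε 3) with e3 | e3 <;>
    simp only [e0, e1, e2, e3, Units.val_one, Units.val_neg, Int.cast_one, Int.cast_neg, one_mul,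
      neg_mul] at hk h3 <;>
    first
    | exact h1 (by linarith)
    | exact h2 (by linarith)
    | exact h3 (by linarith)
    | exact h4 0 (by linarith)
    | exact h4 1 (by linarith)
    | exact h4 2 (by linarith)
    | exact h4 3 (by linarith)
    | exact h5 0 (by linarith)
    | exact h5 1 (by linarith)
    | exact h5 2 (by linarith)
    | exact h5 3 (by linarith)

lemma thetaTranslation_apply (n : Fin 4 → ℤ) (θ : Fin 4 → ℂ) (i : Fin 4) :
    thetaTranslation n θ i = θ i + n i := rfl

lemma thetaSigns_apply (ε : Fin 4 → ℤˣ) (θ : Fin 4 → ℂ) (i : Fin 4) :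
    thetaSigns ε θ i = ((ε i : ℤ) : ℂ) * θ i := rfl

lemma thetaSigns_symm (ε : Fin 4 → ℤˣ) : (thetaSigns ε).symm = thetaSigns ε := rfl

lemma specialOkamoto_apply (θ : Fin 4 → ℂ) (i : Fin 4) :
    specialOkamoto θ i = θ i - (∑ j, θ j) / 2 + 1 := rfl

lemma specialOkamoto_symm : specialOkamoto.symm = specialOkamoto := rfl

lemma exists_actsOnRegular_of_mem {g : Equiv.Perm (Fin 4 → ℂ)} (hg : g ∈ okamotoGroup) :
    ∃ f, ActsOnRegular g f := by
  induction hg using Subgroup.closure_induction with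
  | mem g hg =>
    rcases hg with ((⟨n, hn, rfl⟩ | ⟨σ, rfl⟩) | ⟨ε, rfl⟩) | hg
    · have hn' : Even (∑ i, (-n) i) := by
        simpa using hn
      refine exists_actsOnRegular (fun θ i => θ i + n i) (fun θ i => θ i + ((-n) i : ℤ))
        (by fun_prop) (by fun_prop) (fun θ => ?_) (fun θ => ?_)
        (fun θ h => regularTheta_translate h hn) (fun θ h => regularTheta_translate h hn')
      · funext i
        simp [thetaTranslation, complexify]
      · funext i
        simp [thetaTranslation, complexify]
    · refine exists_actsOnRegular (fun θ i => θ (σ.symm i)) (fun θ i => θ (σ i))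
        (by fun_prop) (by fun_prop) (fun θ => ?_) (fun θ => ?_)
        (fun θ h => regularTheta_permute h σ.symm) (fun θ h => regularTheta_permute h σ)
      · funext i
        simp [thetaPermutation, complexify]
      · funext i
        simp [thetaPermutation, complexify]
    · refine exists_actsOnRegular (fun θ i => ((ε i : ℤ) : ℝ) * θ i)
        (fun θ i => ((ε i : ℤ) : ℝ) * θ i)
        (by fun_prop) (by fun_prop) (fun θ => ?_) (fun θ => ?_)
        (fun θ h => regularTheta_signs h ε) (fun θ h => regularTheta_signs h ε)
      · funext i
        simp [thetaSigns_apply, complexify]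
      · funext i
        simp [thetaSigns_symm, thetaSigns_apply, complexify]
    · obtain rfl : g = specialOkamoto := hg
      refine exists_actsOnRegular (fun θ i => θ i - (∑ j, θ j) / 2 + 1)
        (fun θ i => θ i - (∑ j, θ j) / 2 + 1)
        (by fun_prop) (by fun_prop) (fun θ => ?_) (fun θ => ?_)
        (fun θ h => regularTheta_okamoto h) (fun θ h => regularTheta_okamoto h)
      · funext i
        simp [specialOkamoto_apply, complexify]
      · funext i
        simp [specialOkamoto_symm, specialOkamoto_apply, complexify]
  | one => exact ⟨Homeomorph.refl _, fun θ => rfl, fun θ => Iff.rfl⟩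
  | mul g g' _ _ h h' =>
    obtain ⟨f, hf⟩ := h
    obtain ⟨f', hf'⟩ := h'
    exact ⟨_, hf.mul hf'⟩
  | inv g _ h =>
    obtain ⟨f, hf⟩ := h
    exact ⟨_, hf.inv⟩

/-! ### Deck transformations -/

/-- The subgroup of Okamoto symmetries that preserve the parameters of the cubic surface. -/
noncomputable def deckGroup : Subgroup (Equiv.Perm (Fin 4 → ℂ)) where
  carrier := {g | g ∈ okamotoGroup ∧ FixesCubicParams g}
  mul_mem' := fun {g g'} h h' =>
    ⟨mul_mem h.1 h'.1, fun θ => by rw [Equiv.Perm.mul_apply, h.2, h'.2]⟩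
  one_mem' := ⟨one_mem _, fun _ => rfl⟩
  inv_mem' := fun {g} h => ⟨inv_mem h.1, fun θ => by
    have := h.2 (g.symm θ)
    rw [Equiv.apply_symm_apply] at this
    exact this.symm⟩

lemma thetaSigns_mem_deckGroup (ε : Fin 4 → ℤˣ) : thetaSigns ε ∈ deckGroup := by
  refine ⟨Subgroup.subset_closure (Or.inl (Or.inr ⟨ε, rfl⟩)), fun θ => ?_⟩
  congr 1
  funext i
  simp only [traceOfTheta, thetaSigns_apply]
  rcases Int.units_eq_one_or (ε i) with h | h <;> simp [h]

lemma thetaTranslation_mem_deckGroup (m : Fin 4 → ℤ) :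
    thetaTranslation (fun i => 2 * m i) ∈ deckGroup := by
  refine ⟨Subgroup.subset_closure (Or.inl (Or.inl (Or.inl ⟨_, ?_, rfl⟩))), fun θ => ?_⟩
  · rw [← Finset.mul_sum]
    exact even_two_mul _
  congr 1
  funext i
  simp only [traceOfTheta, thetaTranslation_apply]
  congr 1
  rw [show (Real.pi : ℂ) * (θ i + ((2 * m i : ℤ) : ℂ)) = Real.pi * θ i + m i * (2 * Real.pi) by
    push_cast; ring]
  exact Complex.cos_add_int_mul_two_pi _ _

/-- The product-to-sum formula removes the half-angles. Products of pairs of new traces thereby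
become polynomials in sines and cosines of the old angles. -/
lemma cos_okamoto_mul (u v w t : ℂ) :
    2 * Complex.cos (u - (u + v + w + t) / 2 + Real.pi) *
      (2 * Complex.cos (v - (u + v + w + t) / 2 + Real.pi))
      = 2 * Complex.cos (w + t) + 2 * Complex.cos (u - v) := by
  rw [Complex.cos_add_pi, Complex.cos_add_pi]
  have e1 : w + t = -((u - (u + v + w + t) / 2) + (v - (u + v + w + t) / 2)) := by ring
  have e2 : u - v = (u - (u + v + w + t) / 2) - (v - (u + v + w + t) / 2) := by ring
  rw [e1, e2, Complex.cos_neg, Complex.cos_add (u - _), Complex.cos_sub (u - _)]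
  ring

lemma cos_okamoto_sq (u v w t : ℂ) :
    (2 * Complex.cos (u - (u + v + w + t) / 2 + Real.pi)) ^ 2
      = 2 + 2 * Complex.cos (u - v - w - t) := by
  rw [Complex.cos_add_pi, show u - v - w - t = 2 * (u - (u + v + w + t) / 2) by ring,
    Complex.cos_two_mul]
  ring

lemma specialOkamoto_mem_deckGroup : specialOkamoto ∈ deckGroup := by
  refine ⟨Subgroup.subset_closure (Or.inr rfl), fun θ => ?_⟩
  obtain ⟨u, hu⟩ : ∃ u, u = Real.pi * θ 0 := ⟨_, rfl⟩
  obtain ⟨v, hv⟩ : ∃ v, v = Real.pi * θ 1 := ⟨_, rfl⟩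
  obtain ⟨w, hw⟩ : ∃ w, w = Real.pi * θ 2 := ⟨_, rfl⟩
  obtain ⟨t, ht⟩ : ∃ t, t = Real.pi * θ 3 := ⟨_, rfl⟩
  have a0 : traceOfTheta (specialOkamoto θ) 0
      = 2 * Complex.cos (u - (u + v + w + t) / 2 + Real.pi) := by
    simp only [traceOfTheta, specialOkamoto_apply, Fin.sum_univ_four, hu, hv, hw, ht]
    congr 2; ring
  have a1 : traceOfTheta (specialOkamoto θ) 1
      = 2 * Complex.cos (v - (u + v + w + t) / 2 + Real.pi) := by
    simp only [traceOfTheta, specialOkamoto_apply, Fin.sum_univ_four, hu, hv, hw, ht]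
    congr 2; ring
  have a2 : traceOfTheta (specialOkamoto θ) 2
      = 2 * Complex.cos (w - (u + v + w + t) / 2 + Real.pi) := by
    simp only [traceOfTheta, specialOkamoto_apply, Fin.sum_univ_four, hu, hv, hw, ht]
    congr 2; ring
  have a3 : traceOfTheta (specialOkamoto θ) 3
      = 2 * Complex.cos (t - (u + v + w + t) / 2 + Real.pi) := by
    simp only [traceOfTheta, specialOkamoto_apply, Fin.sum_univ_four, hu, hv, hw, ht]
    congr 2; ring
  have b0 : traceOfTheta θ 0 = 2 * Complex.cos u := by rw [hu]; rfl
  have b1 : traceOfTheta θ 1 = 2 * Complex.cos v := by rw [hv]; rfl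
  have b2 : traceOfTheta θ 2 = 2 * Complex.cos w := by rw [hw]; rfl
  have b3 : traceOfTheta θ 3 = 2 * Complex.cos t := by rw [ht]; rfl
  -- Both sides equal 2cos(x + y) + 2cos(x - y) + 2cos(z + r) + 2cos(z - r). The three ways of
  -- pairing the angles give A, B and C.
  have perm : ∀ x y z r : ℂ, 2 * Complex.cos (x - (x + y + z + r) / 2 + Real.pi) *
      (2 * Complex.cos (y - (x + y + z + r) / 2 + Real.pi)) +
      2 * Complex.cos (z - (x + y + z + r) / 2 + Real.pi) *
      (2 * Complex.cos (r - (x + y + z + r) / 2 + Real.pi))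
      = 2 * Complex.cos x * (2 * Complex.cos y) + 2 * Complex.cos z * (2 * Complex.cos r) := by
    intro x y z r
    rw [cos_okamoto_mul x y z r, show x + y + z + r = z + r + x + y by ring,
      cos_okamoto_mul z r x y]
    simp only [Complex.cos_add, Complex.cos_sub]
    ring
  have hD : 4 - (2 * Complex.cos (u - (u + v + w + t) / 2 + Real.pi)) ^ 2
      - (2 * Complex.cos (v - (u + v + w + t) / 2 + Real.pi)) ^ 2
      - (2 * Complex.cos (w - (u + v + w + t) / 2 + Real.pi)) ^ 2
      - (2 * Complex.cos (t - (u + v + w + t) / 2 + Real.pi)) ^ 2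
      - 2 * Complex.cos (u - (u + v + w + t) / 2 + Real.pi)
        * (2 * Complex.cos (v - (u + v + w + t) / 2 + Real.pi))
        * (2 * Complex.cos (w - (u + v + w + t) / 2 + Real.pi))
        * (2 * Complex.cos (t - (u + v + w + t) / 2 + Real.pi))
      = 4 - (2 * Complex.cos u) ^ 2 - (2 * Complex.cos v) ^ 2 - (2 * Complex.cos w) ^ 2
        - (2 * Complex.cos t) ^ 2
        - 2 * Complex.cos u * (2 * Complex.cos v) * (2 * Complex.cos w) * (2 * Complex.cos t) := by
    have p1 := cos_okamoto_mul u v w t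
    have p2 := cos_okamoto_mul w t u v
    have s1 := cos_okamoto_sq u v w t
    have s2 := cos_okamoto_sq v u w t
    have s3 := cos_okamoto_sq w t u v
    have s4 := cos_okamoto_sq t w u v
    rw [show w + t + u + v = u + v + w + t by ring] at p2 s3
    rw [show v + u + w + t = u + v + w + t by ring] at s2
    rw [show t + w + u + v = u + v + w + t by ring] at s4
    rw [s1, s2, s3, s4, mul_assoc (2 * Complex.cos (u - (u + v + w + t) / 2 + Real.pi) * _) , p1,
      p2]
    have q1 := Complex.sin_sq_add_cos_sq u
    have q2 := Complex.sin_sq_add_cos_sq v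
    have q3 := Complex.sin_sq_add_cos_sq w
    have q4 := Complex.sin_sq_add_cos_sq t
    simp only [Complex.cos_add, Complex.cos_sub, Complex.sin_sub]
    generalize Complex.cos u = cu at *
    generalize Complex.sin u = su at *
    generalize Complex.cos v = cv at *
    generalize Complex.sin v = sv at *
    generalize Complex.cos w = cw at *
    generalize Complex.sin w = sw at *
    generalize Complex.cos t = ct at *
    generalize Complex.sin t = st at *
    linear_combination 4 * st ^ 2 * q3 + 4 * (1 - cw ^ 2) * q4 + 4 * sv ^ 2 * q1
      + 4 * (1 - cu ^ 2) * q2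
  simp only [cubicParams, a0, a1, a2, a3, b0, b1, b2, b3]
  have pB := perm v w u t
  have pC := perm u w v t
  rw [show v + w + u + t = u + v + w + t by ring] at pB
  rw [show u + w + v + t = u + v + w + t by ring] at pC
  rw [perm u v w t, pB, pC, hD]

/-- The reflections in the walls `± θ₁ ± θ₂ ± θ₃ ± θ₄ = 2k` are deck transformations. -/
lemma exists_reflection_mem_deckGroup (ε : Fin 4 → ℤˣ) (k : ℤ) :
    ∃ g ∈ deckGroup, ∀ θ : Fin 4 → ℝ, g (complexify θ) = complexify fun i =>
      θ i - ((ε i : ℤ) : ℝ) * (∑ j, ((ε j : ℤ) : ℝ) * θ j - 2 * k) / 2 := by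
  -- The special symmetry reflects in the wall where the sum is 2. Translating by 2n, of sum 2(k -
  -- 1), moves this wall to sum 2k, and conjugating by the signs ε gives the general wall.
  let n : Fin 4 → ℤ := ![k - 1, 0, 0, 0]
  have hT := thetaTranslation_mem_deckGroup n
  refine ⟨thetaSigns ε * (thetaTranslation (fun i => 2 * n i) * (specialOkamoto *
    ((thetaTranslation fun i => 2 * n i)⁻¹ * thetaSigns ε))),
    mul_mem (thetaSigns_mem_deckGroup ε) (mul_mem hT (mul_mem specialOkamoto_mem_deckGroup
      (mul_mem (inv_mem hT) (thetaSigns_mem_deckGroup ε)))), fun θ => ?_⟩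
  have hinv : ∀ (φ : Fin 4 → ℂ) i, (thetaTranslation fun i => 2 * n i)⁻¹ φ i
      = φ i - ((2 * n i : ℤ) : ℂ) := fun φ i => by
    show φ i + -((2 * n i : ℤ) : ℂ) = _
    ring
  have hεε : ∀ i, ((ε i : ℤ) : ℂ) * ((ε i : ℤ) : ℂ) = 1 := fun i => by
    rcases Int.units_eq_one_or (ε i) with h | h <;> simp [h]
  have hn : (n 0 : ℂ) + n 1 + n 2 + n 3 = k - 1 := by
    simp [n]
  funext i
  simp only [Equiv.Perm.mul_apply, thetaSigns_apply, thetaTranslation_apply, specialOkamoto_apply,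
    hinv, Fin.sum_univ_four, complexify]
  push_cast
  linear_combination (θ i : ℂ) * hεε i + ((ε i : ℤ) : ℂ) * hn

/-! ### Folding into one chamber -/

/-- `θ` and `θ'` are in the same orbit of the group of deck transformations. -/
def DeckRelated (θ θ' : Fin 4 → ℝ) : Prop := ∃ g ∈ deckGroup, g (complexify θ) = complexify θ'

lemma DeckRelated.refl (θ : Fin 4 → ℝ) : DeckRelated θ θ := ⟨1, one_mem _, rfl⟩

lemma DeckRelated.trans {θ θ' θ'' : Fin 4 → ℝ} (h : DeckRelated θ θ') (h' : DeckRelated θ' θ'') :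
    DeckRelated θ θ'' := by
  obtain ⟨g, hg, h⟩ := h
  obtain ⟨g', hg', h'⟩ := h'
  exact ⟨g' * g, mul_mem hg' hg, by rw [Equiv.Perm.mul_apply, h, h']⟩

lemma DeckRelated.mem_regularTheta {θ θ' : Fin 4 → ℝ} (h : DeckRelated θ θ')
    (hθ : θ ∈ regularTheta) : θ' ∈ regularTheta := by
  obtain ⟨g, hg, h⟩ := h
  obtain ⟨f, hf⟩ := exists_actsOnRegular_of_mem hg.1
  rw [hf.1] at h
  rw [← complexify_injective h]
  exact (hf.2 θ).2 hθ

/-- The open polytope that the hyperplanes `centralForm θ k = 0` cut into the central chambers. -/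
def InCentralCell (θ : Fin 4 → ℝ) : Prop :=
  (∀ i, 0 < θ i ∧ θ i < 1) ∧ ∀ i, 0 < thetaSum θ - 2 * θ i ∧ thetaSum θ - 2 * θ i < 2

lemma exists_deckRelated_unit_cube {θ : Fin 4 → ℝ} (hθ : θ ∈ regularTheta) :
    ∃ θ', DeckRelated θ θ' ∧ ∀ i, 0 < θ' i ∧ θ' i < 1 := by
  choose m ε h using fun i => exists_fold_unit_interval ⌊θ i⌋
  refine ⟨fun i => ((ε i : ℤ) : ℝ) * (θ i - 2 * m i), ⟨thetaSigns ε *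
    (thetaTranslation fun i => 2 * m i)⁻¹, mul_mem (thetaSigns_mem_deckGroup ε)
      (inv_mem (thetaTranslation_mem_deckGroup m)), ?_⟩, fun i => ?_⟩
  · funext i
    show ((ε i : ℤ) : ℂ) * ((θ i : ℂ) + -((2 * m i : ℤ) : ℂ)) = _
    simp only [complexify]
    push_cast
    ring
  · exact h i (θ i) (lt_of_le_of_ne (Int.floor_le _) (hθ.1 i _).symm) (Int.lt_floor_add_one _)

/-- A corner simplex shares a facet, on the wall where `thetaSum θ - 2 * θ i` is 0 or 2, with the
central cell. Reflection in that wall moves it inside. -/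
lemma exists_deckRelated_centralCell {θ : Fin 4 → ℝ} (hθ : θ ∈ regularTheta)
    (h : ∀ i, 0 < θ i ∧ θ i < 1) : ∃ θ', DeckRelated θ θ' ∧ InCentralCell θ' := by
  obtain ⟨c, -, hc⟩ := exists_mem_chamber h hθ
  obtain ⟨h0, h0'⟩ := h 0
  obtain ⟨h1, h1'⟩ := h 1
  obtain ⟨h2, h2'⟩ := h 2
  obtain ⟨h3, h3'⟩ := h 3
  have key : ∀ i k, DeckRelated θ fun j =>
      θ j - (if j = i then -1 else 1) * (thetaSum θ - 2 * θ i - 2 * (k : ℤ)) / 2 := by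
    intro i k
    obtain ⟨g, hg, hgθ⟩ := exists_reflection_mem_deckGroup (Function.update 1 i (-1)) k
    refine ⟨g, hg, ?_⟩
    rw [hgθ]
    congr 1
    funext j
    rw [Fin.sum_univ_four, thetaSum]
    fin_cases i <;> fin_cases j <;> simp [Function.update] <;> ring
  rcases c with ⟨i, _ | _⟩ | ε
  · refine ⟨_, key i 0, fun j => ?_, fun j => ?_⟩ <;> simp only [ChamberCond, thetaSum] at hc ⊢ <;>
      fin_cases i <;> fin_cases j <;> simp at hc ⊢ <;> constructor <;> linarith
  · refine ⟨_, key i 1, fun j => ?_, fun j => ?_⟩ <;> simp only [ChamberCond, thetaSum] at hc ⊢ <;>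
      fin_cases i <;> fin_cases j <;> simp at hc ⊢ <;> constructor <;> linarith
  · exact ⟨θ, DeckRelated.refl θ, h, hc.1⟩

/-- The sign vectors of the forms `centralForm`. -/
def centralSigns : Fin 4 → Fin 4 → ℤˣ :=
  ![![1, 1, 1, 1], ![1, 1, -1, -1], ![1, -1, 1, -1], ![1, -1, -1, 1]]

/-- The reflection in the wall of the k-th form changes its sign. It fixes the other three because
the forms are orthogonal, and it preserves the central cell ∑ |w k| < 2, which depends only on
absolute values. -/
lemma exists_deckRelated_centralForm_pos {θ : Fin 4 → ℝ} (hθ : θ ∈ regularTheta)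
    (hc : InCentralCell θ) (k : Fin 4) :
    ∃ θ', DeckRelated θ θ' ∧ InCentralCell θ' ∧ 0 < centralForm θ' k ∧
      ∀ j, j ≠ k → centralForm θ' j = centralForm θ j := by
  by_cases hk : 0 < centralForm θ k
  · exact ⟨θ, DeckRelated.refl θ, hc, hk, fun _ _ => rfl⟩
  have hk' : centralForm θ k < 0 := by
    refine lt_of_le_of_ne (not_lt.1 hk) fun h0 => ?_
    -- The form with index 0 is the coordinate sum minus 2, so its wall has level 2 · 1. The other
    -- three walls pass through level 0.
    have h := hθ.2 (centralSigns k) (if k = 0 then 1 else 0)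
    rw [Fin.sum_univ_four] at h
    fin_cases k <;> simp [centralSigns, centralForm] at h h0 <;> exact h (by linarith)
  obtain ⟨g, hg, hgθ⟩ := exists_reflection_mem_deckGroup (centralSigns k) (if k = 0 then 1 else 0)
  have e : (fun i => θ i - ((centralSigns k i : ℤ) : ℝ) *
      (∑ j, ((centralSigns k j : ℤ) : ℝ) * θ j - 2 * ((if k = 0 then 1 else 0 : ℤ) : ℝ)) / 2)
      = fun i => θ i - ((centralSigns k i : ℤ) : ℝ) * centralForm θ k / 2 := by
    funext i
    congr 3
    rw [Fin.sum_univ_four]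
    fin_cases k <;> simp [centralSigns, centralForm] <;> ring
  specialize hgθ θ
  rw [e] at hgθ
  obtain ⟨hu, hc⟩ := hc
  obtain ⟨h0, h0'⟩ := hu 0
  obtain ⟨h1, h1'⟩ := hu 1
  obtain ⟨h2, h2'⟩ := hu 2
  obtain ⟨h3, h3'⟩ := hu 3
  obtain ⟨c0, c0'⟩ := hc 0
  obtain ⟨c1, c1'⟩ := hc 1
  obtain ⟨c2, c2'⟩ := hc 2
  obtain ⟨c3, c3'⟩ := hc 3
  unfold thetaSum at c0 c0' c1 c1' c2 c2' c3 c3'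
  refine ⟨_, ⟨g, hg, hgθ⟩, ⟨fun i => ?_, fun i => ?_⟩, ?_, fun j hj => ?_⟩
  · fin_cases k <;> fin_cases i <;> simp [centralSigns, centralForm] <;> constructor <;> linarith
  · unfold thetaSum
    fin_cases k <;> fin_cases i <;> simp [centralSigns, centralForm] <;> constructor <;> linarith
  · fin_cases k <;> simp [centralSigns, centralForm] at hk' ⊢ <;> linarith
  · fin_cases k <;> fin_cases j <;> first
      | exact absurd rfl hj
      | (simp [centralSigns, centralForm]; ring)

/-- A chamber into which all regular angles can be moved by deck transformations. -/
def baseChamber : Set (Fin 4 → ℝ) := chamber (Sum.inr fun _ => true)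

/-- Fold into the unit cube, then into the cross-polytope, then make the four central forms positive
one at a time. Each step leaves the signs already arranged untouched. -/
lemma exists_deckRelated_baseChamber {θ : Fin 4 → ℝ} (hθ : θ ∈ regularTheta) :
    ∃ θ' ∈ baseChamber, DeckRelated θ θ' := by
  obtain ⟨θ₁, r₁, h₁⟩ := exists_deckRelated_unit_cube hθ
  obtain ⟨θ₂, r₂, h₂⟩ := exists_deckRelated_centralCell (r₁.mem_regularTheta hθ) h₁
  have r₂ := r₁.trans r₂
  obtain ⟨φ, r₃, h₃, p₀, -⟩ := exists_deckRelated_centralForm_pos (r₂.mem_regularTheta hθ) h₂ 0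
  have r₃ := r₂.trans r₃
  obtain ⟨φ₁, r₄, h₄, p₁, e₁⟩ := exists_deckRelated_centralForm_pos (r₃.mem_regularTheta hθ) h₃ 1
  have r₄ := r₃.trans r₄
  obtain ⟨φ₂, r₅, h₅, p₂, e₂⟩ := exists_deckRelated_centralForm_pos (r₄.mem_regularTheta hθ) h₄ 2
  have r₅ := r₄.trans r₅
  obtain ⟨φ₃, r₆, h₆, p₃, e₃⟩ := exists_deckRelated_centralForm_pos (r₅.mem_regularTheta hθ) h₅ 3
  refine ⟨φ₃, ⟨h₆.1, h₆.2, fun k => ?_⟩, r₅.trans r₆⟩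
  simp only [boolSign, if_true, one_mul]
  fin_cases k
  · show 0 < centralForm φ₃ 0
    rwa [e₃ 0 (by decide), e₂ 0 (by decide), e₁ 0 (by decide)]
  · show 0 < centralForm φ₃ 1
    rwa [e₃ 1 (by decide), e₂ 1 (by decide)]
  · show 0 < centralForm φ₃ 2
    rwa [e₃ 2 (by decide)]
  · exact p₃

/-- The group of deck transformations is transitive on components of the set of regular angles. -/
lemma exists_deck_mem_component {θ θ' : Fin 4 → ℝ} (hθ : θ ∈ regularTheta)
    (hθ' : θ' ∈ regularTheta) :
    ∃ g ∈ deckGroup, ∃ f, ActsOnRegular g f ∧ f θ ∈ connectedComponentIn regularTheta θ' := by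
  obtain ⟨φ, hφ, g, hg, hgφ⟩ := exists_deckRelated_baseChamber hθ
  obtain ⟨φ', hφ', g', hg', hgφ'⟩ := exists_deckRelated_baseChamber hθ'
  obtain ⟨f, hf⟩ := exists_actsOnRegular_of_mem hg.1
  obtain ⟨f', hf'⟩ := exists_actsOnRegular_of_mem hg'.1
  rw [hf.1] at hgφ
  rw [hf'.1] at hgφ'
  have e := complexify_injective hgφ
  have e' := complexify_injective hgφ'
  -- Fold θ forward and unfold along the path of θ'. The two images in the base chamber need not
  -- agree, but convexity puts them in one component.
  refine ⟨g'⁻¹ * g, mul_mem (inv_mem hg') hg, _, hf'.inv.mul hf, ?_⟩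
  show f'.symm (f θ) ∈ _
  have h1 : φ ∈ connectedComponentIn regularTheta φ' :=
    (convex_chamber _).isPreconnected.subset_connectedComponentIn hφ'
      (chamber_subset_regularTheta _) hφ
  have h2 := hf'.inv.image_component (chamber_subset_regularTheta _ hφ')
  rw [e, show θ' = f'.symm φ' by rw [← e', f'.symm_apply_apply], ← h2]
  exact Set.mem_image_of_mem _ h1

theorem mainTheorem11 :
    (componentsOf regularCube).ncard = 24 ∧
    {U ∈ componentsOf regularCube | CorrespondsToSL2R U}.ncard = 8 ∧
    {U ∈ componentsOf regularCube | CorrespondsToSU2 U}.ncard = 16 ∧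
    (∀ U ∈ componentsOf regularCube, ∃ s, IsThetaDetermination U s) ∧
    (∀ g ∈ okamotoGroup, ∀ U ∈ componentsOf regularCube, ∀ s, IsThetaDetermination U s →
      ∃ V ∈ componentsOf regularCube, OkamotoCarries g s U V) ∧
    (∀ U ∈ componentsOf regularCube, ∀ V ∈ componentsOf regularCube,
      ∀ s, IsThetaDetermination U s →
        ∃ g ∈ okamotoGroup, FixesCubicParams g ∧ OkamotoCarries g s U V) := by
  have hne : ∀ U ∈ componentsOf regularCube, ∃ p, p ∈ U := by
    rintro _ ⟨p, hp, rfl⟩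
    exact ⟨p, mem_connectedComponentIn hp⟩
  refine ⟨ncard_components, ncard_components_SL2R, ncard_components_SU2, ?_, ?_, ?_⟩
  · rintro _ ⟨p, hp, rfl⟩
    exact exists_thetaDetermination fun v hv => (connectedComponentIn_subset _ _ hv).1
  · intro g hg U hU s hs
    obtain ⟨p, hp⟩ := hne U hU
    obtain ⟨θ, hθ, -, h⟩ := okamotoCarries_component hU hs hp
    obtain ⟨f, hf⟩ := exists_actsOnRegular_of_mem hg
    exact ⟨_, ⟨_, cosTrace_mem_regularCube_iff.2 ((hf.2 θ).2 hθ), rfl⟩, h g f hf⟩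
  · rintro U hU _ ⟨v, hv, rfl⟩ s hs
    obtain ⟨p, hp⟩ := hne U hU
    obtain ⟨θ, hθ, -, h⟩ := okamotoCarries_component hU hs hp
    have hv' : arccosTheta v ∈ regularTheta := by
      rw [← cosTrace_mem_regularCube_iff, cosTrace_arccosTheta hv.1]
      exact hv
    obtain ⟨g, hg, f, hf, hmem⟩ := exists_deck_mem_component hθ hv'
    refine ⟨g, hg.1, hg.2, ?_⟩
    -- The moved angle lies in the cell of `arccosTheta v`, so its trace vector lies in the
    -- component of v, which is therefore the component reached.
    have h1 := (bijOn_cosTrace_component hv').mapsTo hmem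
    rw [cosTrace_arccosTheta hv.1] at h1
    rw [connectedComponentIn_eq h1]
    exact h g f hf
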